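/- **Conventions.** Let $k$ be a commutative ring of characteristic $2$ with two elements $w,z\in k$. The *unspecialized* case is $k=\mathbb F_2[w,z]$; the *hat* versions are obtained for $k=\mathbb F_2$, $w=z=0$. Everything is over $k$; there are no signs. **The algebras.** An $I$-state for $(m,r)$ is an $r$-element subset $\mathbf x\subset\{0,\dots,m\}$; put $v_i(\mathbf x)=\#\{a\in\mathbf x: a\ge i\}$. The algebra $\mathcal B_0(m,r)$ has a $k$-basis of elements $b_{\mathbf x,\mathbf y,W}=I_{\mathbf x}\, b_{\mathbf x,\mathbf y,W}\, I_{\mathbf y}$ indexed by pairs of $I$-states and weight vectors $W\in(\tfrac12\mathbb Z)^m$ with $W_i-\tfrac12|v_i(\mathbf x)-v_i(\mathbf y)|\in\mathbb Z_{\ge0}$; the product $I_{\mathbf x}\mathcal B_0I_{\mathbf y}\otimes I_{\mathbf y}\mathcal B_0I_{\mathbf u}\to I_{\mathbf x}\mathcal B_0 I_{\mathbf u}$ of two basis elements is the basis element of the summed weight. $U_i$ is the sum over $\mathbf x$ of the elements of $I_{\mathbf x}\mathcal B_0I_{\mathbf x}$ of weight $e_i$; $L_i$ (resp. $R_i$)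 is the sum of the elements of weight $\tfrac12e_i$ from $\mathbf x$ to $\mathbf y$, where $\mathbf y$ is obtained from $\mathbf x$ by moving an element $i$ to $i-1$ (resp. $i-1$ to $i$). $\mathcal B(m,r)$ is the quotient of $\mathcal B_0(m,r)$ by the two-sided ideal generated by $L_{i+1}L_i$, $R_iR_{i+1}$, and $U_iI_{\mathbf x}$ for $\mathbf x\cap\{i-1,i\}=\emptyset$. Let $M$ be a matching (fixed-point-free involution) on $\{1,\dots,2n\}$. $\mathcal B(n,M)$ denotes $\mathcal B(2n,n)$ with zero differential and curvature $\mu_0=\sum_{\{i,j\}\in M}U_iU_j$. $\mathcal B'(n,M)$ denotes the differential algebra obtained from $\mathcal B(2n,n+1)$ by adjoining $E_1,\dots,E_{2n}$ that commute with $\mathcal B(2n,n+1)$ and satisfy $E_i^2=0$, $[E_i,E_j]=1$ if $\{i,j\}\in M$ and $0$ otherwise; its differential is the derivation with $d=0$ on $\mathcal B(2n,n+1)$ and $dE_i=U_i$. **The canonical DD bimodule.** ${}^{\mathcal B(n,M),\mathcal B'(n,M)}\mathcal K$ has one generator $g_{\mathbf x}$ for each $I$-state $\mathbf x$ for $(2n,n)$,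 with idempotents $I_{\mathbf x}\otimes I_{\{0,\dots,2n\}\setminus\mathbf x}$, and $\delta^1$ is multiplication by $\sum_{i=1}^{2n}(L_i\otimes R_i+R_i\otimes L_i+U_i\otimes E_i)$. **Setup.** Let $n\ge0$, let $M_2$ be a matching on $\{1,\dots,2n\}$, and let $M_1$ be the matching on $\{1,\dots,2n+2\}$ with $\{1,2\}\in M_1$ and $\{i+2,j+2\}\in M_1\iff\{i,j\}\in M_2$. Write $\mathcal B_1=\mathcal B(n+1,M_1)$, $\mathcal B_2=\mathcal B(n,M_2)$, $\mathcal B'_1=\mathcal B'(n+1,M_1)$, $\mathcal B_2'=\mathcal B'(n,M_2)$. For a subset $\mathbf x\subset\{0,\dots,2n+2\}$ with $|\mathbf x\cap\{0,1,2\}|\in\{1,2\}$, let $\psi(\mathbf x)\subset\{0,\dots,2n\}$ contain $0$ iff $|\mathbf x\cap\{0,1,2\}|=2$, and contain $i>0$ iff $i+2\in\mathbf x$. **MarkedMin** (output algebra $\mathcal B_2$, input algebra $\mathcal B_1$). There are six types $X_0,X_1,X_2,Y_0,Y_1,Y_2$. Each type $T$ has one generator for each $I$-state $\mathbf x$ for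 $(2n+2,n+1)$ such that $\mathbf x\cap\{0,1,2\}$ is $\{0\}$ or $\{0,2\}$ for $X_0,Y_0$; is $\{1\}$ or $\{1,2\}$ for $X_1,Y_1$; and is $\{2\}$ for $X_2,Y_2$. The right idempotent is $I_{\mathbf x}$, the left idempotent is $I_{\psi(\mathbf x)}$. For a basis element $b$ from $\mathbf x$ to $\mathbf y$ with $W_1(b)=W_2(b)=0$ (weights), $\Psi(b)$ is the element of $\mathcal B_2$ from $\psi(\mathbf x)$ to $\psi(\mathbf y)$ with $i$-th weight $W_{i+2}(b)$. The operations are given by $\delta^1_2(X,b)=\Psi(b)\otimes X$ within each type, together with the following labelled arrows for all $p,q\ge0$: - no input: $Y_1\to X_1$: $wz$; $Y_2\to X_2$: $w$; $Y_0\to X_0$: $z$. - one input: $X_1\to X_2$: $z^q\otimes R_2U_2^q$; $X_2\to X_1$: $z^{q+1}\otimes L_2U_2^q$; $X_1\to X_0$: $w^p\otimes L_1U_1^p$; $X_0\to X_1$: $w^{p+1}\otimes R_1U_1^p$; $Y_2\to Y_1$: $z^q\otimes L_2U_2^q$; $Y_1\to Y_2$: $z^{q+1}\otimes R_2U_2^q$;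 $Y_0\to Y_1$: $w^p\otimes R_1U_1^p$; $Y_1\to Y_0$: $w^{p+1}\otimes L_1U_1^p$; loops: $w^{p+1}\otimes U_1^{p+1}$ at $X_0,X_1,Y_0,Y_1$, and $z^{q+1}\otimes U_2^{q+1}$ at $X_1,X_2,Y_1,Y_2$. - two inputs, with coefficient $w^pz^q$: $X_1\to Y_1$: $(U_1^{p+1},U_2^{q+1})+(U_2^{q+1},U_1^{p+1})$; $X_0\to Y_2$: $(R_1U_1^p,R_2U_2^q)$; $X_2\to Y_0$: $(L_2U_2^q,L_1U_1^p)$; $X_1\to Y_0$: $(U_2^{q+1},L_1U_1^p)$; $X_1\to Y_2$: $(U_1^{p+1},R_2U_2^q)$; $X_2\to Y_1$: $(L_2U_2^q,U_1^{p+1})$; $X_0\to Y_1$: $(R_1U_1^p,U_2^{q+1})$. An arrow with input labels $a_1,\dots,a_s$ acts on inputs obtained from the $a_i$ by multiplication with elements $b_i$ as above, with output the coefficient times $\Psi(b_1)\cdots\Psi(b_s)$: a basis element between the relevant states contributes exactly when its first two weights are those of $a_i$, and it then contributes the element between the $\psi$-images of these states whose $i$-th weight is its $(i+2)$-nd weight;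 for two inputs, the intermediate state meets $\{0,1,2\}$ in $\{1\}$ or $\{1,2\}$. There are no operations with three or more inputs. **The dual module** $\mathrm{MarkedMin}'$ (output algebra $\mathcal B'_1$, input algebra $\mathcal B'_2$). There are six types $X_i',Y_i'$. Each has one generator for each $I$-state $\mathbf x$ for $(2n+2,n+2)$ such that $\mathbf x\cap\{0,1,2\}$ is $\{1\}$ or $\{1,2\}$ for $X'_0,Y'_0$; is $\{0\}$ or $\{0,2\}$ for $X_1',Y_1'$; and is $\{0,1\}$ for $X'_2,Y'_2$. The left idempotent is $I_{\mathbf x}$ and the right idempotent is $I_{\psi(\mathbf x)}$. The operation $\delta^1_1$ is given by multiplication by the following elements: - $X_1'\to X_2'$: $L_2$; $X_2'\to X_1'$: $zR_2$; $X_1'\to X_0'$: $R_1$; $X_0'\to X_1'$: $wL_1$; $X_1'\to Y_1'$: $[E_1,E_2]=1$; $Y_1'\to X_1'$: $wz$; $X_0'\to Y_2'$: $L_1L_2$; $Y_2'\to Y_1'$: $R_2$; $Y_1'\to Y_2'$: $zL_2$; $X_2'\to Y_0'$: $R_2R_1$; $Y_0'\to Y_1'$: $L_1$; $Y_1'\to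 Y_0'$: $wR_1$; $X_1'\to Y_0'$: $E_2R_1$; $X_1'\to Y_2'$: $E_1L_2$; $X_2'\to Y_1'$: $R_2E_1$; $X_0'\to Y_1'$: $L_1E_2$; $Y_2'\to X_2'$: $w$; $Y_0'\to X_0'$: $z$; - loops: $wE_1+zE_2$ at $X_1',Y_1'$; $wE_1$ at $X_0',Y_0'$; $zE_2$ at $X_2',Y_2'$. The operation $\delta^1_2(P,b)$, for a generator $P$ with left idempotent $\mathbf x$ and a basis element $b=I_{\psi(\mathbf x)}\,b\,I_{\mathbf u}$ of $\mathcal B(2n,n+1)$, is $b'\otimes P'$, where $P'$ is the generator of the same type as $P$ with right idempotent $I_{\mathbf u}$ (if there is none, the result is $0$), $\mathbf y$ is the left idempotent of $P'$, and $b'=I_{\mathbf x}\,b'\,I_{\mathbf y}$ has weights $W_1(b')=W_2(b')=0$ and $W_{i+2}(b')=W_i(b)$; it is extended to $\mathcal B'_2$ by $\delta^1_2(P,E_i\cdot b)=E_{i+2}\cdot\delta^1_2(P,b)$. There are no operations with two or more inputs. **Proposition.** With these operations, the dual module is a (strictly unital) type $DA$ bimodule ${}^{\mathcal B'_1}\mathrm{MarkedMin}'_{\mathcal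 B'_2}$: the operations are well defined, linear, compatible with the idempotents, and satisfy the type $DA$ structure equation. Moreover the two box tensor products $${}^{\mathcal B'_1}\mathrm{MarkedMin}'_{\mathcal B'_2}\boxtimes{}^{\mathcal B'_2,\mathcal B_2}\mathcal K\;\simeq\;{}^{\mathcal B_2}\mathrm{MarkedMin}_{\mathcal B_1}\boxtimes{}^{\mathcal B_1,\mathcal B'_1}\mathcal K$$ are curved type $D$ structures over $\mathcal B_2\otimes_k\mathcal B_1'$ (that is, type $DD$ bimodules over $\mathcal B_2$ and $\mathcal B'_1$) and are homotopy equivalent as such. This holds in the unspecialized case $k=\mathbb F_2[w,z]$ and for the hat versions $k=\mathbb F_2$, $w=z=0$. -/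

import Mathlib

open scoped TensorProduct

namespace LinkBordered

noncomputable section

/-! ### Idempotent states and weights -/

/-- An idempotent state (`I`-state) for `B(m, r)`: an `r`-element subset of `{0, ..., m}`. -/
abbrev IState (m r : ℕ) : Type := {x : Finset (Fin (m + 1)) // x.card = r}

/-- `x.Has t` says that `t ∈ x`. -/
def IState.Has {m r : ℕ} (x : IState m r) (t : ℕ) : Prop := ∃ a ∈ x.1, a.val = t

/-- `x.height t` is the number of elements of `x` that are `≥ t`. -/
def IState.height {m r : ℕ} (x : IState m r) (t : ℕ) : ℕ :=
  (x.1.filter (fun a => t ≤ a.val)).card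

open Classical in
theorem IState.height_succ {m r : ℕ} (x : IState m r) (t : ℕ) :
    x.height t = x.height (t + 1) + if x.Has t then 1 else 0 := by
  unfold IState.height IState.Has
  have h : x.1.filter (fun a => t ≤ a.val) =
      x.1.filter (fun a => t + 1 ≤ a.val) ∪ x.1.filter (fun a => a.val = t) := by
    ext a; simp only [Finset.mem_filter, Finset.mem_union]; constructor
    · rintro ⟨h1, h2⟩
      rcases Nat.lt_or_ge t a.val with h3 | h3
      · exact Or.inl ⟨h1, h3⟩
      · exact Or.inr ⟨h1, by omega⟩
    · rintro (⟨h1, h2⟩ | ⟨h1, h2⟩)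
      · exact ⟨h1, by omega⟩
      · exact ⟨h1, by omega⟩
  rw [h, Finset.card_union_of_disjoint]
  · congr 1
    split_ifs with h1
    · obtain ⟨a, ha, hat⟩ := h1
      rw [Finset.card_eq_one]
      refine ⟨a, ?_⟩
      ext b; simp only [Finset.mem_filter, Finset.mem_singleton]
      constructor
      · rintro ⟨_, hb⟩; exact Fin.ext (by omega)
      · rintro rfl; exact ⟨ha, hat⟩
    · rw [Finset.card_eq_zero]
      ext b; simp only [Finset.mem_filter, Finset.notMem_empty, iff_false]
      rintro ⟨h2, h3⟩; exact h1 ⟨b, h2, h3⟩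
  · rw [Finset.disjoint_left]
    intro a; simp only [Finset.mem_filter]
    rintro ⟨_, h1⟩ ⟨_, h2⟩; omega

theorem IState.height_zero {m r : ℕ} (x : IState m r) : x.height 0 = r := by
  unfold IState.height
  simp [x.2]

theorem IState.height_top {m r : ℕ} (x : IState m r) {t : ℕ} (h : m + 1 ≤ t) :
    x.height t = 0 := by
  unfold IState.height
  rw [Finset.card_eq_zero]
  ext b; simp only [Finset.mem_filter, Finset.notMem_empty, iff_false]
  rintro ⟨_, h3⟩; have := b.2; omega

theorem IState.height_step {m r : ℕ} (x : IState m r) (t : ℕ) :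
    x.height (t + 1) ≤ x.height t ∧ x.height t ≤ x.height (t + 1) + 1 := by
  classical
  rw [x.height_succ t]; split_ifs <;> omega

theorem IState.not_has_iff {m r : ℕ} (x : IState m r) (t : ℕ) :
    ¬ x.Has t ↔ x.height t = x.height (t + 1) := by
  classical
  rw [x.height_succ t]; split_ifs with h <;> simp [h]

theorem IState.has_iff {m r : ℕ} (x : IState m r) (t : ℕ) :
    x.Has t ↔ x.height t = x.height (t + 1) + 1 := by
  classical
  rw [x.height_succ t]; split_ifs with h <;> simp [h]

theorem IState.has_lt {m r : ℕ} (x : IState m r) {t : ℕ} (h : x.Has t) : t < m + 1 := by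
  obtain ⟨a, _, rfl⟩ := h; exact a.2

theorem IState.mem_iff_has {m r : ℕ} (x : IState m r) (a : Fin (m + 1)) :
    a ∈ x.1 ↔ x.Has a.val :=
  ⟨fun h => ⟨a, h, rfl⟩, fun ⟨b, hb, hba⟩ => by rwa [← Fin.ext hba]⟩

theorem IState.ext_height {m r : ℕ} {x y : IState m r}
    (h : ∀ t, x.height t = y.height t) : x = y := by
  apply Subtype.ext
  ext a
  rw [x.mem_iff_has, y.mem_iff_has, x.has_iff, y.has_iff, h, h]

/-- Every monotone lattice path is the height function of an `I`-state. -/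
theorem IState.exists_of_path {m r : ℕ} (f : ℕ → ℕ) (h0 : f 0 = r) (h1 : f (m + 1) = 0)
    (h2 : ∀ t, t ≤ m → f (t + 1) ≤ f t ∧ f t ≤ f (t + 1) + 1) :
    ∃ z : IState m r, ∀ t, t ≤ m + 1 → z.height t = f t := by
  classical
  let s : Finset (Fin (m + 1)) := Finset.univ.filter (fun a => f a.val ≠ f (a.val + 1))
  let s' : IState m s.card := ⟨s, rfl⟩
  have key : ∀ j t, t + j = m + 1 → s'.height t = f t := by
    intro j
    induction j with
    | zero =>
      intro t ht
      have : t = m + 1 := by omega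
      subst this
      rw [h1, s'.height_top le_rfl]
    | succ j ih =>
      intro t ht
      have := h2 t (by omega)
      rw [s'.height_succ, ih (t + 1) (by omega)]
      have hs : s'.Has t ↔ f t ≠ f (t + 1) := by
        constructor
        · rintro ⟨a, ha, rfl⟩; exact (Finset.mem_filter.1 ha).2
        · intro h; exact ⟨⟨t, by omega⟩, Finset.mem_filter.2 ⟨Finset.mem_univ _, h⟩, rfl⟩
      split_ifs with h
      · rw [hs] at h; omega
      · rw [hs, not_not] at h; omega
  have hc : s.card = r := by
    rw [← h0, ← key (m + 1) 0 (by omega), s'.height_zero]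
  exact ⟨⟨s, hc⟩, fun t ht => key (m + 1 - t) t (by omega)⟩

/-- Twice the weight vectors of the basis elements of `I_x · B_0(m, r) · I_y`: the `i`-th
entry is `|v_i(x) - v_i(y)|` plus a nonnegative even number, where `v_i = height i`.
The index `i : Fin m` stands for the index `i + 1 ∈ {1, ..., m}` of the usual notation. -/
def IsWeight {m r : ℕ} (x y : IState m r) (W : Fin m →₀ ℕ) : Prop :=
  ∀ i : Fin m, ∃ t : ℕ,
    W i = ((x.height (i.val + 1) : ℤ) - (y.height (i.val + 1) : ℤ)).natAbs + 2 * t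

theorem IsWeight.zero {m r : ℕ} (x : IState m r) : IsWeight x x 0 :=
  fun i => ⟨0, by simp⟩

theorem IsWeight.add {m r : ℕ} {x y z : IState m r} {W V : Fin m →₀ ℕ}
    (hW : IsWeight x y W) (hV : IsWeight y z V) : IsWeight x z (W + V) := by
  intro i
  obtain ⟨s, hs⟩ := hW i
  obtain ⟨t, ht⟩ := hV i
  rw [Finsupp.add_apply, hs, ht]
  refine ⟨((((x.height (i.val + 1) : ℤ) - (y.height (i.val + 1) : ℤ)).natAbs + 2 * s) +
    (((y.height (i.val + 1) : ℤ) - (z.height (i.val + 1) : ℤ)).natAbs + 2 * t) -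
    ((x.height (i.val + 1) : ℤ) - (z.height (i.val + 1) : ℤ)).natAbs) / 2, ?_⟩
  omega

/-! ### The algebra `B_0(m, r)` -/

variable (k : Type) [CommRing k]

/-- The algebra `B_0(m, r)` with ground ring `k`, as an algebra of matrices indexed by
`I`-states. The variable `X i` plays the role of the square root of `U_{i+1}`; the monomial
`X ^ W` in the `(x, y)` entry is the basis element of `I_x · B_0 · I_y` of weight `W / 2`. In this
form the product is the (unique) weight-preserving one. -/
def B0 (m r : ℕ) : Subalgebra k (Matrix (IState m r) (IState m r) (MvPolynomial (Fin m) k)) where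
  carrier := {a | ∀ x y, ∀ W ∈ (a x y).support, IsWeight x y W}
  mul_mem' := by
    classical
    intro a b ha hb x y W hW
    rw [Matrix.mul_apply] at hW
    have h1 := MvPolynomial.support_sum hW
    simp only [Finset.mem_biUnion] at h1
    obtain ⟨z, _, hz⟩ := h1
    have h2 := MvPolynomial.support_mul _ _ hz
    obtain ⟨V, hV, V', hV', rfl⟩ := Finset.mem_add.1 h2
    exact (ha x z V hV).add (hb z y V' hV')
  add_mem' := by
    classical
    intro a b ha hb x y W hW
    rcases Finset.mem_union.1 (MvPolynomial.support_add hW) with h | h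
    · exact ha x y W h
    · exact hb x y W h
  algebraMap_mem' := by
    classical
    intro c x y W hW
    rw [Matrix.algebraMap_matrix_apply] at hW
    split_ifs at hW with h
    · subst h
      rw [MvPolynomial.algebraMap_eq, MvPolynomial.mem_support_iff, MvPolynomial.coeff_C] at hW
      have : W = 0 := by
        by_contra h
        exact hW (if_neg (fun h' => h h'.symm))
      subst this
      exact IsWeight.zero x
    · simp at hW

theorem B0.mem_iff {m r : ℕ} {a : Matrix (IState m r) (IState m r) (MvPolynomial (Fin m) k)} :
    a ∈ B0 k m r ↔ ∀ x y, ∀ W ∈ (a x y).support, IsWeight x y W := Iff.rfl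

open Classical in
theorem B0.single_mem {m r : ℕ} (x y : IState m r) (p : MvPolynomial (Fin m) k)
    (hp : ∀ W ∈ p.support, IsWeight x y W) : Matrix.single x y p ∈ B0 k m r := by
  intro x' y' W hW
  rw [Matrix.single_apply] at hW
  split_ifs at hW with h
  · obtain ⟨rfl, rfl⟩ := h
    exact hp W hW
  · simp at hW

open Classical in
/-- The element `p` of `I_x · B_0 · I_y`. -/
def B0.elt {m r : ℕ} (x y : IState m r) (p : MvPolynomial (Fin m) k)
    (hp : ∀ W ∈ p.support, IsWeight x y W) : B0 k m r :=
  ⟨Matrix.single x y p, B0.single_mem k x y p hp⟩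

theorem isWeight_of_mem_support_monomial {m r : ℕ} {x y : IState m r} {W V : Fin m →₀ ℕ} {c : k}
    (h : IsWeight x y W) (hV : V ∈ (MvPolynomial.monomial W c).support) : IsWeight x y V := by
  have := MvPolynomial.support_monomial_subset hV
  rw [Finset.mem_singleton] at this
  rwa [this]

/-- The idempotent `I_x` of `B_0(m, r)`. -/
def B0.idem {m r : ℕ} (x : IState m r) : B0 k m r :=
  B0.elt k x x 1 (by
    intro W hW
    rw [← MvPolynomial.C_1] at hW
    exact isWeight_of_mem_support_monomial k (IsWeight.zero x) hW)

/-- `y` is obtained from `x` by moving the element `i + 1` of `x` to the unoccupied place `i`. -/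
def MovesLeft {m r : ℕ} (i : Fin m) (x y : IState m r) : Prop :=
  i.succ ∈ x.1 ∧ i.castSucc ∉ x.1 ∧ y.1 = insert i.castSucc (x.1.erase i.succ)

theorem MovesLeft.has_iff {m r : ℕ} {i : Fin m} {x y : IState m r} (h : MovesLeft i x y)
    (t : ℕ) : y.Has t ↔ t = i.val ∨ (t ≠ i.val + 1 ∧ x.Has t) := by
  obtain ⟨h1, h2, h3⟩ := h
  constructor
  · rintro ⟨a, ha, rfl⟩
    rw [h3, Finset.mem_insert, Finset.mem_erase] at ha
    rcases ha with rfl | ⟨h4, h5⟩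
    · left; simp
    · right
      exact ⟨fun h => h4 (Fin.ext (by simpa using h)), a, h5, rfl⟩
  · rintro (rfl | ⟨h4, a, ha, rfl⟩)
    · exact ⟨i.castSucc, by rw [h3]; exact Finset.mem_insert_self _ _, by simp⟩
    · refine ⟨a, ?_, rfl⟩
      rw [h3, Finset.mem_insert, Finset.mem_erase]
      right
      exact ⟨fun h => h4 (by rw [h]; simp), ha⟩

theorem MovesLeft.height_eq {m r : ℕ} {i : Fin m} {x y : IState m r} (h : MovesLeft i x y)
    (t : ℕ) (ht : t ≠ i.val + 1) : y.height t = x.height t := by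
  classical
  have hi := i.2
  have hx1 : x.Has (i.val + 1) := ⟨_, h.1, by simp⟩
  have hx0 : ¬ x.Has i.val := fun h' =>
    h.2.1 ((x.mem_iff_has _).2 (by simpa using h'))
  have hy0 : y.Has i.val := (h.has_iff _).2 (Or.inl rfl)
  have hy1 : ¬ y.Has (i.val + 1) := fun h' => by
    rcases (h.has_iff _).1 h' with h | h
    · omega
    · exact h.1 rfl
  have key : ∀ j t, t + j = m + 1 → t ≠ i.val + 1 → y.height t = x.height t := by
    intro j
    induction j using Nat.strong_induction_on with
    | _ j ih =>
      intro t ht hti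
      rcases Nat.eq_zero_or_pos j with rfl | hj
      · rw [y.height_top (by omega), x.height_top (by omega)]
      · by_cases h5 : t = i.val
        · rw [y.height_succ, y.height_succ, x.height_succ, x.height_succ (t + 1),
            ih (j - 2) (by omega) (t + 1 + 1) (by omega) (by omega)]
          subst h5
          simp [hx0, hx1, hy0, hy1]
        · rw [y.height_succ, x.height_succ, ih (j - 1) (by omega) (t + 1) (by omega) (by omega)]
          have : y.Has t ↔ x.Has t := by
            rw [h.has_iff]
            constructor
            · rintro (h | h)
              · omega
              · exact h.2
            · intro h; exact Or.inr ⟨hti, h⟩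
          simp only [this]
  rcases Nat.lt_or_ge (m + 1) t with h5 | h5
  · rw [y.height_top (by omega), x.height_top (by omega)]
  · exact key (m + 1 - t) t (by omega) ht

theorem MovesLeft.height_eq' {m r : ℕ} {i : Fin m} {x y : IState m r} (h : MovesLeft i x y) :
    x.height (i.val + 1) = y.height (i.val + 1) + 1 := by
  have h1 := h.height_eq i.val (by omega)
  have hx0 : ¬ x.Has i.val := fun h' =>
    h.2.1 ((x.mem_iff_has _).2 (by simpa using h'))
  have hy0 : y.Has i.val := (h.has_iff _).2 (Or.inl rfl)
  rw [x.not_has_iff] at hx0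
  rw [y.has_iff] at hy0
  omega

theorem movesLeft_of_height {m r : ℕ} {i : Fin m} {x y : IState m r}
    (h1 : ∀ t, t ≠ i.val + 1 → y.height t = x.height t)
    (h2 : x.height (i.val + 1) = y.height (i.val + 1) + 1) : MovesLeft i x y := by
  have e0 := h1 i.val (by omega)
  have e2 := h1 (i.val + 1 + 1) (by omega)
  have sx := x.height_step i.val
  have sx' := x.height_step (i.val + 1)
  have sy := y.height_step i.val
  have sy' := y.height_step (i.val + 1)
  refine ⟨?_, ?_, ?_⟩
  · rw [x.mem_iff_has, x.has_iff]; simp only [Fin.val_succ]; omega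
  · rw [x.mem_iff_has, x.not_has_iff]; simp only [Fin.val_castSucc]; omega
  · ext a
    rw [Finset.mem_insert, Finset.mem_erase, y.mem_iff_has, x.mem_iff_has]
    rw [y.has_iff, x.has_iff, Fin.ext_iff, Ne, Fin.ext_iff]
    simp only [Fin.val_castSucc, Fin.val_succ]
    by_cases ha : a.val = i.val
    · rw [ha]; omega
    · by_cases ha' : a.val = i.val + 1
      · rw [ha']; omega
      · rw [h1 _ ha', h1 (a.val + 1) (by omega)]; omega

theorem MovesLeft.isWeight {m r : ℕ} {i : Fin m} {x y : IState m r} (h : MovesLeft i x y) :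
    IsWeight x y (Finsupp.single i 1) ∧ IsWeight y x (Finsupp.single i 1) := by
  constructor <;>
  · intro j
    refine ⟨0, ?_⟩
    by_cases hj : i = j
    · subst hj
      have := h.height_eq'
      simp only [Finsupp.single_eq_same]; omega
    · have := h.height_eq (j.val + 1) (fun h' => hj (Fin.ext (by omega)))
      rw [Finsupp.single_eq_of_ne' hj]; omega

open Classical in
/-- `L_{i+1}`, the sum of the weight-`1/2` elements that move `i + 1` to `i`. -/
def B0.L {m r : ℕ} (i : Fin m) : B0 k m r :=
  ⟨Matrix.of fun x y => if MovesLeft i x y then MvPolynomial.X i else 0, by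
    intro x y W hW
    rw [Matrix.of_apply] at hW
    split_ifs at hW with h
    · exact isWeight_of_mem_support_monomial k h.isWeight.1 hW
    · simp at hW⟩

open Classical in
/-- `R_{i+1}`, the sum of the weight-`1/2` elements that move `i` to `i + 1`. -/
def B0.R {m r : ℕ} (i : Fin m) : B0 k m r :=
  ⟨Matrix.of fun x y => if MovesLeft i y x then MvPolynomial.X i else 0, by
    intro x y W hW
    rw [Matrix.of_apply] at hW
    split_ifs at hW with h
    · exact isWeight_of_mem_support_monomial k h.isWeight.2 hW
    · simp at hW⟩

theorem isWeight_two {m r : ℕ} (x : IState m r) (i : Fin m) :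
    IsWeight x x (Finsupp.single i 2) := by
  intro j
  by_cases hj : i = j
  · subst hj
    exact ⟨1, by simp⟩
  · exact ⟨0, by rw [Finsupp.single_eq_of_ne' hj]; simp⟩

open Classical in
/-- `U_{i+1}`. -/
def B0.U {m r : ℕ} (i : Fin m) : B0 k m r :=
  ⟨Matrix.scalar (IState m r) (MvPolynomial.X i ^ 2), by
    intro x y W hW
    rw [Matrix.scalar_apply, Matrix.diagonal_apply] at hW
    split_ifs at hW with h
    · subst h
      rw [MvPolynomial.X_pow_eq_monomial] at hW
      exact isWeight_of_mem_support_monomial k (isWeight_two x i) hW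
    · simp at hW⟩

/-! ### The algebra `B(m, r)` -/

/-- The two-sided ideal of `B_0(m, r)` generated by `L_{i+1} · L_i`, `R_i · R_{i+1}`, and
`U_i · I_x` whenever `x` contains neither `i - 1` nor `i`. -/
def relIdeal (m r : ℕ) : TwoSidedIdeal (B0 k m r) :=
  TwoSidedIdeal.span
    ({a | ∃ i j : Fin m, j.val = i.val + 1 ∧ a = B0.L k j * B0.L k i} ∪
      {a | ∃ i j : Fin m, j.val = i.val + 1 ∧ a = B0.R k i * B0.R k j} ∪
      {a | ∃ (i : Fin m) (x : IState m r), i.castSucc ∉ x.1 ∧ i.succ ∉ x.1 ∧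
        a = B0.U k i * B0.idem k x})

/-- The algebra `B(m, r)` with ground ring `k`. -/
def Blg (m r : ℕ) : Type := B0 k m r ⧸ (relIdeal k m r).asIdeal

instance (m r : ℕ) : Ring (Blg k m r) :=
  inferInstanceAs (Ring (B0 k m r ⧸ (relIdeal k m r).asIdeal))

instance (m r : ℕ) : Algebra k (Blg k m r) :=
  inferInstanceAs (Algebra k (B0 k m r ⧸ (relIdeal k m r).asIdeal))

/-- The quotient map `B_0(m, r) → B(m, r)`. -/
def Blg.mk (m r : ℕ) : B0 k m r →ₐ[k] Blg k m r :=
  Ideal.Quotient.mkₐ k (relIdeal k m r).asIdeal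

theorem Blg.mk_surjective (m r : ℕ) : Function.Surjective (Blg.mk k m r) :=
  Ideal.Quotient.mkₐ_surjective k _

theorem Blg.mk_eq_zero {m r : ℕ} {a : B0 k m r} : Blg.mk k m r a = 0 ↔ a ∈ relIdeal k m r :=
  Ideal.Quotient.eq_zero_iff_mem.trans TwoSidedIdeal.mem_asIdeal

/-- A linear map out of `B(m, r)` from a linear map on `B_0(m, r)` that kills the ideal. -/
def Blg.lift {m r : ℕ} {V : Type} [AddCommGroup V] [Module k V] (f : B0 k m r →ₗ[k] V)
    (hf : ∀ a ∈ relIdeal k m r, f a = 0) : Blg k m r →ₗ[k] V :=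
  (Submodule.liftQ ((relIdeal k m r).asIdeal.restrictScalars k) f
      (fun a ha => hf a (TwoSidedIdeal.mem_asIdeal.1 ha))).comp
    (Submodule.Quotient.restrictScalarsEquiv k (relIdeal k m r).asIdeal).symm.toLinearMap

theorem Blg.lift_mk {m r : ℕ} {V : Type} [AddCommGroup V] [Module k V] (f : B0 k m r →ₗ[k] V)
    (hf : ∀ a ∈ relIdeal k m r, f a = 0) (a : B0 k m r) :
    Blg.lift k f hf (Blg.mk k m r a) = f a := rfl

/-- The idempotent `I_x` of `B(m, r)`. -/
def Blg.idem {m r : ℕ} (x : IState m r) : Blg k m r := Blg.mk k m r (B0.idem k x)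
/-- `L_{i+1}` -/
def Blg.L {m r : ℕ} (i : Fin m) : Blg k m r := Blg.mk k m r (B0.L k i)
/-- `R_{i+1}` -/
def Blg.R {m r : ℕ} (i : Fin m) : Blg k m r := Blg.mk k m r (B0.R k i)
/-- `U_{i+1}` -/
def Blg.U {m r : ℕ} (i : Fin m) : Blg k m r := Blg.mk k m r (B0.U k i)

/-! ### A monomial description of the ideal

A basis element of weight `W` from `x` to `y` lies in the ideal iff a path of weight at most `W`
from `x` to `y` passes through a state `z` with neither `i` nor `i + 1` in `z`, where `W` is
positive at that index. These facts are used to see that the operations below are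
well-defined. -/

variable {k}

/-- The combinatorial criterion. -/
def Vanishes {m r : ℕ} (x y : IState m r) (W : Fin m →₀ ℕ) : Prop :=
  ∃ (z : IState m r) (i : Fin m), z.height i.val = z.height (i.val + 1) ∧
    z.height (i.val + 1) = z.height (i.val + 1 + 1) ∧ 1 ≤ W i ∧
    ∀ j : Fin m, ((x.height (j.val + 1) : ℤ) - (z.height (j.val + 1) : ℤ)).natAbs +
      ((z.height (j.val + 1) : ℤ) - (y.height (j.val + 1) : ℤ)).natAbs ≤ W j

theorem Vanishes.add_right {m r : ℕ} {x y u : IState m r} {W V : Fin m →₀ ℕ}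
    (h : Vanishes x y W) (hV : IsWeight y u V) : Vanishes x u (W + V) := by
  obtain ⟨z, i, h1, h2, h3, h4⟩ := h
  refine ⟨z, i, h1, h2, by rw [Finsupp.add_apply]; omega, fun j => ?_⟩
  obtain ⟨t, ht⟩ := hV j
  have := h4 j
  rw [Finsupp.add_apply]; omega

theorem Vanishes.add_left {m r : ℕ} {x y u : IState m r} {W V : Fin m →₀ ℕ}
    (hV : IsWeight u x V) (h : Vanishes x y W) : Vanishes u y (V + W) := by
  obtain ⟨z, i, h1, h2, h3, h4⟩ := h
  refine ⟨z, i, h1, h2, by rw [Finsupp.add_apply]; omega, fun j => ?_⟩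
  obtain ⟨t, ht⟩ := hV j
  have := h4 j
  rw [Finsupp.add_apply]; omega

variable (k) in
/-- The two-sided ideal of all elements whose monomials satisfy the criterion. -/
def vanishIdeal (m r : ℕ) : TwoSidedIdeal (B0 k m r) :=
  TwoSidedIdeal.mk' {a | ∀ x y, ∀ W ∈ (a.1 x y).support, Vanishes x y W}
    (by intro x y W hW; simp at hW)
    (by
      classical
      intro a b ha hb x y W hW
      rcases Finset.mem_union.1 (MvPolynomial.support_add hW) with h | h
      · exact ha x y W h
      · exact hb x y W h)
    (by
      intro a ha x y W hW
      have hW' : W ∈ (-(a.1 x y)).support := hW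
      rw [MvPolynomial.support_neg] at hW'
      exact ha x y W hW')
    (by
      classical
      intro a b hb x y W hW
      have hW' : W ∈ ((a.1 * b.1) x y).support := hW
      rw [Matrix.mul_apply] at hW'
      have h1 := MvPolynomial.support_sum hW'
      simp only [Finset.mem_biUnion] at h1
      obtain ⟨z, _, hz⟩ := h1
      obtain ⟨V, hV, V', hV', rfl⟩ := Finset.mem_add.1 (MvPolynomial.support_mul _ _ hz)
      exact (hb z y V' hV').add_left (a.2 x z V hV))
    (by
      classical
      intro a b ha x y W hW
      have hW' : W ∈ ((a.1 * b.1) x y).support := hW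
      rw [Matrix.mul_apply] at hW'
      have h1 := MvPolynomial.support_sum hW'
      simp only [Finset.mem_biUnion] at h1
      obtain ⟨z, _, hz⟩ := h1
      obtain ⟨V, hV, V', hV', rfl⟩ := Finset.mem_add.1 (MvPolynomial.support_mul _ _ hz)
      exact (ha x z V hV).add_right (b.2 z y V' hV'))

theorem mem_vanishIdeal {m r : ℕ} {a : B0 k m r} :
    a ∈ vanishIdeal k m r ↔ ∀ x y, ∀ W ∈ (a.1 x y).support, Vanishes x y W := by
  unfold vanishIdeal
  rw [TwoSidedIdeal.mem_mk']; rfl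

theorem B0.mem_support_mul {m r : ℕ} {a b : B0 k m r} {x y : IState m r} {W : Fin m →₀ ℕ}
    (hW : W ∈ ((a * b).1 x y).support) :
    ∃ z, ∃ V ∈ (a.1 x z).support, ∃ V' ∈ (b.1 z y).support, V + V' = W := by
  classical
  have hW' : W ∈ ((a.1 * b.1) x y).support := hW
  rw [Matrix.mul_apply] at hW'
  have h1 := MvPolynomial.support_sum hW'
  simp only [Finset.mem_biUnion] at h1
  obtain ⟨z, _, hz⟩ := h1
  obtain ⟨V, hV, V', hV', h⟩ := Finset.mem_add.1 (MvPolynomial.support_mul _ _ hz)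
  exact ⟨z, V, hV, V', hV', h⟩

theorem mem_support_X {m : ℕ} {i : Fin m} {W : Fin m →₀ ℕ}
    (h : W ∈ (MvPolynomial.X i : MvPolynomial (Fin m) k).support) : W = Finsupp.single i 1 :=
  Finset.mem_singleton.1 (MvPolynomial.support_monomial_subset h)

theorem B0.mem_support_L {m r : ℕ} {i : Fin m} {x y : IState m r} {W : Fin m →₀ ℕ}
    (hW : W ∈ ((B0.L k i).1 x y).support) : MovesLeft i x y ∧ W = Finsupp.single i 1 := by
  classical
  simp only [B0.L, Matrix.of_apply] at hW
  split_ifs at hW with h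
  · exact ⟨h, mem_support_X hW⟩
  · simp at hW

theorem B0.mem_support_R {m r : ℕ} {i : Fin m} {x y : IState m r} {W : Fin m →₀ ℕ}
    (hW : W ∈ ((B0.R k i).1 x y).support) : MovesLeft i y x ∧ W = Finsupp.single i 1 := by
  classical
  simp only [B0.R, Matrix.of_apply] at hW
  split_ifs at hW with h
  · exact ⟨h, mem_support_X hW⟩
  · simp at hW

theorem B0.mem_support_U {m r : ℕ} {i : Fin m} {x y : IState m r} {W : Fin m →₀ ℕ}
    (hW : W ∈ ((B0.U k i).1 x y).support) : x = y ∧ W = Finsupp.single i 2 := by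
  classical
  simp only [B0.U, Matrix.scalar_apply, Matrix.diagonal_apply] at hW
  split_ifs at hW with h
  · rw [MvPolynomial.X_pow_eq_monomial] at hW
    exact ⟨h, Finset.mem_singleton.1 (MvPolynomial.support_monomial_subset hW)⟩
  · simp at hW

theorem B0.mem_support_idem {m r : ℕ} {u : IState m r} {x y : IState m r} {W : Fin m →₀ ℕ}
    (hW : W ∈ ((B0.idem k u).1 x y).support) : u = x ∧ u = y ∧ W = 0 := by
  classical
  simp only [B0.idem, B0.elt, Matrix.single_apply] at hW
  split_ifs at hW with h
  · rw [← MvPolynomial.C_1] at hW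
    exact ⟨h.1, h.2, Finset.mem_singleton.1 (MvPolynomial.support_monomial_subset hW)⟩
  · simp at hW

theorem relIdeal_le (m r : ℕ) : relIdeal k m r ≤ vanishIdeal k m r := by
  refine TwoSidedIdeal.span_le.2 ?_
  rintro a ((⟨i, j, hij, rfl⟩ | ⟨i, j, hij, rfl⟩) | ⟨i, u, hu0, hu1, rfl⟩)
  · refine mem_vanishIdeal.2 fun x y W hW => ?_
    obtain ⟨z, V, hV, V', hV', rfl⟩ := B0.mem_support_mul hW
    obtain ⟨h1, rfl⟩ := B0.mem_support_L hV
    obtain ⟨h2, rfl⟩ := B0.mem_support_L hV'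
    have a1 := h1.height_eq'
    have a2 := h2.height_eq'
    have b0 := h1.height_eq i.val (by omega)
    have b1 := h1.height_eq (i.val + 1) (by omega)
    have c0 := h2.height_eq i.val (by omega)
    have c2 := h2.height_eq (i.val + 1 + 1) (by omega)
    have d1 := x.height_step i.val
    have d2 := x.height_step (i.val + 1)
    have d3 := z.height_step (i.val)
    have d4 := z.height_step (i.val + 1)
    have d5 := y.height_step (i.val)
    have d6 := y.height_step (i.val + 1)
    rw [hij] at a1
    refine ⟨x, i, by omega, by omega, by simp, fun l => ?_⟩
    have e1 := h1.height_eq (l.val + 1)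
    have e2 := h2.height_eq (l.val + 1)
    rw [Finsupp.add_apply]
    by_cases hl : l = i
    · subst hl
      rw [Finsupp.single_eq_same]
      omega
    · by_cases hl' : l = j
      · subst hl'
        rw [Finsupp.single_eq_same, hij]
        have := e2 (by omega)
        rw [hij] at this
        omega
      · have q1 := e1 (fun h => hl' (Fin.ext (by omega)))
        have q2 := e2 (fun h => hl (Fin.ext (by omega)))
        omega
  · refine mem_vanishIdeal.2 fun x y W hW => ?_
    obtain ⟨z, V, hV, V', hV', rfl⟩ := B0.mem_support_mul hW
    obtain ⟨h1, rfl⟩ := B0.mem_support_R hV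
    obtain ⟨h2, rfl⟩ := B0.mem_support_R hV'
    have a1 := h1.height_eq'
    have a2 := h2.height_eq'
    have b0 := h1.height_eq i.val (by omega)
    have b1 := h1.height_eq (i.val + 1 + 1) (by omega)
    have c0 := h2.height_eq i.val (by omega)
    have c1 := h2.height_eq (i.val + 1) (by omega)
    have c2 := h2.height_eq (j.val + 1 + 1) (by omega)
    have d1 := x.height_step i.val
    have d2 := x.height_step (i.val + 1)
    have d3 := z.height_step (i.val)
    have d4 := z.height_step (i.val + 1)
    have d5 := y.height_step (i.val)
    have d6 := y.height_step (i.val + 1)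
    rw [hij] at a2
    refine ⟨y, i, by omega, by omega, by simp, fun l => ?_⟩
    have e1 := h1.height_eq (l.val + 1)
    have e2 := h2.height_eq (l.val + 1)
    rw [Finsupp.add_apply]
    by_cases hl : l = i
    · subst hl
      rw [Finsupp.single_eq_same]
      omega
    · by_cases hl' : l = j
      · subst hl'
        rw [Finsupp.single_eq_same, hij]
        omega
      · have q1 := e1 (fun h => hl (Fin.ext (by omega)))
        have q2 := e2 (fun h => hl' (Fin.ext (by omega)))
        omega
  · refine mem_vanishIdeal.2 fun x y W hW => ?_
    obtain ⟨z, V, hV, V', hV', rfl⟩ := B0.mem_support_mul hW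
    obtain ⟨rfl, rfl⟩ := B0.mem_support_U hV
    obtain ⟨rfl, rfl, rfl⟩ := B0.mem_support_idem hV'
    have h0 := mt (u.mem_iff_has i.castSucc).2
    rw [u.mem_iff_has, u.not_has_iff] at hu0 hu1
    simp only [Fin.val_castSucc, Fin.val_succ] at hu0 hu1
    exact ⟨u, i, hu0, hu1, by simp, fun l => by omega⟩

/-! Conversely, monomials satisfying the criterion lie in the ideal. -/

variable (k) in
/-- The basis element of weight `W / 2` from `x` to `y`. -/
def B0.mono {m r : ℕ} (x y : IState m r) (W : Fin m →₀ ℕ) (h : IsWeight x y W) (c : k) :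
    B0 k m r :=
  B0.elt k x y (MvPolynomial.monomial W c) fun _ hV => isWeight_of_mem_support_monomial k h hV

theorem B0.mono_mul_mono {m r : ℕ} {x y z : IState m r} {W V : Fin m →₀ ℕ}
    (h : IsWeight x y W) (h' : IsWeight y z V) (c d : k) :
    B0.mono k x y W h c * B0.mono k y z V h' d = B0.mono k x z (W + V) (h.add h') (c * d) := by
  classical
  apply Subtype.ext
  change Matrix.single x y _ * Matrix.single y z _ = Matrix.single x z _
  rw [Matrix.single_mul_single_same, MvPolynomial.monomial_mul]

theorem B0.mono_mul_L {m r : ℕ} {x y z : IState m r} {W : Fin m →₀ ℕ} {i : Fin m}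
    (h : IsWeight x y W) (hz : MovesLeft i y z) (c : k) :
    B0.mono k x y W h c * B0.L k i =
      B0.mono k x z (W + Finsupp.single i 1) (h.add hz.isWeight.1) c := by
  classical
  apply Subtype.ext
  change Matrix.single x y _ * (Matrix.of _) = Matrix.single x z _
  ext1 a b
  by_cases hax : a = x
  · subst hax
    rw [Matrix.single_mul_apply_same, Matrix.of_apply, Matrix.single_apply]
    by_cases hb : z = b
    · subst hb
      rw [if_pos hz, if_pos ⟨rfl, rfl⟩, MvPolynomial.X, MvPolynomial.monomial_mul, mul_one]
    · rw [if_neg, if_neg, mul_zero]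
      · exact fun h => hb h.2
      · intro h'
        exact hb (Subtype.ext (hz.2.2.trans h'.2.2.symm))
  · rw [Matrix.single_mul_apply_of_ne (h := hax), Matrix.single_apply,
      if_neg (fun h => hax h.1.symm)]

theorem MovesLeft.inj {m r : ℕ} {i : Fin m} {x x' y : IState m r} (h : MovesLeft i x y)
    (h' : MovesLeft i x' y) : x = x' := by
  apply IState.ext_height
  intro t
  by_cases ht : t = i.val + 1
  · subst ht
    rw [h.height_eq', h'.height_eq']
  · rw [← h.height_eq t ht, ← h'.height_eq t ht]

theorem B0.mono_mul_R {m r : ℕ} {x y z : IState m r} {W : Fin m →₀ ℕ} {i : Fin m}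
    (h : IsWeight x y W) (hz : MovesLeft i z y) (c : k) :
    B0.mono k x y W h c * B0.R k i =
      B0.mono k x z (W + Finsupp.single i 1) (h.add hz.isWeight.2) c := by
  classical
  apply Subtype.ext
  change Matrix.single x y _ * (Matrix.of _) = Matrix.single x z _
  ext1 a b
  by_cases hax : a = x
  · subst hax
    rw [Matrix.single_mul_apply_same, Matrix.of_apply, Matrix.single_apply]
    by_cases hb : z = b
    · subst hb
      rw [if_pos hz, if_pos ⟨rfl, rfl⟩, MvPolynomial.X, MvPolynomial.monomial_mul, mul_one]
    · rw [if_neg, if_neg, mul_zero]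
      · exact fun h => hb h.2
      · intro h'
        exact hb (hz.inj h')
  · rw [Matrix.single_mul_apply_of_ne (h := hax), Matrix.single_apply,
      if_neg (fun h => hax h.1.symm)]

theorem B0.mono_mul_U_idem {m r : ℕ} {x y : IState m r} {W : Fin m →₀ ℕ} {i : Fin m}
    (h : IsWeight x y W) (c : k) :
    B0.mono k x y W h c * (B0.U k i * B0.idem k y) =
      B0.mono k x y (W + Finsupp.single i 2) (h.add (isWeight_two y i)) c := by
  classical
  apply Subtype.ext
  change Matrix.single x y _ * (Matrix.scalar _ _ * Matrix.single y y _) = Matrix.single x y _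
  rw [Matrix.scalar_apply, ← mul_assoc, Matrix.single_mul_mul_single,
    Matrix.diagonal_apply_eq, mul_one, MvPolynomial.X_pow_eq_monomial, MvPolynomial.monomial_mul,
    mul_one]

theorem B0.mono_congr {m r : ℕ} {x y : IState m r} {W V : Fin m →₀ ℕ} (hWV : W = V)
    (h : IsWeight x y W) (h' : IsWeight x y V) (c : k) :
    B0.mono k x y W h c = B0.mono k x y V h' c := by
  subst hWV; rfl

/-- Splitting a weight through intermediate states `z`, `z'` and a step of weight `g`. -/
theorem IsWeight.split {m r : ℕ} {x y z z' : IState m r} {W g : Fin m →₀ ℕ}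
    (h : IsWeight x y W) (hg : IsWeight z z' g)
    (hb : ∀ j : Fin m, ((x.height (j.val + 1) : ℤ) - (z.height (j.val + 1) : ℤ)).natAbs + g j +
      ((z'.height (j.val + 1) : ℤ) - (y.height (j.val + 1) : ℤ)).natAbs ≤ W j) :
    ∃ W1 W2, IsWeight x z W1 ∧ IsWeight z' y W2 ∧ W1 + g + W2 = W := by
  refine ⟨Finsupp.equivFunOnFinite.symm fun j =>
    ((x.height (j.val + 1) : ℤ) - (z.height (j.val + 1) : ℤ)).natAbs,
    Finsupp.equivFunOnFinite.symm fun j => W j - g j -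
      ((x.height (j.val + 1) : ℤ) - (z.height (j.val + 1) : ℤ)).natAbs, ?_, ?_, ?_⟩
  · intro j
    exact ⟨0, by simp⟩
  · intro j
    obtain ⟨t, ht⟩ := h j
    obtain ⟨s, hs⟩ := hg j
    have := hb j
    refine ⟨(W j - g j - ((x.height (j.val + 1) : ℤ) - (z.height (j.val + 1) : ℤ)).natAbs -
      ((z'.height (j.val + 1) : ℤ) - (y.height (j.val + 1) : ℤ)).natAbs) / 2, ?_⟩
    simp only [Finsupp.equivFunOnFinite_symm_apply_apply]
    omega
  · ext j
    have := hb j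
    simp only [Finsupp.add_apply, Finsupp.equivFunOnFinite_symm_apply_apply]
    omega

theorem MovesLeft.isWeight₂ {m r : ℕ} {i j : Fin m} {x y z : IState m r}
    (h : MovesLeft j x y) (h' : MovesLeft i y z) :
    IsWeight x z (Finsupp.single j 1 + Finsupp.single i 1) :=
  h.isWeight.1.add h'.isWeight.1

/-- Lowering a state `z` towards `y` from an empty place. -/
theorem exists_lower {m r : ℕ} {z y : IState m r} {i : Fin m}
    (h1 : z.height i.val = z.height (i.val + 1))
    (h2 : z.height (i.val + 1) = z.height (i.val + 1 + 1))
    (hy : y.height (i.val + 1) < z.height (i.val + 1)) :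
    ∃ (j : Fin m) (a b c : IState m r), j.val = i.val + 1 ∧ MovesLeft j a b ∧ MovesLeft i b c ∧
      (∀ t, (y.height t ≤ a.height t ∧ a.height t ≤ z.height t) ∨
        (a.height t = z.height t)) ∧
      (∀ t, c.height t ≤ a.height t ∧ ((y.height t ≤ c.height t) ∨ c.height t = a.height t)) := by
  classical
  set q := z.height (i.val + 1) with hq
  have hanti : ∀ (x : IState m r) s t, s ≤ t → x.height t ≤ x.height s := by
    intro x s t hst
    induction t, hst using Nat.le_induction with
    | base => exact le_rfl
    | succ t _ ih => exact (x.height_step t).1.trans ih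
  have htop := fun x : IState m r => x.height_top (le_refl (m + 1))
  have him := i.2
  have hi1 : i.val + 1 < m := by
    by_contra hcon
    have : i.val + 1 + 1 = m + 1 := by omega
    rw [this, htop] at h2
    omega
  have hylt : ∀ t, i.val + 1 ≤ t → y.height t < q := fun t ht =>
    lt_of_le_of_lt (hanti y _ _ ht) hy
  -- the three lattice paths
  obtain ⟨a, ha⟩ := IState.exists_of_path (m := m) (r := r)
    (fun t => if t ≤ i.val + 1 + 1 then z.height t else min (z.height t) (q - 1))
    (by simp [z.height_zero]) (by split_ifs <;> simp [htop]) (by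
      intro t ht
      have s1 := z.height_step t
      have s2 : i.val + 1 + 1 ≤ t → z.height t ≤ q := fun h => by
        rw [hq]; exact hanti z _ _ (by omega)
      have s3 : t = i.val + 1 + 1 → z.height t = q := by rintro rfl; omega
      split_ifs <;> omega)
  obtain ⟨b, hb⟩ := IState.exists_of_path (m := m) (r := r)
    (fun t => if t ≤ i.val + 1 then z.height t else min (z.height t) (q - 1))
    (by simp [z.height_zero]) (by split_ifs <;> simp [htop]) (by
      intro t ht
      have s1 := z.height_step t
      have s2 : i.val + 1 ≤ t → z.height t ≤ q := fun h => by
        rw [hq]; exact hanti z _ _ (by omega)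
      have s3 : t = i.val + 1 → z.height t = q := by rintro rfl; omega
      split_ifs <;> omega)
  obtain ⟨c, hc⟩ := IState.exists_of_path (m := m) (r := r)
    (fun t => if t ≤ i.val then z.height t else min (z.height t) (q - 1))
    (by simp [z.height_zero]) (by split_ifs <;> simp [htop]) (by
      intro t ht
      have s1 := z.height_step t
      have s2 : i.val ≤ t → z.height t ≤ q := fun h => by
        rw [← h1]; exact hanti z _ _ (by omega)
      have s3 : t = i.val → z.height t = q := by rintro rfl; omega
      split_ifs <;> omega)
  have ha' : ∀ t, a.height t =
      if t ≤ i.val + 1 + 1 then z.height t else min (z.height t) (q - 1) := by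
    intro t
    rcases Nat.lt_or_ge (m + 1) t with h | h
    · rw [if_neg (by omega), a.height_top (by omega), z.height_top (by omega)]; simp
    · exact ha t h
  have hb' : ∀ t, b.height t =
      if t ≤ i.val + 1 then z.height t else min (z.height t) (q - 1) := by
    intro t
    rcases Nat.lt_or_ge (m + 1) t with h | h
    · rw [if_neg (by omega), b.height_top (by omega), z.height_top (by omega)]; simp
    · exact hb t h
  have hc' : ∀ t, c.height t =
      if t ≤ i.val then z.height t else min (z.height t) (q - 1) := by
    intro t
    rcases Nat.lt_or_ge (m + 1) t with h | h
    · rw [if_neg (by omega), c.height_top (by omega), z.height_top (by omega)]; simp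
    · exact hc t h
  refine ⟨⟨i.val + 1, hi1⟩, a, b, c, rfl, ?_, ?_, ?_, ?_⟩
  · apply movesLeft_of_height
    · intro t ht
      simp only at ht
      rw [ha', hb']
      split_ifs <;> omega
    · simp only
      rw [ha', hb', if_pos le_rfl, if_neg (by omega)]
      omega
  · apply movesLeft_of_height
    · intro t ht
      rw [hb', hc']
      split_ifs <;> omega
    · rw [hb', hc', if_pos le_rfl, if_neg (by omega)]
      omega
  · intro t
    rw [ha']
    have := hylt t
    split_ifs with h
    · right; rfl
    · have := this (by omega)
      omega
  · intro t
    rw [ha', hc']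
    have := hylt t
    have s4 : i.val + 1 ≤ t → z.height t ≤ q := fun h => by
      rw [hq]; exact hanti z _ _ (by omega)
    split_ifs <;> omega

/-- Raising a state `z` towards `y` from an empty place. -/
theorem exists_raise {m r : ℕ} {z y : IState m r} {i : Fin m}
    (h1 : z.height i.val = z.height (i.val + 1))
    (h2 : z.height (i.val + 1) = z.height (i.val + 1 + 1))
    (hy : z.height (i.val + 1) < y.height (i.val + 1)) :
    ∃ (j : Fin m) (a b c : IState m r), i.val = j.val + 1 ∧ MovesLeft j b a ∧ MovesLeft i c b ∧
      (∀ t, (a.height t ≤ y.height t ∧ z.height t ≤ a.height t) ∨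
        (a.height t = z.height t)) ∧
      (∀ t, a.height t ≤ c.height t ∧ ((c.height t ≤ y.height t) ∨ c.height t = a.height t)) := by
  classical
  set q := z.height (i.val + 1) with hq
  have hanti : ∀ (x : IState m r) s t, s ≤ t → x.height t ≤ x.height s := by
    intro x s t hst
    induction t, hst using Nat.le_induction with
    | base => exact le_rfl
    | succ t _ ih => exact (x.height_step t).1.trans ih
  have htop := fun x : IState m r => x.height_top (le_refl (m + 1))
  have him := i.2
  have hzero := fun x : IState m r => x.height_zero
  have hi1 : 1 ≤ i.val := by
    by_contra hcon
    have h0 : i.val = 0 := by omega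
    have := hanti y 0 (i.val + 1) (by omega)
    rw [hzero] at this
    rw [h0, hzero] at h1
    omega
  have hygt : ∀ t, t ≤ i.val + 1 → q < y.height t := fun t ht =>
    lt_of_lt_of_le hy (hanti y _ _ ht)
  have hqr : q < r := by
    have := hygt 0 (by omega)
    rwa [hzero] at this
  have path : ∀ s, s = i.val - 1 ∨ s = i.val ∨ s = i.val + 1 →
      ∃ a : IState m r, ∀ t, a.height t =
        if s < t then z.height t else max (z.height t) (q + 1) := by
    intro s hs
    obtain ⟨a, ha⟩ := IState.exists_of_path (m := m) (r := r)
      (fun t => if s < t then z.height t else max (z.height t) (q + 1))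
      (by simp only [hzero]; rw [if_neg (by omega)]; omega)
      (by simp only [htop]; rw [if_pos (by omega)]) (by
        intro t ht
        have s1 := z.height_step t
        have s2 : t ≤ i.val + 1 → q ≤ z.height t := fun h => by
          rw [hq]; exact hanti z _ _ (by omega)
        have s3 : t = i.val + 1 → z.height t = q := by rintro rfl; omega
        have s4 : t + 1 = i.val → z.height (t + 1) = q := by
          intro h; rw [h]; omega
        have s5 : t = i.val → z.height t = q := by rintro rfl; omega
        have s6 : t = i.val → z.height (t + 1) = q := by rintro rfl; omega
        have s7 : t = i.val + 1 → z.height (t + 1) = q := by rintro rfl; omega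
        split_ifs <;> omega)
    refine ⟨a, fun t => ?_⟩
    rcases Nat.lt_or_ge (m + 1) t with h | h
    · rw [if_pos (by omega), a.height_top (by omega), z.height_top (by omega)]
    · exact ha t h
  obtain ⟨a, ha'⟩ := path (i.val - 1) (by omega)
  obtain ⟨b, hb'⟩ := path i.val (by omega)
  obtain ⟨c, hc'⟩ := path (i.val + 1) (by omega)
  have e1 : i.val - 1 + 1 = i.val := by omega
  refine ⟨⟨i.val - 1, by omega⟩, a, b, c, by simp; omega, ?_, ?_, ?_, ?_⟩
  · apply movesLeft_of_height
    · intro t ht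
      simp only at ht
      rw [ha', hb']
      split_ifs <;> omega
    · simp only
      rw [e1, ha', hb', if_neg (by omega), if_pos (by omega)]
      omega
  · apply movesLeft_of_height
    · intro t ht
      rw [hb', hc']
      split_ifs <;> omega
    · rw [hb', hc', if_neg (by omega), if_pos (by omega)]
      omega
  · intro t
    rw [ha']
    have := hygt t
    split_ifs with h
    · right; rfl
    · have := this (by omega)
      omega
  · intro t
    rw [ha', hc']
    have := hygt t
    split_ifs <;> omega

theorem mono_mem_relIdeal_of_LL {m r : ℕ} {x y a b c : IState m r} {i j : Fin m}
    {W : Fin m →₀ ℕ} (hij : j.val = i.val + 1) (hab : MovesLeft j a b) (hbc : MovesLeft i b c)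
    (h : IsWeight x y W) (d : k)
    (hbd : ∀ l : Fin m, ((x.height (l.val + 1) : ℤ) - (a.height (l.val + 1) : ℤ)).natAbs +
      ((a.height (l.val + 1) : ℤ) - (c.height (l.val + 1) : ℤ)).natAbs +
      ((c.height (l.val + 1) : ℤ) - (y.height (l.val + 1) : ℤ)).natAbs ≤ W l) :
    B0.mono k x y W h d ∈ relIdeal k m r := by
  have hg := hab.isWeight₂ hbc
  have hgv : ∀ l : Fin m, (Finsupp.single j 1 + Finsupp.single i 1 : Fin m →₀ ℕ) l =
      ((a.height (l.val + 1) : ℤ) - (c.height (l.val + 1) : ℤ)).natAbs := by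
    intro l
    have e1 := hab.height_eq (l.val + 1)
    have e2 := hbc.height_eq (l.val + 1)
    have f1 := hab.height_eq'
    have f2 := hbc.height_eq'
    rw [Finsupp.add_apply]
    by_cases hl : l = i
    · subst hl
      rw [Finsupp.single_eq_same, Finsupp.single_eq_of_ne (by rintro rfl; omega)]
      have := e1 (by omega)
      omega
    · by_cases hl' : l = j
      · subst hl'
        rw [Finsupp.single_eq_same, Finsupp.single_eq_of_ne hl]
        have := e2 (by omega)
        omega
      · have q1 := e1 (fun h => hl' (Fin.ext (by omega)))
        have q2 := e2 (fun h => hl (Fin.ext (by omega)))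
        rw [Finsupp.single_eq_of_ne hl, Finsupp.single_eq_of_ne hl']
        omega
  obtain ⟨W1, W2, hW1, hW2, hWW⟩ := h.split hg (fun l => by rw [hgv]; exact hbd l)
  have : B0.mono k x y W h d =
      B0.mono k x a W1 hW1 d * (B0.L k j * B0.L k i) * B0.mono k c y W2 hW2 1 := by
    rw [← mul_assoc, B0.mono_mul_L hW1 hab, B0.mono_mul_L _ hbc, B0.mono_mul_mono, mul_one]
    exact B0.mono_congr (by rw [← hWW]; abel) _ _ _
  rw [this]
  refine TwoSidedIdeal.mul_mem_right _ _ _ (TwoSidedIdeal.mul_mem_left _ _ _ ?_)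
  exact TwoSidedIdeal.subset_span (Or.inl (Or.inl ⟨i, j, hij, rfl⟩))

theorem mono_mem_relIdeal_of_RR {m r : ℕ} {x y a b c : IState m r} {i j : Fin m}
    {W : Fin m →₀ ℕ} (hij : i.val = j.val + 1) (hab : MovesLeft j b a) (hbc : MovesLeft i c b)
    (h : IsWeight x y W) (d : k)
    (hbd : ∀ l : Fin m, ((x.height (l.val + 1) : ℤ) - (a.height (l.val + 1) : ℤ)).natAbs +
      ((a.height (l.val + 1) : ℤ) - (c.height (l.val + 1) : ℤ)).natAbs +
      ((c.height (l.val + 1) : ℤ) - (y.height (l.val + 1) : ℤ)).natAbs ≤ W l) :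
    B0.mono k x y W h d ∈ relIdeal k m r := by
  have hg : IsWeight a c (Finsupp.single j 1 + Finsupp.single i 1) :=
    hab.isWeight.2.add hbc.isWeight.2
  have hgv : ∀ l : Fin m, (Finsupp.single j 1 + Finsupp.single i 1 : Fin m →₀ ℕ) l =
      ((a.height (l.val + 1) : ℤ) - (c.height (l.val + 1) : ℤ)).natAbs := by
    intro l
    have e1 := hab.height_eq (l.val + 1)
    have e2 := hbc.height_eq (l.val + 1)
    have f1 := hab.height_eq'
    have f2 := hbc.height_eq'
    rw [Finsupp.add_apply]
    by_cases hl : l = i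
    · subst hl
      rw [Finsupp.single_eq_same, Finsupp.single_eq_of_ne (by rintro rfl; omega)]
      have := e1 (by omega)
      omega
    · by_cases hl' : l = j
      · subst hl'
        rw [Finsupp.single_eq_same, Finsupp.single_eq_of_ne hl]
        have := e2 (by omega)
        omega
      · have q1 := e1 (fun h => hl' (Fin.ext (by omega)))
        have q2 := e2 (fun h => hl (Fin.ext (by omega)))
        rw [Finsupp.single_eq_of_ne hl, Finsupp.single_eq_of_ne hl']
        omega
  obtain ⟨W1, W2, hW1, hW2, hWW⟩ := h.split hg (fun l => by rw [hgv]; exact hbd l)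
  have : B0.mono k x y W h d =
      B0.mono k x a W1 hW1 d * (B0.R k j * B0.R k i) * B0.mono k c y W2 hW2 1 := by
    rw [← mul_assoc, B0.mono_mul_R hW1 hab, B0.mono_mul_R _ hbc, B0.mono_mul_mono, mul_one]
    exact B0.mono_congr (by rw [← hWW]; abel) _ _ _
  rw [this]
  refine TwoSidedIdeal.mul_mem_right _ _ _ (TwoSidedIdeal.mul_mem_left _ _ _ ?_)
  exact TwoSidedIdeal.subset_span (Or.inl (Or.inr ⟨j, i, hij, rfl⟩))

theorem mono_mem_relIdeal {m r : ℕ} {x y : IState m r} {W : Fin m →₀ ℕ} (h : IsWeight x y W)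
    (hv : Vanishes x y W) (d : k) : B0.mono k x y W h d ∈ relIdeal k m r := by
  obtain ⟨z, i, h1, h2, h3, h4⟩ := hv
  rcases lt_trichotomy (y.height (i.val + 1)) (z.height (i.val + 1)) with hy | hy | hy
  · obtain ⟨j, a, b, c, hij, hab, hbc, p1, p2⟩ := exists_lower h1 h2 hy
    refine mono_mem_relIdeal_of_LL hij hab hbc h d (fun l => ?_)
    have := p1 (l.val + 1)
    have := p2 (l.val + 1)
    have := h4 l
    omega
  · rcases lt_trichotomy (x.height (i.val + 1)) (z.height (i.val + 1)) with hx | hx | hx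
    · obtain ⟨j, a, b, c, hij, hab, hbc, p1, p2⟩ := exists_lower h1 h2 hx
      refine mono_mem_relIdeal_of_RR hij hbc hab h d (fun l => ?_)
      have := p1 (l.val + 1)
      have := p2 (l.val + 1)
      have := h4 l
      omega
    · have hb : ∀ l : Fin m,
          ((x.height (l.val + 1) : ℤ) - (z.height (l.val + 1) : ℤ)).natAbs +
          (Finsupp.single i 2 : Fin m →₀ ℕ) l +
          ((z.height (l.val + 1) : ℤ) - (y.height (l.val + 1) : ℤ)).natAbs ≤ W l := by
        intro l
        obtain ⟨t, ht⟩ := h l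
        have := h4 l
        by_cases hl : l = i
        · subst hl
          rw [Finsupp.single_eq_same]; omega
        · rw [Finsupp.single_eq_of_ne hl]; omega
      obtain ⟨W1, W2, hW1, hW2, hWW⟩ := h.split (isWeight_two z i) hb
      have : B0.mono k x y W h d =
          B0.mono k x z W1 hW1 d * (B0.U k i * B0.idem k z) * B0.mono k z y W2 hW2 1 := by
        rw [B0.mono_mul_U_idem, B0.mono_mul_mono, mul_one]
        exact B0.mono_congr hWW.symm _ _ _
      rw [this]
      refine TwoSidedIdeal.mul_mem_right _ _ _ (TwoSidedIdeal.mul_mem_left _ _ _ ?_)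
      refine TwoSidedIdeal.subset_span (Or.inr ⟨i, z, ?_, ?_, rfl⟩)
      · rw [z.mem_iff_has, z.not_has_iff]; simpa using h1
      · rw [z.mem_iff_has, z.not_has_iff]; simpa using h2
    · obtain ⟨j, a, b, c, hij, hab, hbc, p1, p2⟩ := exists_raise h1 h2 hx
      refine mono_mem_relIdeal_of_LL hij hbc hab h d (fun l => ?_)
      have := p1 (l.val + 1)
      have := p2 (l.val + 1)
      have := h4 l
      omega
  · obtain ⟨j, a, b, c, hij, hab, hbc, p1, p2⟩ := exists_raise h1 h2 hy
    refine mono_mem_relIdeal_of_RR hij hab hbc h d (fun l => ?_)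
    have := p1 (l.val + 1)
    have := p2 (l.val + 1)
    have := h4 l
    omega

/-- An element of `B_0(m, r)` concentrated in the `(x, y)` entry lies in the ideal as soon as all
its monomials satisfy the criterion. -/
theorem elt_mem_relIdeal {m r : ℕ} {x y : IState m r} (p : MvPolynomial (Fin m) k)
    (hp : ∀ W ∈ p.support, IsWeight x y W) (hv : ∀ W ∈ p.support, Vanishes x y W) :
    B0.elt k x y p hp ∈ relIdeal k m r := by
  classical
  have : B0.elt k x y p hp =
      ∑ W ∈ p.support.attach, B0.mono k x y W.1 (hp W.1 W.2) (p.coeff W.1) := by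
    apply Subtype.ext
    rw [AddSubmonoidClass.coe_finsetSum]
    change Matrix.single x y p = ∑ W ∈ p.support.attach,
      Matrix.single x y (MvPolynomial.monomial W.1 (p.coeff W.1))
    rw [Finset.sum_attach p.support
      (fun W => Matrix.single x y (MvPolynomial.monomial W (p.coeff W)))]
    ext1 a b
    rw [Matrix.sum_apply]
    by_cases hab : x = a ∧ y = b
    · obtain ⟨rfl, rfl⟩ := hab
      simp only [Matrix.single_apply_same]
      exact p.as_sum
    · simp [hab]
  rw [this]
  exact sum_mem fun W _ => mono_mem_relIdeal _ (hv W.1 W.2) _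

/-! ### Preferred states and the maps between the algebras -/

/-- `|x ∩ {0, 1, 2}|`. -/
def IState.low {m r : ℕ} (x : IState m r) : ℕ := (x.1.filter (fun a => a.val < 3)).card

theorem IState.low_add {m r : ℕ} (x : IState m r) : x.low + x.height 3 = r := by
  unfold IState.low IState.height
  have h := Finset.card_filter_add_card_filter_not (s := x.1) (fun a => a.val < 3)
  simp only [not_lt] at h
  rw [h, x.2]

/-- `1 ≤ |x ∩ {0, 1, 2}| ≤ 2`. -/
def IState.Preferred {m r : ℕ} (x : IState m r) : Prop := 1 ≤ x.low ∧ x.low ≤ 2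

theorem psi_aux {m r : ℕ} (x : IState (m + 2) (r + 1)) (hx : x.Preferred) :
    ∃ z : IState m r, (∀ t, 1 ≤ t → z.height t = x.height (t + 2)) ∧
      ∀ t, z.Has t ↔ if t = 0 then x.low = 2 else x.Has (t + 2) := by
  have hl := x.low_add
  obtain ⟨hx1, hx2⟩ := hx
  obtain ⟨z, hz⟩ := IState.exists_of_path (m := m) (r := r)
    (fun t => if t = 0 then r else x.height (t + 2)) (by simp)
    (by rw [if_neg (by omega)]; exact x.height_top (by omega)) (by
      intro t _
      have := x.height_step (t + 2)
      rw [if_neg (by omega)]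
      split_ifs with h
      · subst h
        simp only [Nat.zero_add, Nat.reduceAdd]
        omega
      · have e : t + 1 + 2 = t + 2 + 1 := by omega
        rw [e]; omega)
  have hz' : ∀ t, 1 ≤ t → z.height t = x.height (t + 2) := by
    intro t ht
    rcases Nat.lt_or_ge (m + 1) t with h | h
    · rw [z.height_top (by omega), x.height_top (by omega)]
    · rw [hz t h, if_neg (by omega)]
  refine ⟨z, hz', fun t => ?_⟩
  rw [z.has_iff]
  split_ifs with h
  · subst h
    rw [z.height_zero, hz' _ le_rfl]
    simp only [Nat.reduceAdd]
    omega
  · rw [hz' _ (by omega), hz' _ (by omega), x.has_iff]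

open Classical in
/-- For a preferred state `x`, the state that contains `0` precisely when
`|x ∩ {0, 1, 2}| = 2`, and contains `i > 0` precisely when `i + 2 ∈ x`. -/
def psi {m r : ℕ} (x : IState (m + 2) (r + 1)) (hx : x.Preferred) : IState m r :=
  ⟨Finset.univ.filter (fun i : Fin (m + 1) => if i.val = 0 then x.low = 2 else x.Has (i.val + 2)), by
    obtain ⟨z, _, hz⟩ := psi_aux x hx
    have : Finset.univ.filter (fun i : Fin (m + 1) =>
        if i.val = 0 then x.low = 2 else x.Has (i.val + 2)) = z.1 := by
      ext a
      rw [z.mem_iff_has, hz]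
      simp
    rw [this]
    exact z.2⟩

theorem psi_height {m r : ℕ} (x : IState (m + 2) (r + 1)) (hx : x.Preferred) (t : ℕ)
    (ht : 1 ≤ t) : (psi x hx).height t = x.height (t + 2) := by
  obtain ⟨z, hz, hz'⟩ := psi_aux x hx
  have : psi x hx = z := by
    apply Subtype.ext
    ext a
    rw [z.mem_iff_has, hz']
    simp [psi]
  rw [this, hz t ht]

/-- Drop the first two entries of a weight vector. -/
def tailWeight {m : ℕ} (W : Fin (m + 2) →₀ ℕ) : Fin m →₀ ℕ :=
  Finsupp.equivFunOnFinite.symm fun i => W i.succ.succ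

theorem tailWeight_apply {m : ℕ} (W : Fin (m + 2) →₀ ℕ) (i : Fin m) :
    tailWeight W i = W i.succ.succ := rfl

variable (k) in
/-- Drop the first two entries of the weight of each monomial, and multiply by a coefficient that
depends on these two entries. -/
def shrinkPoly {m : ℕ} (c : ℕ → ℕ → k) :
    MvPolynomial (Fin (m + 2)) k →ₗ[k] MvPolynomial (Fin m) k :=
  (MvPolynomial.basisMonomials (Fin (m + 2)) k).constr k
    fun W => MvPolynomial.monomial (tailWeight W) (c (W 0) (W 1))

theorem shrinkPoly_monomial {m : ℕ} (c : ℕ → ℕ → k) (W : Fin (m + 2) →₀ ℕ) (d : k) :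
    shrinkPoly k c (MvPolynomial.monomial W d) =
      MvPolynomial.monomial (tailWeight W) (d * c (W 0) (W 1)) := by
  have h : MvPolynomial.monomial W d = d • MvPolynomial.basisMonomials (Fin (m + 2)) k W := by
    rw [MvPolynomial.coe_basisMonomials, MvPolynomial.smul_monomial, smul_eq_mul, mul_one]
  rw [h, map_smul, shrinkPoly, Module.Basis.constr_basis, MvPolynomial.smul_monomial, smul_eq_mul]

theorem mem_support_shrinkPoly {m : ℕ} {c : ℕ → ℕ → k} {p : MvPolynomial (Fin (m + 2)) k}
    {V : Fin m →₀ ℕ} (hV : V ∈ (shrinkPoly k c p).support) :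
    ∃ W ∈ p.support, tailWeight W = V ∧ c (W 0) (W 1) ≠ 0 := by
  classical
  rw [p.as_sum, map_sum] at hV
  have h1 := MvPolynomial.support_sum hV
  simp only [Finset.mem_biUnion] at h1
  obtain ⟨W, hW, hWV⟩ := h1
  rw [shrinkPoly_monomial] at hWV
  have h2 := Finset.mem_singleton.1 (MvPolynomial.support_monomial_subset hWV)
  refine ⟨W, hW, h2.symm, fun h0 => ?_⟩
  rw [h0, mul_zero, MvPolynomial.monomial_zero] at hWV
  simp at hWV

/-- A preferred state `x` with `x ∩ {0, 1, 2} ≠ {0, 1}`. -/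
def IState.MPreferred {m r : ℕ} (x : IState m r) : Prop :=
  x.Preferred ∧ ¬ (x.Has 0 ∧ x.Has 1)

/-- The three kinds of input factors of the bimodule `MarkedMin`. -/
inductive Letter
  /-- an element `b` with `weight_1(b) = weight_2(b) = 0` -/
  | one
  /-- a product of `U_1^(i+1)`, `L_1 U_1^i` or `R_1 U_1^i` with an element `b` as before -/
  | first
  /-- a product of `U_2^(i+1)`, `L_2 U_2^i` or `R_2 U_2^i` with an element `b` as before -/
  | second
  deriving DecidableEq

open Classical in
/-- The coefficient with which a letter acts on elements of `I_x · B · I_y` with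
`weight_1 = a / 2` and `weight_2 = b / 2`: it is `w^i` for the first kind of factors and `z^i` for
the second. -/
def Letter.coef {m r : ℕ} (w z : k) (x y : IState m r) : Letter → ℕ → ℕ → k
  | .one, a, b => if a = 0 ∧ b = 0 then 1 else 0
  | .first, a, b =>
      if (x.Has 0 ∨ x.Has 1) ∧ (y.Has 0 ∨ y.Has 1) ∧ 1 ≤ a ∧ b = 0 then w ^ ((a - 1) / 2) else 0
  | .second, a, b =>
      if ¬ x.Has 0 ∧ ¬ y.Has 0 ∧ a = 0 ∧ 1 ≤ b then z ^ ((b - 1) / 2) else 0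

theorem IsWeight.tail {m r : ℕ} {x y : IState (m + 2) (r + 1)} (hx : x.Preferred)
    (hy : y.Preferred) {W : Fin (m + 2) →₀ ℕ} (h : IsWeight x y W) :
    IsWeight (psi x hx) (psi y hy) (tailWeight W) := by
  intro i
  obtain ⟨t, ht⟩ := h i.succ.succ
  refine ⟨t, ?_⟩
  rw [tailWeight_apply, ht, psi_height _ _ _ (by omega), psi_height _ _ _ (by omega)]
  simp only [Fin.val_succ]

theorem tail_arith {r x0 x1 x2 y0 y1 y2 z0 z1 z2 z3 z4 W0 W1 t0 t1 : ℕ}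
    (zx : x0 = r + 1) (zy : y0 = r + 1) (zz : z0 = r + 1)
    (sx0 : x1 ≤ x0 ∧ x0 ≤ x1 + 1) (sx1 : x2 ≤ x1 ∧ x1 ≤ x2 + 1)
    (sy0 : y1 ≤ y0 ∧ y0 ≤ y1 + 1) (sy1 : y2 ≤ y1 ∧ y1 ≤ y2 + 1)
    (sz0 : z1 ≤ z0 ∧ z0 ≤ z1 + 1) (sz1 : z2 ≤ z1 ∧ z1 ≤ z2 + 1) (sz2 : z3 ≤ z2 ∧ z2 ≤ z3 + 1)
    (px : ¬ (x0 = x1 + 1 ∧ x1 = x2 + 1)) (py : ¬ (y0 = y1 + 1 ∧ y1 = y2 + 1))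
    (b0 : ((x1 : ℤ) - (z1 : ℤ)).natAbs + ((z1 : ℤ) - (y1 : ℤ)).natAbs ≤ W0)
    (b1 : ((x2 : ℤ) - (z2 : ℤ)).natAbs + ((z2 : ℤ) - (y2 : ℤ)).natAbs ≤ W1)
    (w0 : W0 = ((x1 : ℤ) - (y1 : ℤ)).natAbs + 2 * t0)
    (w1 : W1 = ((x2 : ℤ) - (y2 : ℤ)).natAbs + 2 * t1)
    (hc : ((x0 = x1 + 1 ∨ x1 = x2 + 1) ∧ (y0 = y1 + 1 ∨ y1 = y2 + 1) ∧ W1 = 0) ∨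
      (¬ x0 = x1 + 1 ∧ ¬ y0 = y1 + 1 ∧ W0 = 0)) :
    r ≤ z3 + 1 ∧ (z2 = z3 → z3 = z4 → r ≤ z3) ∧
      (z1 = z2 → z2 = z3 → 1 ≤ W1 → z3 = r + 1) ∧
      (z0 = z1 → z1 = z2 → 1 ≤ W0 → False) := by
  subst zx zy zz
  rcases hc with ⟨h1, h2, h3⟩ | ⟨h1, h2, h3⟩
  · have e1 : x2 = z2 := by omega
    have e2 : y2 = z2 := by omega
    clear b1 w1
    refine ⟨by omega, by omega, by omega, by omega⟩
  · have e1 : x1 = z1 := by omega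
    have e2 : y1 = z1 := by omega
    clear b0 w0
    refine ⟨by omega, by omega, by omega, by omega⟩

theorem Vanishes.tail {m r : ℕ} {x y : IState (m + 2) (r + 1)} (hx : x.MPreferred)
    (hy : y.MPreferred) {W : Fin (m + 2) →₀ ℕ} (h : Vanishes x y W) (hW : IsWeight x y W)
    (hc : ((x.Has 0 ∨ x.Has 1) ∧ (y.Has 0 ∨ y.Has 1) ∧ W 1 = 0) ∨
      (¬ x.Has 0 ∧ ¬ y.Has 0 ∧ W 0 = 0)) :
    Vanishes (psi x hx.1) (psi y hy.1) (tailWeight W) := by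
  obtain ⟨z, i, h1, h2, h3, h4⟩ := h
  have lx : x.height 3 ≤ r := by
    have := x.low_add
    have : 1 ≤ x.low := hx.1.1
    omega
  have ly : y.height 3 ≤ r := by
    have := y.low_add
    have : 1 ≤ y.low := hy.1.1
    omega
  have v1 : ((1 : Fin (m + 2)) : ℕ) = 1 := rfl
  have key : r ≤ z.height 3 + 1 ∧
      (z.height 2 = z.height 3 → z.height 3 = z.height 4 → r ≤ z.height 3) ∧
      (z.height 1 = z.height 2 → z.height 2 = z.height 3 → 1 ≤ W 1 → z.height 3 = r + 1) ∧
      (z.height 0 = z.height 1 → z.height 1 = z.height 2 → 1 ≤ W 0 → False) := by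
    have px := hx.2
    have py := hy.2
    rw [x.has_iff, x.has_iff] at px
    rw [y.has_iff, y.has_iff] at py
    rw [x.has_iff, x.has_iff, y.has_iff, y.has_iff] at hc
    obtain ⟨t0, w0⟩ := hW 0
    obtain ⟨t1, w1⟩ := hW 1
    exact tail_arith x.height_zero y.height_zero z.height_zero
      (x.height_step 0) (x.height_step 1)
      (y.height_step 0) (y.height_step 1)
      (z.height_step 0) (z.height_step 1) (z.height_step 2) px py (h4 0) (h4 1) w0 w1 hc
  clear hc
  obtain ⟨hz3, key2, key1, key0⟩ := key
  obtain ⟨u, hu⟩ := IState.exists_of_path (m := m) (r := r)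
    (fun t => if t = 0 then r else min (z.height (t + 2)) r) (by simp)
    (by rw [if_neg (by omega), z.height_top (by omega)]; simp) (by
      intro t _
      have := z.height_step (t + 2)
      rw [if_neg (by omega)]
      split_ifs with h
      · subst h
        simp only [Nat.zero_add, Nat.reduceAdd]
        omega
      · have e : t + 1 + 2 = t + 2 + 1 := by omega
        rw [e]; omega)
  have hu' : ∀ t, 1 ≤ t → u.height t = min (z.height (t + 2)) r := by
    intro t ht
    rcases Nat.lt_or_ge (m + 1) t with h | h
    · rw [u.height_top (by omega), z.height_top (by omega)]; simp
    · rw [hu t h, if_neg (by omega)]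
  have hanti : ∀ (x : IState (m + 2) (r + 1)) s t, s ≤ t → x.height t ≤ x.height s := by
    intro x s t hst
    induction t, hst using Nat.le_induction with
    | base => exact le_rfl
    | succ t _ ih => exact (x.height_step t).1.trans ih
  have budget : ∀ j : Fin m,
      (((psi x hx.1).height (j.val + 1) : ℤ) - (u.height (j.val + 1) : ℤ)).natAbs +
      ((u.height (j.val + 1) : ℤ) - ((psi y hy.1).height (j.val + 1) : ℤ)).natAbs ≤
      tailWeight W j := by
    intro j
    have q := h4 j.succ.succ
    rw [tailWeight_apply, psi_height _ _ _ (by omega), psi_height _ _ _ (by omega),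
      hu' _ (by omega)]
    simp only [Fin.val_succ] at q
    have e : j.val + 1 + 2 = j.val + 1 + 1 + 1 := by omega
    rw [e]
    have ax := hanti x 3 (j.val + 1 + 1 + 1) (by omega)
    have ay := hanti y 3 (j.val + 1 + 1 + 1) (by omega)
    omega
  have u0 := u.height_zero
  by_cases hi : 2 ≤ i.val
  · have hilt := i.2
    refine ⟨u, ⟨i.val - 2, by omega⟩, ?_, ?_, ?_, budget⟩
    · simp only
      by_cases hi2 : i.val = 2
      · have e : i.val - 2 = 0 := by omega
        rw [e, u0, hu' _ (by omega)]
        rw [hi2] at h1 h2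
        have := key2 h1 h2
        simp only [Nat.zero_add, Nat.reduceAdd]
        omega
      · rw [hu' _ (by omega), hu' _ (by omega)]
        have e : i.val - 2 + 2 = i.val := by omega
        have e' : i.val - 2 + 1 + 2 = i.val + 1 := by omega
        rw [e, e', h1]
    · simp only
      rw [hu' _ (by omega), hu' _ (by omega)]
      have e : i.val - 2 + 1 + 1 + 2 = i.val + 1 + 1 := by omega
      have e' : i.val - 2 + 1 + 2 = i.val + 1 := by omega
      rw [e, e', h2]
    · rw [tailWeight_apply]
      have e : Fin.succ (Fin.succ (⟨i.val - 2, by omega⟩ : Fin m)) = i :=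
        Fin.ext (by simp only [Fin.val_succ]; omega)
      rw [e]
      exact h3
  · have hi01 : i = 0 ∨ i = 1 := by
      rcases Nat.lt_or_ge i.val 1 with h | h
      · left; exact Fin.ext (by rw [Fin.val_zero]; omega)
      · right; exact Fin.ext (by rw [v1]; omega)
    rcases hi01 with rfl | rfl
    · exact (key0 h1 h2 h3).elim
    · have hzr := key1 h1 h2 h3
      have hm : 1 ≤ m := by
        by_contra hcon
        have : z.height 3 = 0 := z.height_top (by omega)
        omega
      have b2 := h4 (Fin.succ (Fin.succ ⟨0, hm⟩))
      simp only [Fin.val_succ, Nat.zero_add, Nat.reduceAdd] at b2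
      have sz3 := z.height_step 3
      simp only [Nat.reduceAdd] at sz3
      refine ⟨u, ⟨0, hm⟩, ?_, ?_, ?_, budget⟩
      · simp only [Nat.zero_add]
        rw [u0, hu' _ le_rfl]
        simp only [Nat.reduceAdd]
        omega
      · simp only [Nat.zero_add, Nat.reduceAdd]
        rw [hu' _ le_rfl, hu' _ (by omega)]
        simp only [Nat.reduceAdd]
        omega
      · rw [tailWeight_apply]
        omega

theorem Letter.coef_ne_zero {m r : ℕ} {w z : k} {x y : IState (m + 2) (r + 1)}
    {W : Fin (m + 2) →₀ ℕ} (hW : IsWeight x y W) (l : Letter) (h : l.coef w z x y (W 0) (W 1) ≠ 0) :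
    ((x.Has 0 ∨ x.Has 1) ∧ (y.Has 0 ∨ y.Has 1) ∧ W 1 = 0) ∨
      (¬ x.Has 0 ∧ ¬ y.Has 0 ∧ W 0 = 0) := by
  cases l with
  | one =>
    simp only [Letter.coef, ne_eq, ite_eq_right_iff, Classical.not_imp] at h
    obtain ⟨⟨h1, h2⟩, _⟩ := h
    obtain ⟨t0, w0⟩ := hW 0
    obtain ⟨t1, w1⟩ := hW 1
    have v1 : ((1 : Fin (m + 2)) : ℕ) = 1 := rfl
    simp only [Fin.val_zero, v1, Nat.zero_add, Nat.reduceAdd] at w0 w1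
    rw [x.has_iff, x.has_iff, y.has_iff, y.has_iff]
    simp only [Nat.zero_add, Nat.reduceAdd]
    have zx := x.height_zero
    have zy := y.height_zero
    have sx0 := x.height_step 0
    have sx1 := x.height_step 1
    have sy0 := y.height_step 0
    have sy1 := y.height_step 1
    simp only [Nat.zero_add, Nat.reduceAdd] at sx0 sx1 sy0 sy1
    omega
  | first =>
    simp only [Letter.coef, ne_eq, ite_eq_right_iff, Classical.not_imp] at h
    left; exact ⟨h.1.1, h.1.2.1, h.1.2.2.2⟩
  | second =>
    simp only [Letter.coef, ne_eq, ite_eq_right_iff, Classical.not_imp] at h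
    right; exact ⟨h.1.1, h.1.2.1, h.1.2.2.1⟩

theorem B0.shrink_aux {m r : ℕ} (w z : k) (l : Letter) (x y : IState (m + 2) (r + 1))
    (hx : x.MPreferred) (hy : y.MPreferred) (a : B0 k (m + 2) (r + 1)) :
    ∀ V ∈ (shrinkPoly k (l.coef w z x y) (a.1 x y)).support,
      IsWeight (psi x hx.1) (psi y hy.1) V := by
  intro V hV
  obtain ⟨W, hW, rfl, _⟩ := mem_support_shrinkPoly hV
  exact (a.2 x y W hW).tail hx.1 hy.1

variable (k) in
/-- The map on `B_0` underlying `shrink`. -/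
def B0.shrink {m r : ℕ} (w z : k) (l : Letter) (x y : IState (m + 2) (r + 1))
    (hx : x.MPreferred) (hy : y.MPreferred) : B0 k (m + 2) (r + 1) →ₗ[k] B0 k m r where
  toFun a := B0.elt k (psi x hx.1) (psi y hy.1) (shrinkPoly k (l.coef w z x y) (a.1 x y))
    (B0.shrink_aux w z l x y hx hy a)
  map_add' a b := by
    classical
    apply Subtype.ext
    change Matrix.single _ _ (shrinkPoly k _ (a.1 x y + b.1 x y)) = Matrix.single _ _ _ +
      Matrix.single _ _ _
    rw [map_add, Matrix.single_add]
  map_smul' c a := by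
    classical
    apply Subtype.ext
    change Matrix.single _ _ (shrinkPoly k _ (c • a.1 x y)) = c • Matrix.single _ _ _
    rw [map_smul, Matrix.smul_single]

variable (k) in
/-- The linear map `B(m + 2, r + 1) → B(m, r)` associated to a letter: it sends an element of
`I_x · B · I_y` that is a product of a factor of the kind indicated by the letter and of an element
`b` with `weight_1(b) = weight_2(b) = 0` to a power of `w` or `z` times the element of
`I_{ψ(x)} · B · I_{ψ(y)}` whose `i`-th weight is the `(i + 2)`-nd weight of `b`. All other basis
elements are sent to zero. -/
def Blg.shrink {m r : ℕ} (w z : k) (l : Letter) (x y : IState (m + 2) (r + 1))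
    (hx : x.MPreferred) (hy : y.MPreferred) : Blg k (m + 2) (r + 1) →ₗ[k] Blg k m r :=
  Blg.lift k ((Blg.mk k m r).toLinearMap.comp (B0.shrink k w z l x y hx hy)) (by
    intro a ha
    refine (Blg.mk_eq_zero k).2 (elt_mem_relIdeal _ (B0.shrink_aux w z l x y hx hy a) fun V hV => ?_)
    obtain ⟨W, hW, rfl, hc⟩ := mem_support_shrinkPoly hV
    have hWt := a.2 x y W hW
    exact (mem_vanishIdeal.1 (relIdeal_le _ _ ha) x y W hW).tail hx hy hWt
      (l.coef_ne_zero hWt hc))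

/-- The six types of generators. -/
inductive MinType
  | X0 | X1 | X2 | Y0 | Y1 | Y2
  deriving DecidableEq

instance : Fintype MinType :=
  ⟨{.X0, .X1, .X2, .Y0, .Y1, .Y2}, by intro T; cases T <;> decide⟩

/-- The states that occur as right idempotents of the summand of `MarkedMin` of a given type:
`x ∩ {0, 1, 2}` is `{0}` or `{0, 2}`, resp. `{1}` or `{1, 2}`, resp. `{2}`. -/
def MinType.Admits {m r : ℕ} : MinType → IState m r → Prop
  | .X0, x | .Y0, x => x.Has 0 ∧ ¬ x.Has 1
  | .X1, x | .Y1, x => ¬ x.Has 0 ∧ x.Has 1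
  | .X2, x | .Y2, x => ¬ x.Has 0 ∧ ¬ x.Has 1 ∧ x.Has 2

/-- The states that occur as left idempotents of the summand of the dual module of a given type:
`x ∩ {0, 1, 2}` is `{1}` or `{1, 2}`, resp. `{0}` or `{0, 2}`, resp. `{0, 1}`. -/
def MinType.DualAdmits {m r : ℕ} : MinType → IState m r → Prop
  | .X0, x | .Y0, x => ¬ x.Has 0 ∧ x.Has 1
  | .X1, x | .Y1, x => x.Has 0 ∧ ¬ x.Has 1
  | .X2, x | .Y2, x => x.Has 0 ∧ x.Has 1 ∧ ¬ x.Has 2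

theorem low_eq {m r : ℕ} (x : IState m r) : x.low + x.height 3 = x.height 0 := by
  rw [x.low_add, x.height_zero]

theorem MinType.Admits.mpreferred {m r : ℕ} {T : MinType} {x : IState m r}
    (h : T.Admits x) : x.MPreferred := by
  have h0 := x.height_step 0
  have h1 := x.height_step 1
  have h2 := x.height_step 2
  have h3 := low_eq x
  simp only [Nat.zero_add, Nat.reduceAdd] at h0 h1 h2
  unfold IState.MPreferred IState.Preferred
  cases T <;> simp only [MinType.Admits] at h <;> simp only [IState.has_iff] at h ⊢ <;>
    simp only [Nat.zero_add, Nat.reduceAdd] at h ⊢ <;> omega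

theorem MinType.DualAdmits.preferred {m r : ℕ} {T : MinType} {x : IState m r}
    (h : T.DualAdmits x) : x.Preferred := by
  have h0 := x.height_step 0
  have h1 := x.height_step 1
  have h2 := x.height_step 2
  have h3 := low_eq x
  simp only [Nat.zero_add, Nat.reduceAdd] at h0 h1 h2
  unfold IState.Preferred
  cases T <;> simp only [MinType.DualAdmits] at h <;> simp only [IState.has_iff] at h ⊢ <;>
    simp only [Nat.zero_add, Nat.reduceAdd] at h ⊢ <;> omega

/-- The first two heights of a state are determined by the type that admits it. -/
theorem MinType.DualAdmits.heights {m r : ℕ} {T : MinType} {x y : IState m (r + 1)}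
    (hx : T.DualAdmits x) (hy : T.DualAdmits y) :
    x.height 1 = y.height 1 ∧ x.height 2 = y.height 2 ∧
      (x.height 2 = r ∨ (x.height 2 + 1 = r ∧ x.height 3 + 1 = r)) ∧
      x.height 2 ≤ x.height 1 ∧ x.height 1 ≤ x.height 2 + 1 := by
  have h0 := x.height_step 0
  have h1 := x.height_step 1
  have h2 := x.height_step 2
  have g0 := y.height_step 0
  have g1 := y.height_step 1
  have g2 := y.height_step 2
  have xz := x.height_zero
  have yz := y.height_zero
  simp only [Nat.zero_add, Nat.reduceAdd] at h0 h1 h2 g0 g1 g2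
  cases T <;> simp only [MinType.DualAdmits] at hx hy <;> simp only [IState.has_iff] at hx hy <;>
    simp only [Nat.zero_add, Nat.reduceAdd] at hx hy <;> omega

/-- Prepend two zeroes to a weight vector. -/
def shiftWeight {m : ℕ} (W : Fin m →₀ ℕ) : Fin (m + 2) →₀ ℕ :=
  W.mapDomain fun i => i.succ.succ

theorem shiftWeight_zero {m : ℕ} (W : Fin m →₀ ℕ) : shiftWeight W 0 = 0 :=
  Finsupp.mapDomain_of_notMem_range _ _ (by rintro ⟨i, hi⟩; exact Fin.succ_ne_zero _ hi)

theorem shiftWeight_one {m : ℕ} (W : Fin m →₀ ℕ) : shiftWeight W 1 = 0 :=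
  Finsupp.mapDomain_of_notMem_range _ _ (by
    rintro ⟨i, hi⟩
    have h := congrArg Fin.val hi
    have v1 : ((1 : Fin (m + 2)) : ℕ) = 1 := rfl
    simp only [Fin.val_succ, v1] at h
    omega)

theorem shiftWeight_succ {m : ℕ} (W : Fin m →₀ ℕ) (i : Fin m) :
    shiftWeight W i.succ.succ = W i :=
  Finsupp.mapDomain_apply (f := fun i : Fin m => i.succ.succ)
    (fun _ _ h => Fin.succ_injective _ (Fin.succ_injective _ h)) W i

theorem fin_cases₂ {m : ℕ} (i : Fin (m + 2)) : i = 0 ∨ i = 1 ∨ ∃ j : Fin m, i = j.succ.succ := by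
  refine Fin.cases (Or.inl rfl) (fun i => Or.inr ?_) i
  refine Fin.cases (Or.inl rfl) (fun j => Or.inr ⟨j, rfl⟩) i

theorem IsWeight.shift {m r : ℕ} {T : MinType} {x y : IState (m + 2) (r + 1)}
    (hx : T.DualAdmits x) (hy : T.DualAdmits y) {W : Fin m →₀ ℕ}
    (h : IsWeight (psi x hx.preferred) (psi y hy.preferred) W) :
    IsWeight x y (shiftWeight W) := by
  have hh := hx.heights hy
  have v1 : ((1 : Fin (m + 2)) : ℕ) = 1 := rfl
  intro i
  rcases fin_cases₂ i with rfl | rfl | ⟨j, rfl⟩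
  · refine ⟨0, ?_⟩
    rw [shiftWeight_zero]
    simp only [Fin.val_zero, Nat.zero_add]
    omega
  · refine ⟨0, ?_⟩
    rw [shiftWeight_one]
    simp only [v1, Nat.reduceAdd]
    omega
  · obtain ⟨t, ht⟩ := h j
    refine ⟨t, ?_⟩
    rw [psi_height _ _ _ (by omega), psi_height _ _ _ (by omega)] at ht
    rw [shiftWeight_succ, ht]
    simp only [Fin.val_succ]

theorem Vanishes.shift {m r : ℕ} {T : MinType} {x y : IState (m + 2) (r + 1)}
    (hx : T.DualAdmits x) (hy : T.DualAdmits y) {W : Fin m →₀ ℕ}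
    (h : Vanishes (psi x hx.preferred) (psi y hy.preferred) W) :
    Vanishes x y (shiftWeight W) := by
  obtain ⟨z, i, h1, h2, h3, h4⟩ := h
  obtain ⟨e1, e2, hr, s1, s2⟩ := hx.heights hy
  have hanti : ∀ (x : IState (m + 2) (r + 1)) s t, s ≤ t → x.height t ≤ x.height s := by
    intro x s t hst
    induction t, hst using Nat.le_induction with
    | base => exact le_rfl
    | succ t _ ih => exact (x.height_step t).1.trans ih
  have v1 : ((1 : Fin (m + 2)) : ℕ) = 1 := rfl
  have z0 := z.height_zero
  have zs0 := z.height_step 0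
  have xs0 := x.height_step 0
  have xz := x.height_zero
  simp only [Nat.zero_add] at zs0 xs0
  obtain ⟨u, hu⟩ := IState.exists_of_path (m := m + 2) (r := r + 1)
    (fun t => if t = 0 then r + 1 else if t = 1 then x.height 1 else
      min (z.height (t - 2)) (x.height 2)) (by simp)
    (by
      rw [if_neg (by omega), if_neg (by omega)]
      have e : m + 2 + 1 - 2 = m + 1 := by omega
      rw [e, z.height_top le_rfl]; simp) (by
      intro t _
      rcases Nat.lt_or_ge t 2 with ht | ht
      · have : t = 0 ∨ t = 1 := by omega
        rcases this with rfl | rfl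
        · simp only [Nat.zero_add, if_true, one_ne_zero, if_false]; omega
        · simp only [Nat.reduceAdd, OfNat.ofNat_ne_zero, OfNat.ofNat_ne_one, one_ne_zero, if_true,
            if_false, Nat.sub_self]
          omega
      · obtain ⟨s, rfl⟩ : ∃ s, t = s + 2 := ⟨t - 2, by omega⟩
        have := z.height_step s
        have e : s + 2 + 1 - 2 = s + 1 := by omega
        rw [if_neg (by omega), if_neg (by omega), if_neg (by omega), if_neg (by omega), e,
          Nat.add_sub_cancel]
        omega)
  have u1 : u.height 1 = x.height 1 := by
    rw [hu 1 (by omega)]; simp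
  have hu' : ∀ t, u.height (t + 2) = min (z.height t) (x.height 2) := by
    intro t
    rcases Nat.lt_or_ge (m + 1) t with h | h
    · rw [u.height_top (by omega), z.height_top (by omega)]; simp
    · rw [hu _ (by omega), if_neg (by omega), if_neg (by omega), Nat.add_sub_cancel]
  refine ⟨u, i.succ.succ, ?_, ?_, ?_, ?_⟩
  · simp only [Fin.val_succ]
    have a1 := hu' i.val
    have a2 := hu' (i.val + 1)
    have e : i.val + 1 + 1 + 1 = i.val + 1 + 2 := by omega
    rw [e, a2]
    change u.height (i.val + 2) = _
    rw [a1, h1]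
  · simp only [Fin.val_succ]
    have a1 := hu' (i.val + 1)
    have a2 := hu' (i.val + 1 + 1)
    change u.height (i.val + 1 + 2) = u.height (i.val + 1 + 1 + 2)
    rw [a1, a2, h2]
  · rw [shiftWeight_succ]; exact h3
  · intro j
    rcases fin_cases₂ j with rfl | rfl | ⟨j, rfl⟩
    · rw [shiftWeight_zero]
      simp only [Fin.val_zero, Nat.zero_add]
      omega
    · rw [shiftWeight_one]
      simp only [v1, Nat.reduceAdd]
      have := hu' 0
      simp only [Nat.zero_add] at this
      omega
    · have q := h4 j
      rw [psi_height _ _ _ (by omega), psi_height _ _ _ (by omega)] at q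
      rw [shiftWeight_succ]
      simp only [Fin.val_succ]
      have a1 := hu' (j.val + 1)
      have ax := hanti x 2 (j.val + 1 + 2) (by omega)
      have ay := hanti y 2 (j.val + 1 + 2) (by omega)
      change ((x.height (j.val + 1 + 2) : ℤ) - (u.height (j.val + 1 + 2) : ℤ)).natAbs +
        ((u.height (j.val + 1 + 2) : ℤ) - (y.height (j.val + 1 + 2) : ℤ)).natAbs ≤ _
      omega

theorem mem_support_shift {m : ℕ} {p : MvPolynomial (Fin m) k} {V : Fin (m + 2) →₀ ℕ}
    (hV : V ∈ (MvPolynomial.rename (fun i : Fin m => i.succ.succ) p).support) :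
    ∃ W ∈ p.support, V = shiftWeight W := by
  classical
  rw [MvPolynomial.support_rename_of_injective
    (fun _ _ h => Fin.succ_injective _ (Fin.succ_injective _ h)), Finset.mem_image] at hV
  obtain ⟨W, hW, rfl⟩ := hV
  exact ⟨W, hW, rfl⟩

theorem B0.expand_aux {m r : ℕ} {T : MinType} (x y : IState (m + 2) (r + 1))
    (hx : T.DualAdmits x) (hy : T.DualAdmits y) (a : B0 k m r) :
    ∀ V ∈ (MvPolynomial.rename (fun i : Fin m => i.succ.succ)
      (a.1 (psi x hx.preferred) (psi y hy.preferred))).support, IsWeight x y V := by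
  intro V hV
  obtain ⟨W, hW, rfl⟩ := mem_support_shift hV
  exact (a.2 _ _ W hW).shift hx hy

variable (k) in
/-- The map on `B_0` underlying `expand`. -/
def B0.expand {m r : ℕ} {T : MinType} (x y : IState (m + 2) (r + 1))
    (hx : T.DualAdmits x) (hy : T.DualAdmits y) : B0 k m r →ₗ[k] B0 k (m + 2) (r + 1) where
  toFun a := B0.elt k x y (MvPolynomial.rename (fun i : Fin m => i.succ.succ)
      (a.1 (psi x hx.preferred) (psi y hy.preferred))) (B0.expand_aux x y hx hy a)
  map_add' a b := by
    classical
    apply Subtype.ext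
    change Matrix.single _ _ (MvPolynomial.rename _ (a.1 _ _ + b.1 _ _)) = Matrix.single _ _ _ +
      Matrix.single _ _ _
    rw [map_add, Matrix.single_add]
  map_smul' c a := by
    classical
    apply Subtype.ext
    change Matrix.single _ _ (MvPolynomial.rename _ (c • a.1 _ _)) = c • Matrix.single _ _ _
    rw [map_smul, Matrix.smul_single]

variable (k) in
/-- The linear map `B(m, r) → I_x · B(m + 2, r + 1) · I_y`, for states `x` and `y` admitted by the
same type, that sends an element `b` of `I_{φ(x)} · B · I_{φ(y)}` to the element `b'` with
`weight_i(b') = weight_{i-2}(b)` and `weight_1(b') = weight_2(b') = 0`, and that vanishes on the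
other summands `I_{x'} · B · I_{y'}`. -/
def Blg.expand {m r : ℕ} {T : MinType} (x y : IState (m + 2) (r + 1))
    (hx : T.DualAdmits x) (hy : T.DualAdmits y) : Blg k m r →ₗ[k] Blg k (m + 2) (r + 1) :=
  Blg.lift k ((Blg.mk k (m + 2) (r + 1)).toLinearMap.comp (B0.expand k x y hx hy)) (by
    intro a ha
    refine (Blg.mk_eq_zero k).2 (elt_mem_relIdeal _ (B0.expand_aux x y hx hy a) fun V hV => ?_)
    obtain ⟨W, hW, rfl⟩ := mem_support_shift hV
    exact (mem_vanishIdeal.1 (relIdeal_le _ _ ha) _ _ W hW).shift hx hy)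

/-! ### Curved differential graded algebras in characteristic two -/

variable (k) in
/-- A curved differential algebra structure (in characteristic two, so without signs) on the
`k`-algebra `A`, with an idempotent ring spanned by orthogonal idempotents indexed by `I`. -/
structure CurvedDG (A I : Type) [Ring A] [Algebra k A] [Fintype I] where
  /-- the basic idempotents -/
  idem : I → A
  /-- the differential `μ_1` -/
  d : A →ₗ[k] A
  /-- the curvature `μ_0` -/
  curv : A
  complete : CompleteOrthogonalIdempotents idem
  d_idem : ∀ i, d (idem i) = 0
  leibniz : ∀ a b, d (a * b) = d a * b + a * d b
  d_d : ∀ a, d (d a) = curv * a + a * curv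
  d_curv : d curv = 0
  idem_curv : ∀ i, idem i * curv = curv * idem i

theorem add_self_of_char_two [CharP k 2] {V : Type} [AddCommGroup V] [Module k V] (v : V) :
    v + v = 0 := by
  rw [← two_smul k v, CharTwo.two_eq_zero, zero_smul]

/-- The tensor product over `k` of two curved differential algebras. -/
def CurvedDG.tensor [CharP k 2] {A B I J : Type} [Ring A] [Algebra k A] [Fintype I] [Ring B]
    [Algebra k B] [Fintype J] (C : CurvedDG k A I) (D : CurvedDG k B J) :
    CurvedDG k (A ⊗[k] B) (I × J) where
  idem p := C.idem p.1 ⊗ₜ D.idem p.2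
  d := TensorProduct.map C.d LinearMap.id + TensorProduct.map LinearMap.id D.d
  curv := C.curv ⊗ₜ 1 + 1 ⊗ₜ D.curv
  complete :=
    { idem := fun p => by
        change _ * _ = _
        rw [Algebra.TensorProduct.tmul_mul_tmul, (C.complete.idem _).eq, (D.complete.idem _).eq]
      ortho := fun p q hpq => by
        change _ * _ = _
        rw [Algebra.TensorProduct.tmul_mul_tmul]
        by_cases h : p.1 = q.1
        · have h' : p.2 ≠ q.2 := fun h' => hpq (Prod.ext h h')
          have := D.complete.ortho h'
          simp only at this
          rw [this, TensorProduct.tmul_zero]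
        · have := C.complete.ortho h
          simp only at this
          rw [this, TensorProduct.zero_tmul]
      complete := by
        rw [Fintype.sum_prod_type]
        simp only [← TensorProduct.tmul_sum, D.complete.complete, ← TensorProduct.sum_tmul,
          C.complete.complete]
        rfl }
  d_idem p := by simp [C.d_idem, D.d_idem]
  leibniz x y := by
    induction x using TensorProduct.induction_on with
    | zero => simp
    | add x x' hx hx' => rw [add_mul, map_add, hx, hx', map_add, add_mul, add_mul]; abel
    | tmul a b =>
      induction y using TensorProduct.induction_on with
      | zero => simp
      | add y y' hy hy' => rw [mul_add, map_add, hy, hy', map_add, mul_add, mul_add]; abel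
      | tmul a' b' =>
        simp only [Algebra.TensorProduct.tmul_mul_tmul, LinearMap.add_apply,
          TensorProduct.map_tmul, LinearMap.id_coe, id_eq, C.leibniz, D.leibniz,
          TensorProduct.add_tmul, TensorProduct.tmul_add, add_mul, mul_add]
        abel
  d_d x := by
    induction x using TensorProduct.induction_on with
    | zero => simp
    | add x x' hx hx' => rw [map_add, map_add, hx, hx', mul_add _ x x', add_mul x x']; abel
    | tmul a b =>
      have h := add_self_of_char_two (k := k) (C.d a ⊗ₜ[k] D.d b)
      simp only [LinearMap.add_apply, TensorProduct.map_tmul, LinearMap.id_coe, id_eq, map_add,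
        C.d_d, D.d_d, add_mul, mul_add, Algebra.TensorProduct.tmul_mul_tmul, one_mul, mul_one,
        TensorProduct.add_tmul, TensorProduct.tmul_add]
      rw [show ∀ p q r s t u : A ⊗[k] B, p + q + r + (s + (t + u)) = p + q + t + u + (r + s) from
        fun p q r s t u => by abel, h]
      abel
  d_curv := by
    have hC : C.d 1 = 0 := by
      rw [← C.complete.complete, map_sum]; exact Finset.sum_eq_zero fun i _ => C.d_idem i
    have hD : D.d 1 = 0 := by
      rw [← D.complete.complete, map_sum]; exact Finset.sum_eq_zero fun i _ => D.d_idem i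
    simp [C.d_curv, D.d_curv, hC, hD]
  idem_curv p := by
    simp [mul_add, add_mul, C.idem_curv, D.idem_curv]

/-! ### The algebras -/

theorem B0.idem_val {m r : ℕ} [DecidableEq (IState m r)] (x : IState m r) :
    (B0.idem k x).1 = Matrix.single x x 1 := by
  unfold B0.idem B0.elt
  congr!

theorem B0.complete_idem (m r : ℕ) :
    CompleteOrthogonalIdempotents (fun x : IState m r => B0.idem k x) := by
  classical
  refine ⟨⟨fun x => ?_, fun x y hxy => ?_⟩, ?_⟩
  · apply Subtype.ext
    change (B0.idem k x).1 * (B0.idem k x).1 = (B0.idem k x).1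
    rw [B0.idem_val, Matrix.single_mul_single_same, mul_one]
  · apply Subtype.ext
    change (B0.idem k x).1 * (B0.idem k y).1 = 0
    rw [B0.idem_val, B0.idem_val, Matrix.single_mul_single_of_ne]
    exact hxy
  · apply Subtype.ext
    rw [AddSubmonoidClass.coe_finsetSum]
    simp only [B0.idem_val]
    rw [Matrix.sum_single_one]
    rfl

theorem Blg.complete_idem (m r : ℕ) :
    CompleteOrthogonalIdempotents (fun x : IState m r => Blg.idem k x) :=
  (B0.complete_idem (k := k) m r).map (Blg.mk k m r).toRingHom

theorem Blg.U_comm {m r : ℕ} (i : Fin m) (a : Blg k m r) : Blg.U k i * a = a * Blg.U k i := by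
  classical
  obtain ⟨a, rfl⟩ := Blg.mk_surjective k m r a
  unfold Blg.U
  rw [← map_mul, ← map_mul]
  congr 1
  apply Subtype.ext
  change Matrix.scalar _ _ * a.1 = a.1 * Matrix.scalar _ _
  exact (Matrix.scalar_commute _ (fun _ => Commute.all _ _) a.1).eq

/-- A matching on `{1, ..., m}`, indexed by `Fin m` (so `i : Fin m` stands for `i + 1`). -/
structure Matching (m : ℕ) where
  /-- the element matched with `i` -/
  partner : Fin m → Fin m
  partner_partner : ∀ i, partner (partner i) = i
  partner_ne : ∀ i, partner i ≠ i

/-- The matching on `{1, ..., m + 2}` that consists of `{1, 2}` and of the pairs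
`{i + 2, j + 2}` for which `{i, j}` belongs to the given matching. -/
def Matching.extend {m : ℕ} (M : Matching m) : Matching (m + 2) where
  partner := Fin.cases 1 (Fin.cases 0 fun i => (M.partner i).succ.succ)
  partner_partner i := by
    rcases fin_cases₂ i with rfl | rfl | ⟨j, rfl⟩
    · rfl
    · rfl
    · simp [M.partner_partner]
  partner_ne i := by
    rcases fin_cases₂ i with rfl | rfl | ⟨j, rfl⟩
    · exact Fin.succ_ne_zero (0 : Fin (m + 1))
    · exact (Fin.succ_ne_zero (0 : Fin (m + 1))).symm
    · simp [M.partner_ne]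

variable (k) in
/-- The curved algebra `B(m, r)` with zero differential and with curvature
`∑ U_i U_j`, the sum being over the pairs `{i, j}` of the matching. -/
def cBlg [CharP k 2] {m : ℕ} (M : Matching m) (r : ℕ) : CurvedDG k (Blg k m r) (IState m r) where
  idem := Blg.idem k
  d := 0
  curv := ∑ i ∈ Finset.univ.filter (fun i => i < M.partner i), Blg.U k i * Blg.U k (M.partner i)
  complete := Blg.complete_idem m r
  d_idem _ := rfl
  leibniz _ _ := by simp
  d_d a := by
    have : ∀ c : Blg k m r, c * a = a * c → 0 = c * a + a * c := fun c hc => by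
      rw [hc, add_self_of_char_two (k := k)]
    refine this _ ?_
    rw [Finset.sum_mul, Finset.mul_sum]
    refine Finset.sum_congr rfl fun i _ => ?_
    exact (Commute.mul_left (Blg.U_comm i a) (Blg.U_comm (M.partner i) a)).eq
  d_curv := rfl
  idem_curv x := by
    rw [Finset.sum_mul, Finset.mul_sum]
    refine Finset.sum_congr rfl fun i _ => ?_
    exact (Commute.mul_right (Blg.U_comm i _).symm (Blg.U_comm (M.partner i) _).symm).eq

variable (k) in
/-- The quadratic form `∑ x_i x_j`, the sum being over the pairs `{i, j}` of the matching. -/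
def Matching.quad {m : ℕ} (M : Matching m) : QuadraticForm k (Fin m → k) :=
  ∑ i ∈ Finset.univ.filter (fun i => i < M.partner i),
    QuadraticMap.linMulLin (LinearMap.proj i) (LinearMap.proj (M.partner i))

variable (k) in
/-- The algebra `B'` obtained from `B(m, r)` by adjoining elements `E_i` that commute with
`B(m, r)` and satisfy `E_i ^ 2 = 0` and `[E_i, E_j] = 1` or `0` according to whether `{i, j}` belongs
to the matching or not. The `E_i` generate the Clifford algebra of the form `M.quad k`. -/
abbrev DuAlg {m : ℕ} (M : Matching m) (r : ℕ) : Type :=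
  Blg k m r ⊗[k] CliffordAlgebra (M.quad k)

/-- The element of `B'` given by an element of `B(m, r)`. -/
def DuAlg.of {m : ℕ} {M : Matching m} {r : ℕ} (b : Blg k m r) : DuAlg k M r := b ⊗ₜ 1

variable (k) in
/-- The element `E_{i+1}`. -/
def DuAlg.E {m : ℕ} {M : Matching m} {r : ℕ} (i : Fin m) : DuAlg k M r :=
  1 ⊗ₜ CliffordAlgebra.ι (M.quad k) (Pi.single i 1)

theorem Matching.quad_single {m : ℕ} (M : Matching m) (i : Fin m) :
    M.quad k (Pi.single i 1) = 0 := by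
  unfold Matching.quad
  rw [sum_apply]
  refine Finset.sum_eq_zero fun j _ => ?_
  rw [QuadraticMap.linMulLin_apply, LinearMap.proj_apply, LinearMap.proj_apply]
  by_cases h : j = i
  · subst h
    rw [Pi.single_eq_of_ne (M.partner_ne j), mul_zero]
  · rw [Pi.single_eq_of_ne h, zero_mul]

theorem DuAlg.E_sq {m : ℕ} {M : Matching m} {r : ℕ} (i : Fin m) :
    (DuAlg.E k i : DuAlg k M r) * DuAlg.E k i = 0 := by
  unfold DuAlg.E
  rw [Algebra.TensorProduct.tmul_mul_tmul, CliffordAlgebra.ι_sq_scalar, M.quad_single, map_zero,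
    TensorProduct.tmul_zero]

theorem contractLeft_mul [CharP k 2] {V : Type} [AddCommGroup V] [Module k V]
    {Q : QuadraticForm k V} (f : Module.Dual k V) (a b : CliffordAlgebra Q) :
    CliffordAlgebra.contractLeft f (a * b) =
      CliffordAlgebra.contractLeft f a * b + a * CliffordAlgebra.contractLeft f b := by
  have hneg : ∀ x : CliffordAlgebra Q, -x = x := fun x =>
    neg_eq_of_add_eq_zero_left (add_self_of_char_two (k := k) x)
  induction a using CliffordAlgebra.left_induction with
  | algebraMap c =>
    rw [CliffordAlgebra.contractLeft_algebraMap, zero_mul, zero_add, ← Algebra.smul_def, map_smul,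
      Algebra.smul_def]
  | add x y hx hy => rw [add_mul, map_add, hx, hy, map_add, add_mul, add_mul]; abel
  | ι_mul x v hx =>
    rw [mul_assoc, CliffordAlgebra.contractLeft_ι_mul, CliffordAlgebra.contractLeft_ι_mul, hx,
      sub_eq_add_neg, sub_eq_add_neg, hneg, hneg, add_mul, mul_add, smul_mul_assoc, mul_assoc,
      mul_assoc, add_assoc]

variable (k) in
/-- The differential of `B'`: the derivation that vanishes on `B(m, r)` and has `d E_i = U_i`. -/
def DuAlg.d {m : ℕ} (M : Matching m) (r : ℕ) : DuAlg k M r →ₗ[k] DuAlg k M r :=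
  ∑ i : Fin m, TensorProduct.map (LinearMap.mulLeft k (Blg.U k i))
    (CliffordAlgebra.contractLeft (Q := M.quad k) (LinearMap.proj i))

theorem DuAlg.d_tmul {m : ℕ} (M : Matching m) (r : ℕ) (b : Blg k m r)
    (c : CliffordAlgebra (M.quad k)) : DuAlg.d k M r (b ⊗ₜ c) =
      ∑ i : Fin m, (Blg.U k i * b) ⊗ₜ[k]
        CliffordAlgebra.contractLeft (Q := M.quad k) (LinearMap.proj i) c := by
  simp [DuAlg.d]

theorem DuAlg.d_of {m : ℕ} (M : Matching m) (r : ℕ) (b : Blg k m r) :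
    DuAlg.d k M r (DuAlg.of b) = 0 := by
  unfold DuAlg.of
  rw [DuAlg.d_tmul]
  refine Finset.sum_eq_zero fun i _ => ?_
  rw [CliffordAlgebra.contractLeft_one, TensorProduct.tmul_zero]

theorem DuAlg.d_E {m : ℕ} (M : Matching m) (r : ℕ) (i : Fin m) :
    DuAlg.d k M r (DuAlg.E k i) = DuAlg.of (Blg.U k i) := by
  unfold DuAlg.E DuAlg.of
  rw [DuAlg.d_tmul, Finset.sum_eq_single i]
  · rw [CliffordAlgebra.contractLeft_ι, LinearMap.proj_apply, Pi.single_eq_same, map_one, mul_one]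
  · intro j _ hj
    rw [CliffordAlgebra.contractLeft_ι, LinearMap.proj_apply, Pi.single_eq_of_ne hj, map_zero,
      TensorProduct.tmul_zero]
  · intro h; exact (h (Finset.mem_univ _)).elim

theorem DuAlg.leibniz [CharP k 2] {m : ℕ} (M : Matching m) (r : ℕ) (x y : DuAlg k M r) :
    DuAlg.d k M r (x * y) = DuAlg.d k M r x * y + x * DuAlg.d k M r y := by
  induction x using TensorProduct.induction_on with
  | zero => simp
  | add x x' hx hx' => rw [add_mul, map_add, hx, hx', map_add, add_mul, add_mul]; abel
  | tmul a b =>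
    induction y using TensorProduct.induction_on with
    | zero => simp
    | add y y' hy hy' => rw [mul_add, map_add, hy, hy', map_add, mul_add, mul_add]; abel
    | tmul a' b' =>
      simp only [Algebra.TensorProduct.tmul_mul_tmul, DuAlg.d_tmul, Finset.sum_mul,
        Finset.mul_sum, contractLeft_mul, TensorProduct.tmul_add, Finset.sum_add_distrib]
      congr 1
      · simp only [mul_assoc]
      · refine Finset.sum_congr rfl fun i _ => ?_
        rw [← mul_assoc, Blg.U_comm, mul_assoc]

theorem DuAlg.d_d [CharP k 2] {m : ℕ} (M : Matching m) (r : ℕ) (x : DuAlg k M r) :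
    DuAlg.d k M r (DuAlg.d k M r x) = 0 := by
  induction x using TensorProduct.induction_on with
  | zero => simp
  | add x x' hx hx' => rw [map_add, map_add, hx, hx', add_zero]
  | tmul a b =>
    have hneg : ∀ x : CliffordAlgebra (M.quad k), -x = x := fun x =>
      neg_eq_of_add_eq_zero_left (add_self_of_char_two (k := k) x)
    rw [DuAlg.d_tmul, map_sum]
    simp only [DuAlg.d_tmul]
    rw [← Finset.sum_product']
    refine Finset.sum_involution (fun p _ => (p.2, p.1)) ?_ ?_ ?_ ?_
    · rintro ⟨i, j⟩ _
      simp only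
      rw [CliffordAlgebra.contractLeft_comm, hneg, ← mul_assoc, Blg.U_comm, ← mul_assoc]
      exact add_self_of_char_two (k := k) _
    · rintro ⟨i, j⟩ _ h h'
      apply h
      simp only [Prod.mk.injEq] at h'
      simp only
      rw [h'.1, CliffordAlgebra.contractLeft_contractLeft, TensorProduct.tmul_zero]
    · intro _ _; simp
    · intro _ _; rfl

variable (k) in
/-- The differential algebra `B'`. -/
def nDuAlg [CharP k 2] {m : ℕ} (M : Matching m) (r : ℕ) : CurvedDG k (DuAlg k M r) (IState m r) where
  idem x := DuAlg.of (Blg.idem k x)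
  d := DuAlg.d k M r
  curv := 0
  complete := (Blg.complete_idem (k := k) m r).map
    (Algebra.TensorProduct.includeLeft (R := k) (S := k) (A := Blg k m r)
      (B := CliffordAlgebra (M.quad k))).toRingHom
  d_idem x := DuAlg.d_of M r _
  leibniz := DuAlg.leibniz M r
  d_d a := by rw [DuAlg.d_d, zero_mul, mul_zero, add_zero]
  d_curv := map_zero _
  idem_curv x := by rw [mul_zero, zero_mul]

variable (k) in
/-- The inclusion `(x_i) ↦ (0, 0, x_1, x_2, ...)`, which preserves the quadratic forms. -/
def Matching.shiftIso {m : ℕ} (M : Matching m) : M.quad k →qᵢ M.extend.quad k where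
  toFun x := Fin.cons 0 (Fin.cons 0 x)
  map_add' x y := by
    ext i
    rcases fin_cases₂ i with rfl | h | ⟨j, rfl⟩
    · simp
    · obtain rfl : i = Fin.succ 0 := h
      simp
    · simp
  map_smul' c x := by
    ext i
    rcases fin_cases₂ i with rfl | h | ⟨j, rfl⟩
    · simp
    · obtain rfl : i = Fin.succ 0 := h
      simp
    · simp
  map_app' x := by
    unfold Matching.quad
    rw [sum_apply, sum_apply, Finset.sum_filter, Finset.sum_filter,
      Fin.sum_univ_succ, Fin.sum_univ_succ]
    simp [Matching.extend]

variable (k) in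
/-- The algebra map `E_i ↦ E_{i+2}`. -/
def Matching.shiftE {m : ℕ} (M : Matching m) :
    CliffordAlgebra (M.quad k) →ₐ[k] CliffordAlgebra (M.extend.quad k) :=
  CliffordAlgebra.map (M.shiftIso k)

theorem Matching.shiftE_ι_single {m : ℕ} (M : Matching m) (i : Fin m) :
    M.shiftE k (CliffordAlgebra.ι (M.quad k) (Pi.single i 1)) =
      CliffordAlgebra.ι (M.extend.quad k) (Pi.single i.succ.succ 1) := by
  unfold Matching.shiftE
  rw [CliffordAlgebra.map_apply_ι]
  congr 1
  change (Fin.cons 0 (Fin.cons 0 (Pi.single i 1)) : Fin (m + 2) → k) = _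
  ext j
  rcases fin_cases₂ j with rfl | h | ⟨l, rfl⟩
  · rw [Fin.cons_zero, Pi.single_eq_of_ne (Fin.succ_ne_zero _).symm]
  · obtain rfl : j = Fin.succ 0 := h
    rw [Fin.cons_succ, Fin.cons_zero, Pi.single_eq_of_ne]
    exact fun h => (Fin.succ_ne_zero _).symm (Fin.succ_injective _ h)
  · simp [Pi.single_apply]

/-! ### Type D structures

A type D structure is described by its finite set of generators, each with its idempotent, and by
the matrix of `δ`: the coefficient of `h` in `δ(g)` is `δ g h`. -/

/-- The data of a curved type D structure over `C`. -/
structure PreTypeD {A I : Type} [Ring A] [Algebra k A] [Fintype I] (C : CurvedDG k A I) where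
  /-- the generators -/
  Gen : Type
  [fintype : Fintype Gen]
  /-- the idempotents of the generators -/
  ι : Gen → I
  /-- the coefficients of the structure map `δ` -/
  δ : Matrix Gen Gen A

attribute [instance] PreTypeD.fintype

section TypeD

variable {A I : Type} [Ring A] [Algebra k A] [Fintype I] {C : CurvedDG k A I}

/-- The coefficients of a map `X → A ⊗ Y` that is compatible with the idempotents. -/
def PreTypeD.IdemCompat (X Y : PreTypeD C) (f : Matrix X.Gen Y.Gen A) : Prop :=
  ∀ g h, C.idem (X.ι g) * f g h = f g h ∧ f g h * C.idem (Y.ι h) = f g h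

open Classical in
/-- The identity morphism. -/
def PreTypeD.one (X : PreTypeD C) : Matrix X.Gen X.Gen A :=
  Matrix.diagonal fun g => C.idem (X.ι g)

open Classical in
/-- The curved type D structure equation. -/
def PreTypeD.IsTypeD (X : PreTypeD C) : Prop :=
  X.IdemCompat X X.δ ∧
    X.δ.map C.d + X.δ * X.δ + Matrix.diagonal (fun g => C.curv * C.idem (X.ι g)) = 0

/-- The differential on morphisms. -/
def PreTypeD.dMor (X Y : PreTypeD C) (f : Matrix X.Gen Y.Gen A) : Matrix X.Gen Y.Gen A :=
  f.map C.d + X.δ * f + f * Y.δ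

/-- `X` and `Y` are homotopy equivalent (curved) type D structures. -/
def PreTypeD.HomotopyEquivalent (X Y : PreTypeD C) : Prop :=
  X.IsTypeD ∧ Y.IsTypeD ∧
    ∃ (f : Matrix X.Gen Y.Gen A) (g : Matrix Y.Gen X.Gen A)
      (p : Matrix X.Gen X.Gen A) (q : Matrix Y.Gen Y.Gen A),
      X.IdemCompat Y f ∧ Y.IdemCompat X g ∧ X.IdemCompat X p ∧ Y.IdemCompat Y q ∧
      X.dMor Y f = 0 ∧ Y.dMor X g = 0 ∧
      f * g + X.one = X.dMor X p ∧ g * f + Y.one = Y.dMor Y q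

/-- A type D structure over `C ⊗ D` as one over `D ⊗ C`. -/
def PreTypeD.swap [CharP k 2] {B J : Type} [Ring B] [Algebra k B] [Fintype J] {D : CurvedDG k B J}
    (X : PreTypeD (C.tensor D)) : PreTypeD (D.tensor C) where
  Gen := X.Gen
  ι g := (X.ι g).swap
  δ := X.δ.map (TensorProduct.comm k A B)

end TypeD

/-! ### Type DA bimodules -/

section TypeDA

variable {A I B J : Type} [Ring A] [Algebra k A] [Fintype I] [Ring B] [Algebra k B] [Fintype J]

/-- The data of a (curved) type DA bimodule with output algebra `C` and input algebra `D`: the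
generators, their left and right idempotents, and the structure maps; `δ [b_1, ..., b_j] g h` is the
coefficient of `h` in `δ^1_{1+j}(g, b_1, ..., b_j)`. -/
structure PreDA (C : CurvedDG k A I) (D : CurvedDG k B J) where
  /-- the generators -/
  Gen : Type
  [fintype : Fintype Gen]
  /-- the left idempotents -/
  l : Gen → I
  /-- the right idempotents -/
  r : Gen → J
  /-- the coefficients of the structure maps -/
  δ : List B → Matrix Gen Gen A

attribute [instance] PreDA.fintype

/-- `∑ f [b_1, ..., b_i] * f [b_{i+1}, ..., b_j]` over `0 ≤ i ≤ j`. -/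
def splits {G : Type} [Fintype G] (f : List B → Matrix G G A) (bs : List B) : Matrix G G A :=
  ∑ i ∈ Finset.range (bs.length + 1), f (bs.take i) * f (bs.drop i)

/-- The lists obtained from `bs` by applying the map `d` to one entry. -/
def differentials (d : B → B) : List B → List (List B)
  | [] => []
  | b :: bs => (d b :: bs) :: (differentials d bs).map (b :: ·)

/-- The lists obtained from `bs` by multiplying two consecutive entries. -/
def contractions : List B → List (List B)
  | b :: c :: bs => (b * c :: bs) :: (contractions (c :: bs)).map (b :: ·)
  | _ => []

/-- The lists obtained from `bs` by inserting `c` somewhere. -/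
def insertions (c : B) : List B → List (List B)
  | [] => [[c]]
  | b :: bs => (c :: b :: bs) :: (insertions c bs).map (b :: ·)

variable {C : CurvedDG k A I} {D : CurvedDG k B J}

open Classical in
/-- The curved type DA structure equation for the inputs `bs`. -/
def PreDA.Relation (X : PreDA C D) (bs : List B) : Prop :=
  (X.δ bs).map C.d + splits X.δ bs + ((differentials D.d bs).map X.δ).sum +
    ((contractions bs).map X.δ).sum + ((insertions D.curv bs).map X.δ).sum +
    (if bs = [] then Matrix.diagonal (fun g => C.curv * C.idem (X.l g)) else 0) = 0

/-- `X` is a (curved) type DA bimodule: the structure maps are linear in each input, compatible with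
the idempotents (that is, they are maps `X ⊗ B ⊗ ... ⊗ B → A ⊗ X` of bimodules, where the
tensor products are over the idempotent rings), and satisfy the structure equation. -/
structure PreDA.IsTypeDA (X : PreDA C D) : Prop where
  map_add : ∀ bs cs (b c : B),
    X.δ (bs ++ (b + c) :: cs) = X.δ (bs ++ b :: cs) + X.δ (bs ++ c :: cs)
  map_smul : ∀ bs cs (t : k) (b : B), X.δ (bs ++ (t • b) :: cs) = t • X.δ (bs ++ b :: cs)
  out_left : ∀ bs g h, C.idem (X.l g) * X.δ bs g h = X.δ bs g h
  out_right : ∀ bs g h, X.δ bs g h * C.idem (X.l h) = X.δ bs g h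
  in_nil : ∀ g h, X.r g ≠ X.r h → X.δ [] g h = 0
  in_left : ∀ b bs g h, X.δ (D.idem (X.r g) * b :: bs) g h = X.δ (b :: bs) g h
  in_middle : ∀ bs cs b c j,
    X.δ (bs ++ (b * D.idem j) :: c :: cs) = X.δ (bs ++ b :: (D.idem j * c) :: cs)
  in_right : ∀ bs b g h, X.δ (bs ++ [b * D.idem (X.r h)]) g h = X.δ (bs ++ [b]) g h
  relation : ∀ bs, X.Relation bs

open Classical in
/-- `X` is (strictly) unital. -/
def PreDA.IsUnital (X : PreDA C D) : Prop :=
  X.δ [1] = Matrix.diagonal (fun g => C.idem (X.l g)) ∧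
    ∀ bs : List B, 1 < bs.length → 1 ∈ bs → X.δ bs = 0

end TypeDA

/-! ### Type DD bimodules and box tensor products -/

section TypeDD

variable {A I B J E K : Type} [Ring A] [Algebra k A] [Fintype I] [Ring B] [Algebra k B] [Fintype J]
  [Ring E] [Algebra k E] [Fintype K]

/-- The data of a type DD bimodule, that is, of a type D structure over `D ⊗ F`, with the
structure map written out in terms of elementary tensors: the coefficient of `h` in `δ(g)` is
the sum of `fst t g h ⊗ snd t g h` over all `t`. -/
structure PreDD (D : CurvedDG k B J) (F : CurvedDG k E K) where
  /-- the generators -/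
  Gen : Type
  [fintype : Fintype Gen]
  /-- the idempotents over the first algebra -/
  ι₁ : Gen → J
  /-- the idempotents over the second algebra -/
  ι₂ : Gen → K
  /-- the indices of the elementary tensors -/
  Term : Type
  [fintypeTerm : Fintype Term]
  /-- first factors -/
  fst : Term → Gen → Gen → B
  /-- second factors -/
  snd : Term → Gen → Gen → E

attribute [instance] PreDD.fintype PreDD.fintypeTerm

variable {C : CurvedDG k A I} {D : CurvedDG k B J} {F : CurvedDG k E K}

/-- Exchange the two algebras. -/
def PreDD.swap (Y : PreDD D F) : PreDD F D where
  Gen := Y.Gen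
  ι₁ := Y.ι₂
  ι₂ := Y.ι₁
  Term := Y.Term
  fst := Y.snd
  snd := Y.fst

/-- The type D structure over `D ⊗ F`. -/
def PreDD.toTypeD [CharP k 2] (Y : PreDD D F) : PreTypeD (D.tensor F) where
  Gen := Y.Gen
  ι g := (Y.ι₁ g, Y.ι₂ g)
  δ g h := ∑ t, Y.fst t g h ⊗ₜ Y.snd t g h

open Classical in
/-- If the `j`-fold iterate of the structure map of `Y` takes `κ` to the sum of the terms
`(b_1 ⊗ ... ⊗ b_j) ⊗ c ⊗ κ'`, then this is the sum of the `φ [b_1, ..., b_j] ⊗ c` over the terms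
with `κ' = κ₁`. -/
def PreDD.iter (Y : PreDD D F) (κ₁ : Y.Gen) : ℕ → Y.Gen → (List B → A) → A ⊗[k] E
  | 0, κ, φ => if κ = κ₁ then φ [] ⊗ₜ F.idem (Y.ι₂ κ) else 0
  | j + 1, κ, φ => ∑ κ', ∑ t,
      (1 ⊗ₜ Y.snd t κ κ') * PreDD.iter Y κ₁ j κ' (fun bs => φ (Y.fst t κ κ' :: bs))

open Classical in
/-- The box tensor product of a type DA bimodule with a type DD bimodule, as a type D structure
over `C ⊗ F`. Its generators are the pairs of generators with matching idempotents; the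
structure map is `∑_j (δ^1_{1+j} ⊗ id) ∘ (id ⊗ δ^j)`, where `δ^j` is the `j`-fold iterate of the
structure map of `Y`. (The sum is finite as soon as `δ^1_{1+j} = 0` for all large `j`, as is the
case for both bimodules below.) -/
def PreDA.box [CharP k 2] (X : PreDA C D) (Y : PreDD D F) : PreTypeD (C.tensor F) where
  Gen := {p : X.Gen × Y.Gen // X.r p.1 = Y.ι₁ p.2}
  ι p := (X.l p.1.1, Y.ι₂ p.1.2)
  δ p q := ∑ᶠ j : ℕ, Y.iter q.1.2 j p.1.2 (fun bs => X.δ bs p.1.1 q.1.1)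

end TypeDD

/-! ### The canonical DD bimodule -/

/-- The complement of a state. -/
def IState.compl {m r s : ℕ} (h : r + s = m + 1) (x : IState m r) : IState m s :=
  ⟨x.1ᶜ, by rw [Finset.card_compl, Fintype.card_fin, x.2]; omega⟩

/-- The three kinds of terms `L_i ⊗ R_i`, `R_i ⊗ L_i` and `U_i ⊗ E_i`. -/
inductive CanonKind
  | LR | RL | UE
  deriving DecidableEq

instance : Fintype CanonKind := ⟨{.LR, .RL, .UE}, by intro T; cases T <;> decide⟩

variable (k) in
/-- The canonical type DD bimodule, generated by the states for `B(m, r)`; the idempotents of the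
generator `x` are `I_x` and `I_{x'}`, where `x'` is the complement of `x`, and the structure map is
multiplication by `∑ (L_i ⊗ R_i + R_i ⊗ L_i + U_i ⊗ E_i)`. -/
def canonDD [CharP k 2] {m r s : ℕ} (M : Matching m) (hrs : r + s = m + 1) :
    PreDD (cBlg k M r) (nDuAlg k M s) where
  Gen := IState m r
  ι₁ x := x
  ι₂ x := x.compl hrs
  Term := Fin m × CanonKind
  fst t x y := Blg.idem k x *
    (match t with
      | (i, .LR) => Blg.L k i
      | (i, .RL) => Blg.R k i
      | (i, .UE) => Blg.U k i) * Blg.idem k y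
  snd t x y := DuAlg.of (Blg.idem k (x.compl hrs)) *
    (match t with
      | (i, .LR) => DuAlg.of (Blg.R k i)
      | (i, .RL) => DuAlg.of (Blg.L k i)
      | (i, .UE) => DuAlg.E k i) * DuAlg.of (Blg.idem k (y.compl hrs))

/-! ### The bimodule `MarkedMin` -/

/-- The generators of `MarkedMin`: a type together with the right idempotent. -/
abbrev MinGen (m r : ℕ) : Type := {p : MinType × IState m r // p.1.Admits p.2}

/-- The generators of the dual module: a type together with the left idempotent. -/
abbrev DualMinGen (m r : ℕ) : Type := {p : MinType × IState m r // p.1.DualAdmits p.2}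

instance : Fintype Letter := ⟨{.one, .first, .second}, by intro T; cases T <;> decide⟩

open Classical in
instance (m r : ℕ) : Fintype (MinGen m r) := Subtype.fintype _

open Classical in
instance (m r : ℕ) : Fintype (DualMinGen m r) := Subtype.fintype _

/-- The coefficients of `δ^1_1`. -/
def minCoef₀ (w z : k) : MinType → MinType → k
  | .Y1, .X1 => w * z
  | .Y2, .X2 => w
  | .Y0, .X0 => z
  | _, _ => 0

/-- The coefficients of `δ^1_2`. -/
def minCoef₁ (w z : k) : MinType → MinType → Letter → k
  | .X1, .X2, .second => 1
  | .X2, .X1, .second => z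
  | .X1, .X0, .first => 1
  | .X0, .X1, .first => w
  | .Y2, .Y1, .second => 1
  | .Y1, .Y2, .second => z
  | .Y0, .Y1, .first => 1
  | .Y1, .Y0, .first => w
  | .X1, .X1, .one | .Y1, .Y1, .one => 1
  | .X1, .X1, .first | .Y1, .Y1, .first => w
  | .X1, .X1, .second | .Y1, .Y1, .second => z
  | .X0, .X0, .one | .Y0, .Y0, .one => 1
  | .X0, .X0, .first | .Y0, .Y0, .first => w
  | .X2, .X2, .one | .Y2, .Y2, .one => 1
  | .X2, .X2, .second | .Y2, .Y2, .second => z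
  | _, _, _ => 0

/-- The coefficients of `δ^1_3`. -/
def minCoef₂ : MinType → MinType → Letter → Letter → k
  | .X1, .Y1, .first, .second => 1
  | .X1, .Y1, .second, .first => 1
  | .X0, .Y2, .first, .second => 1
  | .X2, .Y0, .second, .first => 1
  | .X1, .Y0, .second, .first => 1
  | .X1, .Y2, .first, .second => 1
  | .X2, .Y1, .second, .first => 1
  | .X0, .Y1, .first, .second => 1
  | _, _, _, _ => 0

variable (k) in
/-- `Blg.shrink` for states admitted by given types. -/
def minShrink {m r : ℕ} (w z : k) (l : Letter) {S T : MinType} {x y : IState (m + 2) (r + 1)}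
    (hx : S.Admits x) (hy : T.Admits y) : Blg k (m + 2) (r + 1) →ₗ[k] Blg k m r :=
  Blg.shrink k w z l x y hx.mpreferred hy.mpreferred

open Classical in
variable (k) in
/-- The bimodule `MarkedMin`, with output algebra `B(m, r)` and input algebra `B(m + 2, r + 1)`. -/
def markedMin [CharP k 2] (w z : k) {m : ℕ} (M : Matching m) (r : ℕ) :
    PreDA (cBlg k M r) (cBlg k M.extend (r + 1)) where
  Gen := MinGen (m + 2) (r + 1)
  l p := psi p.1.2 p.2.mpreferred.1
  r p := p.1.2
  δ
    | [] => fun p q => if p.1.2 = q.1.2 then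
        minCoef₀ w z p.1.1 q.1.1 • Blg.idem k (psi p.1.2 p.2.mpreferred.1) else 0
    | [a] => fun p q => ∑ l : Letter,
        minCoef₁ w z p.1.1 q.1.1 l • minShrink k w z l p.2 q.2 a
    | [a, b] => fun p q => ∑ l : Letter, ∑ l' : Letter,
        ∑ u : {u : IState (m + 2) (r + 1) // MinType.X1.Admits u},
          (minCoef₂ p.1.1 q.1.1 l l' : k) •
            (minShrink k w z l p.2 u.2 a * minShrink k w z l' u.2 q.2 b)
    | _ => 0

/-! ### The dual of `MarkedMin` -/

variable (k) in
/-- The algebra elements that specify `δ^1_1` on the dual module. -/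
def dualArrow (w z : k) {m : ℕ} (M : Matching (m + 2)) (r : ℕ) : MinType → MinType → DuAlg k M r
  | .X1, .X2 => DuAlg.of (Blg.L k 1)
  | .X2, .X1 => z • DuAlg.of (Blg.R k 1)
  | .X1, .X0 => DuAlg.of (Blg.R k 0)
  | .X0, .X1 => w • DuAlg.of (Blg.L k 0)
  | .X1, .Y1 => DuAlg.E k 0 * DuAlg.E k 1 + DuAlg.E k 1 * DuAlg.E k 0
  | .Y1, .X1 => (w * z) • 1
  | .X0, .Y2 => DuAlg.of (Blg.L k 0 * Blg.L k 1)
  | .Y2, .Y1 => DuAlg.of (Blg.R k 1)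
  | .Y1, .Y2 => z • DuAlg.of (Blg.L k 1)
  | .X2, .Y0 => DuAlg.of (Blg.R k 1 * Blg.R k 0)
  | .Y0, .Y1 => DuAlg.of (Blg.L k 0)
  | .Y1, .Y0 => w • DuAlg.of (Blg.R k 0)
  | .X1, .Y0 => DuAlg.E k 1 * DuAlg.of (Blg.R k 0)
  | .X1, .Y2 => DuAlg.E k 0 * DuAlg.of (Blg.L k 1)
  | .X2, .Y1 => DuAlg.of (Blg.R k 1) * DuAlg.E k 0
  | .X0, .Y1 => DuAlg.of (Blg.L k 0) * DuAlg.E k 1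
  | .Y2, .X2 => w • 1
  | .Y0, .X0 => z • 1
  | .X1, .X1 | .Y1, .Y1 => w • DuAlg.E k 0 + z • DuAlg.E k 1
  | .X0, .X0 | .Y0, .Y0 => w • DuAlg.E k 0
  | .X2, .X2 | .Y2, .Y2 => z • DuAlg.E k 1
  | _, _ => 0

variable (k) in
/-- The map `B' → I_x · B' · I_y` between the algebras `B'` that is given by `b ↦ b'` (as in
`Blg.expand`) and `E_i ↦ E_{i+2}`. -/
def DuAlg.expand {m r : ℕ} (M : Matching m) {T : MinType} {x y : IState (m + 2) (r + 1)}
    (hx : T.DualAdmits x) (hy : T.DualAdmits y) : DuAlg k M r →ₗ[k] DuAlg k M.extend (r + 1) :=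
  TensorProduct.map (Blg.expand k x y hx hy) (M.shiftE k).toLinearMap

open Classical in
variable (k) in
/-- The dual of `MarkedMin`. -/
def dualMarkedMin [CharP k 2] (w z : k) {m : ℕ} (M : Matching m) (r : ℕ) :
    PreDA (nDuAlg k M.extend (r + 1)) (nDuAlg k M r) where
  Gen := DualMinGen (m + 2) (r + 1)
  l p := p.1.2
  r p := psi p.1.2 p.2.preferred
  δ
    | [] => fun p q => DuAlg.of (Blg.idem k p.1.2) *
        dualArrow k w z M.extend (r + 1) p.1.1 q.1.1 * DuAlg.of (Blg.idem k q.1.2)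
    | [b] => fun p q => if h : p.1.1 = q.1.1 then DuAlg.expand k M p.2 (h ▸ q.2) b else 0
    | _ => 0

end

end LinkBordered

/-!
The two tensor products are not only homotopy equivalent, they agree after renaming the generators.
A generator of `MarkedMin ⊠ K` is a type `T` with a state `x` admitted by `T`. A generator of
`MarkedMin' ⊠ K` is a type `T` with a state admitted by `T` on the dual side, which is the complement
of a state `x` as before (`MinType.admits_iff_compl`), since `ψ` commutes with complements
(`psi_compl`). Relabelled type D structures are homotopy equivalent
(`PreTypeD.homotopyEquivalent_of_equiv`), so it suffices to show that one of the two is a type D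
structure and that the structure maps agree.

All computations are done with the elements `Blg.mon k x y W` of `B(m, r)`, the basis element of
weight `W / 2` from `x` to `y`, or zero if there is none. The first two heights of the states admitted
by a type are fixed by the type, so an arrow of the dual module from `T` to `S` is a basis element of
a weight `T.step S` that depends on the types only, times an element `dualCliff` of the Clifford
algebra (`dualArrow_eq`). The key to the structure equation is `sum_step_mul_mon`: composites of
arrows with basis elements are again the basis elements of the summed weights. Where no intermediate
state exists, the path on the other side runs through a state that contains neither of two
neighbouring places, and it is zero in the quotient. This reduces the equation without inputs to an
identity in the Clifford algebra of `E₁`, `E₂` for each pair of types (`dualCliff_relation`). The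
equations with inputs say that the expansion maps are multiplicative and commute with differentials
and with the arrows; a similar analysis of missing intermediate states proves them. Together this is
`dualMarkedMin_isTypeDA`.

For the canonical bimodule, the terms `L_i ⊗ R_i + R_i ⊗ L_i` and `U_i ⊗ E_i` of the structure map
are basis elements between complementary pairs of states, and its type D equation follows from the
symmetry of the products in `i` and `j`, in characteristic two (`canonMat_relation`). Since the dual
module has no operations with several inputs, its tensor product with the canonical bimodule is a
type D structure by a formal computation (`PreDA.IsTypeDA.box_isTypeD`), and its structure map is the
sum of the arrows of the dual module and of the terms of the canonical bimodule away from the first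
two places (`dualMarkedMin_box_δ`).

The same formula holds for `MarkedMin ⊠ K` (`markedMin_box_δ`). The inputs without weight in the first
two places give the terms of the canonical bimodule away from these places. The other operations of
`MarkedMin` meet the canonical bimodule only in inputs `L_i`, `R_i` or `U_i` with `i ≤ 2`, to which it
pairs `R_i`, `L_i` and `E_i`; these are the factors of the arrows of the dual module
(`sum_minCoef_smul`), the arrow `[E₁, E₂] = 1` from `X₁'` to `Y₁'` arising from the two operations of
`MarkedMin` from `X₁` to `Y₁`.
-/

open scoped TensorProduct

namespace LinkBordered

noncomputable section

/-! ### Basis elements of `B(m, r)` -/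

section Basis

variable {k : Type} [CommRing k] {m r : ℕ}

theorem IsWeight.symm {x y : IState m r} {W : Fin m →₀ ℕ} (h : IsWeight x y W) :
    IsWeight y x W := by
  intro i
  obtain ⟨t, ht⟩ := h i
  exact ⟨t, by omega⟩

theorem Vanishes.symm {x y : IState m r} {W : Fin m →₀ ℕ} (h : Vanishes x y W) :
    Vanishes y x W := by
  obtain ⟨z, i, h1, h2, h3, h4⟩ := h
  refine ⟨z, i, h1, h2, h3, fun j => ?_⟩
  have := h4 j
  omega

/-- A state is determined by the heights in `{1, ..., m}`. -/
theorem IState.ext_height_fin {x y : IState m r}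
    (h : ∀ i : Fin m, x.height (i.val + 1) = y.height (i.val + 1)) : x = y := by
  apply IState.ext_height
  intro t
  rcases Nat.eq_zero_or_pos t with rfl | ht
  · rw [x.height_zero, y.height_zero]
  · rcases Nat.lt_or_ge m t with h' | h'
    · rw [x.height_top h', y.height_top h']
    · have := h ⟨t - 1, by omega⟩
      simp only [Nat.sub_add_cancel ht] at this
      exact this

theorem isWeight_zero_iff {x y : IState m r} : IsWeight x y 0 ↔ x = y := by
  constructor
  · intro h
    apply IState.ext_height_fin
    intro i
    obtain ⟨t, ht⟩ := h i
    rw [Finsupp.zero_apply] at ht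
    omega
  · rintro rfl
    exact IsWeight.zero x

variable (k) in
open Classical in
/-- The basis element of `I_x · B(m, r) · I_y` of weight `W / 2`, extended by zero to all vectors
`W`. -/
def Blg.mon (x y : IState m r) (W : Fin m →₀ ℕ) : Blg k m r :=
  if h : IsWeight x y W then Blg.mk k m r (B0.mono k x y W h 1) else 0

theorem Blg.mon_of_isWeight {x y : IState m r} {W : Fin m →₀ ℕ} (h : IsWeight x y W) :
    Blg.mon k x y W = Blg.mk k m r (B0.mono k x y W h 1) := dif_pos h

theorem Blg.mon_of_not_isWeight {x y : IState m r} {W : Fin m →₀ ℕ} (h : ¬ IsWeight x y W) :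
    Blg.mon k x y W = 0 := dif_neg h

/-- A basis element is zero in the quotient if its weight leaves room for a path through a state
that contains neither of two neighbouring places, and if its weight between these places is
positive. -/
theorem Blg.mon_of_vanishes {x y : IState m r} {W : Fin m →₀ ℕ} (h : Vanishes x y W) :
    Blg.mon k x y W = 0 := by
  by_cases hW : IsWeight x y W
  · rw [Blg.mon_of_isWeight hW]
    exact (Blg.mk_eq_zero k).2 (mono_mem_relIdeal hW h 1)
  · exact Blg.mon_of_not_isWeight hW

theorem Blg.mon_mul_mon {x y z : IState m r} {W V : Fin m →₀ ℕ} (h : IsWeight x y W)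
    (h' : IsWeight y z V) : Blg.mon k x y W * Blg.mon k y z V = Blg.mon k x z (W + V) := by
  rw [Blg.mon_of_isWeight h, Blg.mon_of_isWeight h', Blg.mon_of_isWeight (h.add h'), ← map_mul,
    B0.mono_mul_mono, mul_one]

theorem Blg.mon_mul_mon_of_ne {x y y' z : IState m r} {W V : Fin m →₀ ℕ} (hy : y ≠ y') :
    Blg.mon k x y W * Blg.mon k y' z V = 0 := by
  classical
  by_cases h : IsWeight x y W
  · by_cases h' : IsWeight y' z V
    · rw [Blg.mon_of_isWeight h, Blg.mon_of_isWeight h', ← map_mul]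
      have : B0.mono k x y W h 1 * B0.mono k y' z V h' 1 = 0 := by
        apply Subtype.ext
        change Matrix.single x y _ * Matrix.single y' z _ = 0
        rw [Matrix.single_mul_single_of_ne]
        exact hy
      rw [this, map_zero]
    · rw [Blg.mon_of_not_isWeight h', mul_zero]
  · rw [Blg.mon_of_not_isWeight h, zero_mul]

theorem Blg.idem_eq_mon (x : IState m r) : Blg.idem k x = Blg.mon k x x 0 := by
  rw [Blg.mon_of_isWeight (IsWeight.zero x)]
  rfl

theorem Blg.mon_zero_of_ne {x y : IState m r} (h : x ≠ y) : Blg.mon k x y 0 = 0 :=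
  Blg.mon_of_not_isWeight fun h' => h (isWeight_zero_iff.1 h')

theorem Blg.idem_mul_mon (x y : IState m r) (W : Fin m →₀ ℕ) :
    Blg.idem k x * Blg.mon k x y W = Blg.mon k x y W := by
  by_cases h : IsWeight x y W
  · rw [Blg.idem_eq_mon, Blg.mon_mul_mon (IsWeight.zero x) h, zero_add]
  · rw [Blg.mon_of_not_isWeight h, mul_zero]

theorem Blg.mon_mul_idem (x y : IState m r) (W : Fin m →₀ ℕ) :
    Blg.mon k x y W * Blg.idem k y = Blg.mon k x y W := by
  by_cases h : IsWeight x y W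
  · rw [Blg.idem_eq_mon, Blg.mon_mul_mon h (IsWeight.zero y), add_zero]
  · rw [Blg.mon_of_not_isWeight h, zero_mul]

theorem Blg.idem_mul_mon_of_ne {u x : IState m r} (h : u ≠ x) (y : IState m r) (W : Fin m →₀ ℕ) :
    Blg.idem k u * Blg.mon k x y W = 0 := by
  rw [Blg.idem_eq_mon, Blg.mon_mul_mon_of_ne h]

theorem Blg.mon_mul_idem_of_ne {u y : IState m r} (h : y ≠ u) (x : IState m r) (W : Fin m →₀ ℕ) :
    Blg.mon k x y W * Blg.idem k u = 0 := by
  rw [Blg.idem_eq_mon, Blg.mon_mul_mon_of_ne h]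

theorem Blg.U_mul_mon {i : Fin m} {x y : IState m r} {W : Fin m →₀ ℕ}
    (hW : IsWeight x y (W + Finsupp.single i 2) → IsWeight x y W) :
    Blg.U k i * Blg.mon k x y W = Blg.mon k x y (W + Finsupp.single i 2) := by
  by_cases h : IsWeight x y W
  · rw [← Blg.mon_mul_idem, ← mul_assoc, Blg.U_comm, mul_assoc, Blg.mon_of_isWeight h,
      Blg.mon_of_isWeight (h.add (isWeight_two y i)), ← B0.mono_mul_U_idem, map_mul, map_mul]
    rfl
  · rw [Blg.mon_of_not_isWeight h, mul_zero, Blg.mon_of_not_isWeight fun h' => h (hW h')]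

open Classical in
theorem Blg.idem_mul_L_mul_idem (i : Fin m) (x y : IState m r) :
    Blg.idem k x * Blg.L k i * Blg.idem k y =
      if MovesLeft i x y then Blg.mon k x y (Finsupp.single i 1) else 0 := by
  have key : B0.idem k x * B0.L k i * B0.idem k y =
      if h : MovesLeft i x y then B0.mono k x y _ h.isWeight.1 1 else 0 := by
    apply Subtype.ext
    change (B0.idem k x).1 * (B0.L k i).1 * (B0.idem k y).1 = _
    rw [B0.idem_val, B0.idem_val, Matrix.single_mul_mul_single, one_mul, mul_one]
    simp only [B0.L, Matrix.of_apply]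
    split_ifs
    · rfl
    · exact Matrix.single_zero _ _
  change Blg.mk k m r _ * Blg.mk k m r _ * Blg.mk k m r _ = _
  rw [← map_mul, ← map_mul, key]
  split_ifs with h
  · rw [Blg.mon_of_isWeight h.isWeight.1]
  · rw [map_zero]

open Classical in
theorem Blg.idem_mul_R_mul_idem (i : Fin m) (x y : IState m r) :
    Blg.idem k x * Blg.R k i * Blg.idem k y =
      if MovesLeft i y x then Blg.mon k x y (Finsupp.single i 1) else 0 := by
  have key : B0.idem k x * B0.R k i * B0.idem k y =
      if h : MovesLeft i y x then B0.mono k x y _ h.isWeight.2 1 else 0 := by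
    apply Subtype.ext
    change (B0.idem k x).1 * (B0.R k i).1 * (B0.idem k y).1 = _
    rw [B0.idem_val, B0.idem_val, Matrix.single_mul_mul_single, one_mul, mul_one]
    simp only [B0.R, Matrix.of_apply]
    split_ifs
    · rfl
    · exact Matrix.single_zero _ _
  change Blg.mk k m r _ * Blg.mk k m r _ * Blg.mk k m r _ = _
  rw [← map_mul, ← map_mul, key]
  split_ifs with h
  · rw [Blg.mon_of_isWeight h.isWeight.2]
  · rw [map_zero]

open Classical in
theorem Blg.idem_mul_idem (x y : IState m r) :
    Blg.idem k x * Blg.idem k y = if x = y then Blg.idem k x else 0 := by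
  rw [Blg.idem_eq_mon, Blg.idem_eq_mon]
  split_ifs with h
  · subst h
    rw [Blg.mon_mul_mon (IsWeight.zero x) (IsWeight.zero x), zero_add]
  · exact Blg.mon_mul_mon_of_ne h

open Classical in
theorem Blg.idem_mul_U_mul_idem (i : Fin m) (x y : IState m r) :
    Blg.idem k x * Blg.U k i * Blg.idem k y =
      if x = y then Blg.mon k x y (Finsupp.single i 2) else 0 := by
  rw [← Blg.U_comm, mul_assoc, Blg.idem_mul_idem]
  split_ifs with h
  · subst h
    rw [Blg.idem_eq_mon, Blg.U_mul_mon fun _ => IsWeight.zero x, zero_add]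
  · rw [mul_zero]

/-- A step of weight `1/2` moves one element to a neighbouring place. -/
theorem isWeight_single_one_iff {i : Fin m} {x y : IState m r} :
    IsWeight x y (Finsupp.single i 1) ↔ MovesLeft i x y ∨ MovesLeft i y x := by
  constructor
  · intro h
    have hne : ∀ t, t ≠ i.val + 1 → y.height t = x.height t := by
      intro t ht
      rcases Nat.eq_zero_or_pos t with rfl | h0
      · rw [x.height_zero, y.height_zero]
      · rcases Nat.lt_or_ge m t with h' | h'
        · rw [x.height_top h', y.height_top h']
        · obtain ⟨s, hs⟩ := h ⟨t - 1, by omega⟩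
          rw [Finsupp.single_eq_of_ne (by rintro rfl; simp only at ht; omega)] at hs
          simp only [Nat.sub_add_cancel h0] at hs
          omega
    obtain ⟨s, hs⟩ := h i
    rw [Finsupp.single_eq_same] at hs
    rcases lt_trichotomy (x.height (i.val + 1)) (y.height (i.val + 1)) with h' | h' | h'
    · exact Or.inr (movesLeft_of_height (fun t ht => (hne t ht).symm) (by omega))
    · omega
    · exact Or.inl (movesLeft_of_height hne (by omega))
  · rintro (h | h)
    · exact h.isWeight.1
    · exact h.isWeight.2

theorem MovesLeft.asymm {i : Fin m} {x y : IState m r} (h : MovesLeft i x y)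
    (h' : MovesLeft i y x) : False := by
  have := h.height_eq'
  have := h'.height_eq'
  omega

/-- Every element of `B(m, r)` is a sum of matrix units times monomials. -/
theorem Blg.span_mon : Submodule.span k
    (Set.range fun p : IState m r × IState m r × (Fin m →₀ ℕ) =>
      Blg.mon k p.1 p.2.1 p.2.2) = ⊤ := by
  classical
  rw [eq_top_iff]
  rintro a -
  obtain ⟨a, rfl⟩ := Blg.mk_surjective k m r a
  have ha : a = ∑ x, ∑ y, ∑ W ∈ (a.1 x y).support.attach,
      (a.1 x y).coeff W.1 • B0.mono k x y W.1 (a.2 x y W.1 W.2) 1 := by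
    apply Subtype.ext
    simp only [AddSubmonoidClass.coe_finsetSum, SetLike.val_smul]
    refine (Matrix.matrix_eq_sum_single a.1).trans ?_
    refine Finset.sum_congr rfl fun x _ => Finset.sum_congr rfl fun y _ => ?_
    have hval : ∀ (W : Fin m →₀ ℕ) (h : IsWeight x y W), (B0.mono k x y W h 1).1 =
        Matrix.single x y (MvPolynomial.monomial W 1) := by
      intro W h
      unfold B0.mono B0.elt
      congr!
    simp only [hval, Matrix.smul_single, MvPolynomial.smul_monomial, smul_eq_mul, mul_one]
    rw [Finset.sum_attach (a.1 x y).support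
      (fun W => Matrix.single x y (MvPolynomial.monomial W ((a.1 x y).coeff W)))]
    conv_lhs => rw [(a.1 x y).as_sum]
    exact map_sum (Matrix.singleAddMonoidHom x y) _ _
  rw [ha]
  simp only [map_sum, map_smul]
  refine sum_mem fun x _ => sum_mem fun y _ => sum_mem fun W _ => ?_
  refine Submodule.smul_mem _ _ (Submodule.subset_span ⟨(x, y, W.1), ?_⟩)
  exact Blg.mon_of_isWeight _

/-- Linear maps that agree on the basis elements are equal. -/
theorem Blg.linearMap_ext {V : Type*} [AddCommGroup V] [Module k V] {f g : Blg k m r →ₗ[k] V}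
    (h : ∀ x y W, IsWeight x y W → f (Blg.mon k x y W) = g (Blg.mon k x y W)) : f = g := by
  refine LinearMap.ext_on Blg.span_mon ?_
  rintro _ ⟨⟨x, y, W⟩, rfl⟩
  by_cases hW : IsWeight x y W
  · exact h x y W hW
  · simp only [Blg.mon_of_not_isWeight hW, map_zero]

end Basis

/-! ### The linear maps between the algebras on basis elements -/

section Maps

variable {k : Type} [CommRing k] {m r : ℕ}

theorem isWeight_shift_iff {T : MinType} {x y : IState (m + 2) (r + 1)}
    (hx : T.DualAdmits x) (hy : T.DualAdmits y) {W : Fin m →₀ ℕ} :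
    IsWeight x y (shiftWeight W) ↔ IsWeight (psi x hx.preferred) (psi y hy.preferred) W := by
  refine ⟨fun h i => ?_, fun h => h.shift hx hy⟩
  obtain ⟨t, ht⟩ := h i.succ.succ
  refine ⟨t, ?_⟩
  rw [shiftWeight_succ] at ht
  rw [psi_height _ _ _ (by omega), psi_height _ _ _ (by omega), ht]
  simp only [Fin.val_succ]

theorem rename_monomial_succ_succ (W : Fin m →₀ ℕ) (c : k) :
    MvPolynomial.rename (fun i : Fin m => i.succ.succ) (MvPolynomial.monomial W c) =
      MvPolynomial.monomial (shiftWeight W) c :=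
  MvPolynomial.rename_monomial _ _ _

theorem B0.mono_val [DecidableEq (IState m r)] {x y : IState m r} {W : Fin m →₀ ℕ}
    (h : IsWeight x y W) (c : k) :
    (B0.mono k x y W h c).1 = Matrix.single x y (MvPolynomial.monomial W c) := by
  unfold B0.mono B0.elt
  congr!

open Classical in
theorem Blg.expand_mon {T : MinType} {x y : IState (m + 2) (r + 1)} (hx : T.DualAdmits x)
    (hy : T.DualAdmits y) (p q : IState m r) (W : Fin m →₀ ℕ) :
    Blg.expand k x y hx hy (Blg.mon k p q W) =
      if psi x hx.preferred = p ∧ psi y hy.preferred = q then Blg.mon k x y (shiftWeight W)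
      else 0 := by
  by_cases h : IsWeight p q W
  · rw [Blg.mon_of_isWeight h]
    change Blg.mk k _ _ (B0.expand k x y hx hy (B0.mono k p q W h 1)) = _
    split_ifs with hpq
    · obtain ⟨rfl, rfl⟩ := hpq
      rw [Blg.mon_of_isWeight (h.shift hx hy)]
      congr 1
      apply Subtype.ext
      rw [B0.mono_val]
      change Matrix.single x y (MvPolynomial.rename _ ((B0.mono k _ _ W h 1).1 _ _)) = _
      rw [B0.mono_val, Matrix.single_apply_same, rename_monomial_succ_succ]
    · rw [show B0.expand k x y hx hy (B0.mono k p q W h 1) = 0 from ?_, map_zero]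
      apply Subtype.ext
      change Matrix.single x y (MvPolynomial.rename _ ((B0.mono k _ _ W h 1).1 _ _)) = 0
      rw [B0.mono_val, Matrix.single_apply_of_ne, map_zero, Matrix.single_zero]
      exact fun h' => hpq ⟨h'.1.symm, h'.2.symm⟩
  · rw [Blg.mon_of_not_isWeight h, map_zero]
    split_ifs with hpq
    · obtain ⟨rfl, rfl⟩ := hpq
      rw [Blg.mon_of_not_isWeight (mt (isWeight_shift_iff hx hy).1 h)]
    · rfl

open Classical in
theorem Blg.shrink_mon {w z : k} (l : Letter) {x y : IState (m + 2) (r + 1)} (hx : x.MPreferred)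
    (hy : y.MPreferred) (p q : IState (m + 2) (r + 1)) (W : Fin (m + 2) →₀ ℕ) :
    Blg.shrink k w z l x y hx hy (Blg.mon k p q W) =
      if x = p ∧ y = q ∧ IsWeight x y W then
        l.coef w z x y (W 0) (W 1) • Blg.mon k (psi x hx.1) (psi y hy.1) (tailWeight W)
      else 0 := by
  by_cases h : IsWeight p q W
  · rw [Blg.mon_of_isWeight h]
    change Blg.mk k _ _ (B0.shrink k w z l x y hx hy (B0.mono k p q W h 1)) = _
    split_ifs with hpq
    · obtain ⟨rfl, rfl, -⟩ := hpq
      rw [Blg.mon_of_isWeight (h.tail hx.1 hy.1), ← map_smul]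
      congr 1
      apply Subtype.ext
      rw [SetLike.val_smul, B0.mono_val]
      change Matrix.single _ _ (shrinkPoly k _ ((B0.mono k _ _ W h 1).1 _ _)) = _
      rw [B0.mono_val, Matrix.single_apply_same, shrinkPoly_monomial, Matrix.smul_single,
        MvPolynomial.smul_monomial, smul_eq_mul, one_mul, mul_one]
    · rw [show B0.shrink k w z l x y hx hy (B0.mono k p q W h 1) = 0 from ?_, map_zero]
      apply Subtype.ext
      change Matrix.single _ _ (shrinkPoly k _ ((B0.mono k _ _ W h 1).1 _ _)) = 0
      rw [B0.mono_val, Matrix.single_apply_of_ne, map_zero, Matrix.single_zero]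
      rintro ⟨rfl, rfl⟩
      exact hpq ⟨rfl, rfl, h⟩
  · rw [Blg.mon_of_not_isWeight h, map_zero, if_neg]
    rintro ⟨rfl, rfl, h'⟩
    exact h h'

end Maps

/-! ### The local part of the states -/

section Local

variable {m r : ℕ}

/-- The first height of the states in `MinType.DualAdmits T`, relative to the least possible one. -/
def MinType.h₁ : MinType → ℕ
  | .X0 | .Y0 => 1
  | _ => 0

/-- The second height of the states in `MinType.DualAdmits T`, relative to the least possible
one. -/
def MinType.h₂ : MinType → ℕ
  | .X2 | .Y2 => 0
  | _ => 1

theorem MinType.h₁_le (T : MinType) : T.h₁ ≤ T.h₂ ∧ T.h₂ ≤ 1 := by cases T <;> decide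

/-- Being admitted by a type is a condition on the first three heights; the third one only enters
for `X2` and `Y2`, whose states must not contain `2`. -/
theorem dualAdmits_iff {T : MinType} {x : IState m (r + 1)} :
    T.DualAdmits x ↔ x.height 1 = r + T.h₁ ∧ x.height 2 + 1 = r + T.h₂ ∧
      (T.h₂ = 0 → x.height 3 = x.height 2) := by
  have h0 := x.height_step 0
  have h1 := x.height_step 1
  have h2 := x.height_step 2
  have xz := x.height_zero
  simp only [Nat.zero_add, Nat.reduceAdd] at h0 h1 h2
  cases T <;> simp only [MinType.DualAdmits, MinType.h₁, MinType.h₂, IState.has_iff,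
    Nat.zero_add, Nat.reduceAdd, true_imp_iff, Nat.add_zero] <;> omega

theorem psi_eq_iff {x y : IState (m + 2) (r + 1)} (hx : x.Preferred) (hy : y.Preferred) :
    psi x hx = psi y hy ↔ ∀ t, x.height (t + 3) = y.height (t + 3) := by
  constructor
  · intro h t
    have h1 := psi_height x hx (t + 1) (by omega)
    have h2 := psi_height y hy (t + 1) (by omega)
    rw [h, h2] at h1
    exact h1.symm
  · intro h
    apply IState.ext_height_fin
    intro i
    rw [psi_height _ _ _ (by omega), psi_height _ _ _ (by omega)]
    exact h i.val

theorem MinType.DualAdmits.eq_of_psi_eq {T : MinType} {x y : IState (m + 2) (r + 1)}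
    (hx : T.DualAdmits x) (hy : T.DualAdmits y)
    (h : psi x hx.preferred = psi y hy.preferred) : x = y := by
  rw [psi_eq_iff] at h
  rw [dualAdmits_iff] at hx hy
  apply IState.ext_height
  intro t
  match t with
  | 0 => rw [x.height_zero, y.height_zero]
  | 1 => omega
  | 2 => omega
  | t + 3 => exact h t

/-- Every state is of the form `ψ(u)` for a state `u` admitted by `T`, except that `0` has to be
in the state if `T` is `X2` or `Y2`. -/
theorem MinType.exists_lift (T : MinType) (p : IState m r) (h : T.h₂ = 0 → p.height 1 + 1 = r) :
    ∃ (u : IState (m + 2) (r + 1)) (hu : T.DualAdmits u), psi u hu.preferred = p := by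
  have hT := T.h₁_le
  have p0 := p.height_zero
  have ps := p.height_step 0
  rw [p0] at ps
  simp only [Nat.zero_add] at ps
  obtain ⟨u, hu⟩ := IState.exists_of_path (m := m + 2) (r := r + 1)
    (fun t => if t = 0 then r + 1 else if t = 1 then r + T.h₁ else
      if t = 2 then r + T.h₂ - 1 else p.height (t - 2)) (by simp)
    (by
      rw [if_neg (by omega), if_neg (by omega)]
      split_ifs with h
      · omega
      · rw [show m + 2 + 1 - 2 = m + 1 by omega, p.height_top le_rfl])
    (by
      intro t _
      match t with
      | 0 => simp only [Nat.zero_add, if_true, one_ne_zero, if_false]; omega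
      | 1 => simp; omega
      | 2 => simp; omega
      | t + 3 =>
        have := p.height_step (t + 1)
        rw [if_neg (by omega), if_neg (by omega), if_neg (by omega), if_neg (by omega),
          if_neg (by omega), if_neg (by omega)]
        exact this)
  have u1 : u.height 1 = r + T.h₁ := by rw [hu 1 (by omega)]; simp
  have u2 : u.height 2 = r + T.h₂ - 1 := by rw [hu 2 (by omega)]; simp
  have u3 : ∀ t, u.height (t + 3) = p.height (t + 1) := by
    intro t
    rcases Nat.lt_or_ge m t with h' | h'
    · rw [u.height_top (by omega), p.height_top (by omega)]
    · rw [hu _ (by omega), if_neg (by omega), if_neg (by omega), if_neg (by omega)]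
      rfl
  have hadm : T.DualAdmits u := by
    rw [dualAdmits_iff, u1, u2, show (3 : ℕ) = 0 + 3 from rfl, u3]
    simp only [Nat.zero_add]
    refine ⟨trivial, by omega, fun h' => ?_⟩
    have := h h'
    omega
  refine ⟨u, hadm, ?_⟩
  apply IState.ext_height_fin
  intro i
  rw [psi_height _ _ _ (by omega)]
  exact u3 i.val

/-- The weight vector with first entries `p` and `q`, and with all other entries zero. -/
def lowWeight (p q : ℕ) : Fin (m + 2) →₀ ℕ := Finsupp.single 0 p + Finsupp.single 1 q

theorem lowWeight_zero (p q : ℕ) : (lowWeight p q : Fin (m + 2) →₀ ℕ) 0 = p := by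
  simp [lowWeight]

theorem lowWeight_one (p q : ℕ) : (lowWeight p q : Fin (m + 2) →₀ ℕ) 1 = q := by
  simp [lowWeight]

theorem lowWeight_succ (p q : ℕ) (j : Fin m) :
    (lowWeight p q : Fin (m + 2) →₀ ℕ) j.succ.succ = 0 := by
  have h1 : j.succ.succ ≠ 1 := fun h => Fin.succ_ne_zero _ (Fin.succ_injective _ h)
  simp [lowWeight, h1]

theorem lowWeight_add (p q p' q' : ℕ) :
    (lowWeight p q + lowWeight p' q' : Fin (m + 2) →₀ ℕ) = lowWeight (p + p') (q + q') := by
  simp only [lowWeight, Finsupp.single_add]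
  abel

/-- The distances between the first two heights of two states admitted by `T` and `S`. -/
def MinType.step (T S : MinType) : Fin (m + 2) →₀ ℕ :=
  lowWeight ((T.h₁ : ℤ) - S.h₁).natAbs ((T.h₂ : ℤ) - S.h₂).natAbs

theorem MinType.step_comm (T S : MinType) :
    (T.step S : Fin (m + 2) →₀ ℕ) = S.step T := by
  unfold MinType.step
  congr 1 <;> omega

theorem isWeight_iff_low {x y : IState (m + 2) r} {W : Fin (m + 2) →₀ ℕ} :
    IsWeight x y W ↔ (∃ t, W 0 = ((x.height 1 : ℤ) - y.height 1).natAbs + 2 * t) ∧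
      (∃ t, W 1 = ((x.height 2 : ℤ) - y.height 2).natAbs + 2 * t) ∧
      ∀ j : Fin m, ∃ t, W j.succ.succ =
        ((x.height (j.val + 3) : ℤ) - y.height (j.val + 3)).natAbs + 2 * t := by
  constructor
  · intro h
    exact ⟨h 0, h 1, fun j => h j.succ.succ⟩
  · rintro ⟨h0, h1, h2⟩ i
    rcases fin_cases₂ i with rfl | rfl | ⟨j, rfl⟩
    · exact h0
    · exact h1
    · exact h2 j

theorem height_eq_of_fin {x y : IState (m + 2) r}
    (h : ∀ j : Fin m, x.height (j.val + 3) = y.height (j.val + 3)) (t : ℕ) :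
    x.height (t + 3) = y.height (t + 3) := by
  rcases Nat.lt_or_ge t m with h' | h'
  · exact h ⟨t, h'⟩
  · rw [x.height_top (by omega), y.height_top (by omega)]

theorem isWeight_step_iff {T S : MinType} {x u : IState (m + 2) (r + 1)} (hx : T.DualAdmits x)
    (hu : S.DualAdmits u) :
    IsWeight x u (T.step S) ↔ psi x hx.preferred = psi u hu.preferred := by
  rw [isWeight_iff_low, psi_eq_iff]
  have hx' := dualAdmits_iff.1 hx
  have hu' := dualAdmits_iff.1 hu
  constructor
  · rintro ⟨-, -, h⟩
    refine height_eq_of_fin fun j => ?_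
    obtain ⟨t, ht⟩ := h j
    rw [MinType.step, lowWeight_succ] at ht
    omega
  · intro h
    refine ⟨⟨0, ?_⟩, ⟨0, ?_⟩, fun j => ⟨0, ?_⟩⟩
    · rw [MinType.step, lowWeight_zero]; omega
    · rw [MinType.step, lowWeight_one]; omega
    · rw [MinType.step, lowWeight_succ, h]; omega

theorem exists_eq_natAbs_add_of_step {c a s b x u y V t : ℕ} (ha : a ≤ 1) (hs : s ≤ 1)
    (hb : b ≤ 1) (hx : x + c = r + a) (hu : u + c = r + s) (hy : y + c = r + b)
    (h : ((a : ℤ) - s).natAbs + V = ((x : ℤ) - y).natAbs + 2 * t) :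
    ∃ t, V = ((u : ℤ) - y).natAbs + 2 * t := by
  have e1 : (x : ℤ) - y = (a : ℤ) - b := by omega
  have e2 : (u : ℤ) - y = (s : ℤ) - b := by omega
  rw [e1] at h
  rw [e2]
  refine ⟨(V - ((s : ℤ) - b).natAbs) / 2, ?_⟩
  clear e1 e2 hx hu hy
  interval_cases a <;> interval_cases s <;> interval_cases b <;> simp at h ⊢ <;> omega

theorem natAbs_add_natAbs_le_of_step {a b x u y V t : ℕ} (ha : a ≤ 1)
    (hb : b ≤ 1) (hx : x = r + a) (hu : u = r) (hy : y = r + b)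
    (h : ((a : ℤ) - (0 : ℕ)).natAbs + V = ((x : ℤ) - y).natAbs + 2 * t) :
    ((x : ℤ) - u).natAbs + ((u : ℤ) - y).natAbs ≤ ((a : ℤ) - (0 : ℕ)).natAbs + V := by
  have e1 : (x : ℤ) - y = (a : ℤ) - b := by omega
  have e2 : (x : ℤ) - u = a := by omega
  have e3 : (u : ℤ) - y = -b := by omega
  rw [e1] at h
  rw [e2, e3]
  clear e1 e2 e3 hx hu hy
  interval_cases a <;> interval_cases b <;> simp at h ⊢ <;> omega

/-- A weight vector that passes from `T` via `S` to `T'` is realized by a path through a state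
admitted by `S`, unless the algebra element is zero. -/
theorem exists_mid {T S T' : MinType} {x y : IState (m + 2) (r + 1)} (hx : T.DualAdmits x)
    (hy : T'.DualAdmits y) {V : Fin (m + 2) →₀ ℕ} (h : IsWeight x y (T.step S + V)) :
    (∃ (u : IState (m + 2) (r + 1)) (_ : S.DualAdmits u),
      IsWeight x u (T.step S) ∧ IsWeight u y V) ∨ Vanishes x y (T.step S + V) := by
  have hT := T.h₁_le
  have hS := S.h₁_le
  have hT' := T'.h₁_le
  have hx' := dualAdmits_iff.1 hx
  have hy' := dualAdmits_iff.1 hy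
  obtain ⟨⟨t0, e0⟩, ⟨t1, e1⟩, e2⟩ := isWeight_iff_low.1 h
  rw [Finsupp.add_apply, MinType.step, lowWeight_zero] at e0
  rw [Finsupp.add_apply, MinType.step, lowWeight_one] at e1
  by_cases hl : S.h₂ = 0 → (psi x hx.preferred).height 1 + 1 = r
  · left
    obtain ⟨u, hu, hpsi⟩ := S.exists_lift _ hl
    refine ⟨u, hu, (isWeight_step_iff hx hu).2 hpsi.symm, ?_⟩
    rw [psi_eq_iff] at hpsi
    have hu' := dualAdmits_iff.1 hu
    refine isWeight_iff_low.2 ⟨exists_eq_natAbs_add_of_step (c := 0) (hT.1.trans hT.2)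
      (hS.1.trans hS.2) (hT'.1.trans hT'.2) hx'.1 hu'.1 hy'.1 e0,
      exists_eq_natAbs_add_of_step hT.2 hS.2 hT'.2 hx'.2.1 hu'.2.1 hy'.2.1 e1, fun j => ?_⟩
    obtain ⟨t, ht⟩ := e2 j
    rw [Finsupp.add_apply, MinType.step, lowWeight_succ] at ht
    exact ⟨t, by rw [hpsi]; omega⟩
  · right
    -- `x` lifts a state without `0`, so the state of type `X1` over it contains neither `1` nor `2`
    obtain ⟨u, hu, hpsi⟩ := MinType.X1.exists_lift (psi x hx.preferred)
      (fun h => by simp [MinType.h₂] at h)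
    rw [psi_eq_iff] at hpsi
    obtain ⟨u1, u2, -⟩ := dualAdmits_iff.1 hu
    simp only [MinType.h₁, MinType.h₂, Nat.add_zero, Nat.add_right_cancel_iff] at u1 u2
    rw [psi_height _ _ _ le_rfl, Classical.not_imp] at hl
    simp only [Nat.reduceAdd] at hl
    have x2 := x.height_step 2
    have u3 := hpsi 0
    simp only [Nat.zero_add, Nat.reduceAdd] at u3 x2
    have s2 : S.h₂ = 0 := hl.1
    have s1 : S.h₁ = 0 := by omega
    have t2 : T.h₂ = 1 := by omega
    have x3 : x.height 2 = r ∧ x.height 3 = r := by omega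
    rw [s1] at e0
    refine ⟨u, 1, ?_, ?_, ?_, fun j => ?_⟩
    · change u.height 1 = u.height 2
      omega
    · change u.height 2 = u.height 3
      omega
    · rw [Finsupp.add_apply, MinType.step, lowWeight_one, s2, t2]
      exact Nat.le_add_right _ _
    · rcases fin_cases₂ j with rfl | rfl | ⟨j, rfl⟩
      · rw [Finsupp.add_apply, MinType.step, lowWeight_zero, s1]
        exact natAbs_add_natAbs_le_of_step (hT.1.trans hT.2) (hT'.1.trans hT'.2) hx'.1 u1 hy'.1 e0
      · rw [Finsupp.add_apply, MinType.step, lowWeight_one, s2, t2]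
        change ((x.height 2 : ℤ) - u.height 2).natAbs + ((u.height 2 : ℤ) - y.height 2).natAbs ≤ _
        have : ((u.height 2 : ℤ) - y.height 2).natAbs ≤ 1 := by omega
        rw [x3.1, u2, sub_self]
        rw [u2] at this
        simp only [Int.natAbs_zero, Nat.cast_one, Nat.cast_zero, sub_zero, Int.natAbs_one]
        omega
      · obtain ⟨t, ht⟩ := e2 j
        change ((x.height (j.val + 3) : ℤ) - u.height (j.val + 3)).natAbs +
          ((u.height (j.val + 3) : ℤ) - y.height (j.val + 3)).natAbs ≤ _
        rw [hpsi, ht, sub_self, Int.natAbs_zero]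
        omega

end Local

section LocalProducts

variable {k : Type} [CommRing k] {m r : ℕ}

open Classical in
/-- A product of an arrow of the dual module from `T` to `S` with a basis element, summed over the
intermediate states, is the basis element of the summed weight: if there is no intermediate state
admitted by `S`, then the latter is zero in the quotient. -/
theorem sum_step_mul_mon {T S T' : MinType} {x y : IState (m + 2) (r + 1)} (hx : T.DualAdmits x)
    (hy : T'.DualAdmits y) (V : Fin (m + 2) →₀ ℕ) :
    ∑ u : {u : IState (m + 2) (r + 1) // S.DualAdmits u},
      Blg.mon k x u.1 (T.step S) * Blg.mon k u.1 y V = Blg.mon k x y (T.step S + V) := by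
  by_cases h : ∃ (u : IState (m + 2) (r + 1)) (_ : S.DualAdmits u),
      IsWeight x u (T.step S) ∧ IsWeight u y V
  · obtain ⟨u, hu, h1, h2⟩ := h
    rw [Finset.sum_eq_single_of_mem (⟨u, hu⟩ : {u // S.DualAdmits u}) (Finset.mem_univ _),
      Blg.mon_mul_mon h1 h2]
    rintro ⟨v, hv⟩ - hvu
    rw [Blg.mon_of_not_isWeight, zero_mul]
    intro h'
    apply hvu
    rw [isWeight_step_iff hx hv] at h'
    rw [isWeight_step_iff hx hu] at h1
    exact Subtype.ext (hv.eq_of_psi_eq hu (h'.symm.trans h1))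
  · rw [Finset.sum_eq_zero]
    · by_cases hW : IsWeight x y (T.step S + V)
      · rcases exists_mid hx hy hW with h' | h'
        · exact (h h').elim
        · exact (Blg.mon_of_vanishes h').symm
      · exact (Blg.mon_of_not_isWeight hW).symm
    · rintro ⟨u, hu⟩ -
      by_cases h1 : IsWeight x u (T.step S)
      · rw [Blg.mon_of_not_isWeight (x := u) (y := y) fun h2 => h ⟨u, hu, h1, h2⟩, mul_zero]
      · rw [Blg.mon_of_not_isWeight h1, zero_mul]

open Classical in
/-- The mirror image of `sum_step_mul_mon`. -/
theorem sum_mon_mul_step {T S T' : MinType} {x y : IState (m + 2) (r + 1)} (hx : T.DualAdmits x)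
    (hy : T'.DualAdmits y) (V : Fin (m + 2) →₀ ℕ) :
    ∑ u : {u : IState (m + 2) (r + 1) // S.DualAdmits u},
      Blg.mon k x u.1 V * Blg.mon k u.1 y (S.step T') = Blg.mon k x y (V + S.step T') := by
  rw [MinType.step_comm]
  by_cases h : ∃ (u : IState (m + 2) (r + 1)) (_ : S.DualAdmits u),
      IsWeight y u (T'.step S) ∧ IsWeight u x V
  · obtain ⟨u, hu, h1, h2⟩ := h
    rw [Finset.sum_eq_single_of_mem (⟨u, hu⟩ : {u // S.DualAdmits u}) (Finset.mem_univ _),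
      Blg.mon_mul_mon h2.symm h1.symm]
    rintro ⟨v, hv⟩ - hvu
    rw [Blg.mon_of_not_isWeight (x := v), mul_zero]
    intro h'
    apply hvu
    replace h' := (isWeight_step_iff hy hv).1 h'.symm
    rw [isWeight_step_iff hy hu] at h1
    exact Subtype.ext (hv.eq_of_psi_eq hu (h'.symm.trans h1))
  · rw [Finset.sum_eq_zero]
    · by_cases hW : IsWeight x y (V + T'.step S)
      · rw [add_comm V] at hW ⊢
        rcases exists_mid hy hx hW.symm with h' | h'
        · exact (h h').elim
        · exact (Blg.mon_of_vanishes h'.symm).symm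
      · exact (Blg.mon_of_not_isWeight hW).symm
    · rintro ⟨u, hu⟩ -
      by_cases h1 : IsWeight y u (T'.step S)
      · rw [Blg.mon_of_not_isWeight (x := x) (y := u) fun h2 => h ⟨u, hu, h1, h2.symm⟩, zero_mul]
      · rw [Blg.mon_of_not_isWeight fun h => h1 h.symm, mul_zero]

end LocalProducts

/-! ### The Clifford algebra of a matching -/

section Clifford

variable {k : Type} [CommRing k] {m : ℕ}

variable (k) in
/-- The generator `E_{i+1}` of the Clifford algebra. -/
def Matching.e (M : Matching m) (i : Fin m) : CliffordAlgebra (M.quad k) :=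
  CliffordAlgebra.ι (M.quad k) (Pi.single i 1)

theorem Matching.e_mul_self (M : Matching m) (i : Fin m) : M.e k i * M.e k i = 0 := by
  rw [Matching.e, CliffordAlgebra.ι_sq_scalar, M.quad_single, map_zero]

theorem Matching.e_mul_e_add (M : Matching m) (i j : Fin m) :
    M.e k i * M.e k j + M.e k j * M.e k i = if M.partner i = j then 1 else 0 := by
  have key : QuadraticMap.polar (M.quad k) (Pi.single i 1) (Pi.single j 1) =
      ∑ l, if l < M.partner l then
        ((Pi.single i 1 : Fin m → k) l * (Pi.single j 1 : Fin m → k) (M.partner l) +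
          (Pi.single i 1 : Fin m → k) (M.partner l) * (Pi.single j 1 : Fin m → k) l) else 0 := by
    unfold QuadraticMap.polar Matching.quad
    rw [sum_apply, sum_apply, sum_apply, Finset.sum_filter, Finset.sum_filter,
      Finset.sum_filter, ← Finset.sum_sub_distrib, ← Finset.sum_sub_distrib]
    refine Finset.sum_congr rfl fun l _ => ?_
    split_ifs
    · simp only [QuadraticMap.linMulLin_apply, LinearMap.proj_apply, Pi.add_apply]
      ring
    · simp
  rw [Matching.e, Matching.e, CliffordAlgebra.ι_mul_ι_add_swap, key]
  split_ifs with h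
  · subst h
    refine Eq.trans (congrArg _ ?_) (map_one (algebraMap k (CliffordAlgebra (M.quad k))))
    have hne := M.partner_ne i
    have hinv := M.partner_partner i
    rcases lt_or_gt_of_ne hne with h | h
    · rw [Finset.sum_eq_single (M.partner i)]
      · rw [hinv, if_pos h, Pi.single_eq_same, Pi.single_eq_same, Pi.single_eq_of_ne hne]
        ring
      · intro l _ hl
        have h2 : M.partner l ≠ i := by
          rintro rfl
          exact hl (M.partner_partner l).symm
        rw [Pi.single_eq_of_ne hl, Pi.single_eq_of_ne h2]
        split_ifs with h3
        · by_cases hli : l = i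
          · subst hli
            exact (lt_asymm h h3).elim
          · rw [Pi.single_eq_of_ne hli]; ring
        · rfl
      · simp
    · rw [Finset.sum_eq_single i]
      · rw [if_pos h, Pi.single_eq_same, Pi.single_eq_same, Pi.single_eq_of_ne hne]
        ring
      · intro l _ hl
        rw [Pi.single_eq_of_ne hl]
        split_ifs with h3
        · by_cases hli : l = M.partner i
          · subst hli
            rw [hinv] at h3
            exact (lt_asymm h h3).elim
          · rw [Pi.single_eq_of_ne hli]; ring
        · rfl
      · simp
  · rw [Finset.sum_eq_zero, map_zero]
    intro l _
    split_ifs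
    · have h1 : (Pi.single i 1 : Fin m → k) l *
          (Pi.single j 1 : Fin m → k) (M.partner l) = 0 := by
        by_cases hl : l = i
        · subst hl
          rw [Pi.single_eq_of_ne h, mul_zero]
        · rw [Pi.single_eq_of_ne hl, zero_mul]
      have h2 : (Pi.single i 1 : Fin m → k) (M.partner l) *
          (Pi.single j 1 : Fin m → k) l = 0 := by
        by_cases hl : l = j
        · subst hl
          rw [Pi.single_eq_of_ne, zero_mul]
          rintro rfl
          exact h (M.partner_partner l)
        · rw [Pi.single_eq_of_ne hl, mul_zero]
      rw [h1, h2, add_zero]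
    · rfl

theorem Matching.contractLeft_e (M : Matching m) (i j : Fin m) :
    CliffordAlgebra.contractLeft (Q := M.quad k) (LinearMap.proj i) (M.e k j) =
      if i = j then 1 else 0 := by
  rw [Matching.e, CliffordAlgebra.contractLeft_ι, LinearMap.proj_apply, Pi.single_apply]
  split_ifs <;> simp

theorem Matching.contractLeft_shiftE (M : Matching m) (f : Module.Dual k (Fin (m + 2) → k))
    (c : CliffordAlgebra (M.quad k)) :
    CliffordAlgebra.contractLeft (Q := M.extend.quad k) f (M.shiftE k c) =
      M.shiftE k (CliffordAlgebra.contractLeft (Q := M.quad k)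
        (f ∘ₗ (M.shiftIso k).toLinearMap) c) := by
  induction c using CliffordAlgebra.left_induction with
  | algebraMap t => simp [CliffordAlgebra.contractLeft_algebraMap]
  | add x y hx hy => rw [map_add, map_add, hx, hy, map_add, map_add]
  | ι_mul x v hx =>
    have hv : M.shiftE k (CliffordAlgebra.ι (M.quad k) v) =
        CliffordAlgebra.ι (M.extend.quad k) (M.shiftIso k v) :=
      CliffordAlgebra.map_apply_ι _ _
    rw [map_mul, hv, CliffordAlgebra.contractLeft_ι_mul, CliffordAlgebra.contractLeft_ι_mul, hx,
      map_sub, map_smul, map_mul, hv]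
    rfl

/-- The new generators `E₁`, `E₂` do not occur in the image of `shiftE`, so `U₁` and `U₂` do not
occur in its differential. -/
theorem Matching.contractLeft_shiftE_of_lt (M : Matching m) {i : Fin (m + 2)} (hi : i.val < 2)
    (c : CliffordAlgebra (M.quad k)) :
    CliffordAlgebra.contractLeft (Q := M.extend.quad k) (LinearMap.proj i) (M.shiftE k c) = 0 := by
  rw [M.contractLeft_shiftE]
  have : (LinearMap.proj i : Module.Dual k (Fin (m + 2) → k)) ∘ₗ (M.shiftIso k).toLinearMap =
      0 := by
    ext j
    rcases fin_cases₂ i with rfl | rfl | ⟨l, rfl⟩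
    · rfl
    · rfl
    · simp only [Fin.val_succ] at hi; omega
  rw [this, map_zero, LinearMap.zero_apply, map_zero]

theorem Matching.contractLeft_shiftE_succ (M : Matching m) (i : Fin m)
    (c : CliffordAlgebra (M.quad k)) :
    CliffordAlgebra.contractLeft (Q := M.extend.quad k) (LinearMap.proj i.succ.succ)
      (M.shiftE k c) = M.shiftE k
        (CliffordAlgebra.contractLeft (Q := M.quad k) (LinearMap.proj i) c) := by
  rw [M.contractLeft_shiftE]
  rfl

/-- The new generators `E₁`, `E₂` are matched with each other, so they commute with the others. -/
theorem Matching.e_commute_shiftE [CharP k 2] (M : Matching m) {i : Fin (m + 2)} (hi : i.val < 2)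
    (c : CliffordAlgebra (M.quad k)) : Commute (M.extend.e k i) (M.shiftE k c) := by
  induction c using CliffordAlgebra.left_induction with
  | algebraMap t =>
    rw [AlgHom.commutes]
    exact (Algebra.commutes t _).symm
  | add x y hx hy => rw [map_add]; exact hx.add_right hy
  | ι_mul x v hx =>
    rw [map_mul]
    refine Commute.mul_right ?_ hx
    have hv : ∀ j, Commute (M.extend.e k i)
        (M.shiftE k (CliffordAlgebra.ι (M.quad k) (Pi.single j 1))) := by
      intro j
      rw [M.shiftE_ι_single]
      change M.extend.e k i * M.extend.e k j.succ.succ = M.extend.e k j.succ.succ * M.extend.e k i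
      refine (eq_of_sub_eq_zero ?_)
      rw [sub_eq_add_neg, neg_eq_of_add_eq_zero_left (add_self_of_char_two (k := k)
        (M.extend.e k j.succ.succ * M.extend.e k i)), M.extend.e_mul_e_add, if_neg]
      intro h
      have := congrArg Fin.val h
      rcases fin_cases₂ i with rfl | rfl | ⟨l, rfl⟩
      · change 1 = _ at this
        simp only [Fin.val_succ] at this
        omega
      · change 0 = _ at this
        simp only [Fin.val_succ] at this
        omega
      · simp only [Fin.val_succ] at hi; omega
    have hsum : v = ∑ j, v j • (Pi.single j 1 : Fin m → k) := by
      ext l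
      simp [Finset.sum_apply, Pi.single_apply]
    rw [hsum, map_sum, map_sum]
    refine Commute.sum_right _ _ _ fun j _ => ?_
    rw [map_smul, map_smul]
    exact (hv j).smul_right _

end Clifford

/-! ### The expansion maps -/

section Expand

variable {k : Type} [CommRing k] {m r : ℕ}

theorem shiftWeight_add (W V : Fin m →₀ ℕ) :
    shiftWeight (W + V) = shiftWeight W + shiftWeight V := Finsupp.mapDomain_add

theorem shiftWeight_single (i : Fin m) (c : ℕ) :
    shiftWeight (Finsupp.single i c) = Finsupp.single i.succ.succ c := Finsupp.mapDomain_single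

theorem IState.height_anti (x : IState m r) {s t : ℕ} (h : s ≤ t) : x.height t ≤ x.height s := by
  induction t, h using Nat.le_induction with
  | base => exact le_rfl
  | succ t _ ih => exact (x.height_step t).1.trans ih

/-- Prepend two places to a state `q`, and lower its heights to `r - 1`. -/
theorem IState.exists_truncate (q : IState m r) :
    ∃ u : IState (m + 2) (r + 1), u.height 1 = r ∧
      ∀ t, u.height (t + 2) = min (q.height t) (r - 1) := by
  have q0 := q.height_zero
  obtain ⟨u, hu⟩ := IState.exists_of_path (m := m + 2) (r := r + 1)
    (fun t => if t = 0 then r + 1 else if t = 1 then r else min (q.height (t - 2)) (r - 1))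
    (by simp) (by
      rw [if_neg (by omega), if_neg (by omega), show m + 2 + 1 - 2 = m + 1 by omega,
        q.height_top le_rfl]
      simp)
    (by
      intro t _
      match t with
      | 0 => simp
      | 1 => simp; omega
      | t + 2 =>
        have := q.height_step t
        rw [if_neg (by omega), if_neg (by omega), if_neg (by omega), if_neg (by omega),
          show t + 2 + 1 - 2 = t + 1 by omega, Nat.add_sub_cancel]
        omega)
  have u1 : u.height 1 = r := by rw [hu 1 (by omega)]; simp
  have u2 : ∀ t, u.height (t + 2) = min (q.height t) (r - 1) := by
    intro t
    rcases Nat.lt_or_ge (m + 1) t with h' | h'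
    · rw [u.height_top (by omega), q.height_top (by omega)]; simp
    · rw [hu _ (by omega), if_neg (by omega), if_neg (by omega), Nat.add_sub_cancel]
  exact ⟨u, u1, u2⟩

/-- A product through a state that is not of the form `ψ(u)`, with `u` admitted by `T`, expands to
an element of the ideal. -/
theorem vanishes_shift_of_no_lift {T : MinType} {x y : IState (m + 2) (r + 1)}
    (hx : T.DualAdmits x) (hy : T.DualAdmits y) {q : IState m r} {W V : Fin m →₀ ℕ}
    (hW : IsWeight (psi x hx.preferred) q W) (hV : IsWeight q (psi y hy.preferred) V)
    (hq : ¬ (T.h₂ = 0 → q.height 1 + 1 = r)) :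
    Vanishes x y (shiftWeight W + shiftWeight V) := by
  rw [Classical.not_imp] at hq
  obtain ⟨hT, hq⟩ := hq
  obtain ⟨x1, x2, x3⟩ := dualAdmits_iff.1 hx
  obtain ⟨y1, y2, y3⟩ := dualAdmits_iff.1 hy
  rw [hT, Nat.add_zero r] at x2 y2
  replace x3 := x3 hT
  replace y3 := y3 hT
  have hT1 : T.h₁ = 0 := by have := T.h₁_le; omega
  rw [hT1, Nat.add_zero r] at x1 y1
  have q0 := q.height_zero
  have qs := q.height_step 0
  have qs1 := q.height_step 1
  simp only [Nat.zero_add, Nat.reduceAdd] at qs qs1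
  have q1 : q.height 1 = r := by clear * - hq q0 qs; omega
  have hm : 0 < m := by
    by_contra hcon
    have : q.height 1 = 0 := q.height_top (by omega)
    clear * - this q1 x2
    omega
  obtain ⟨u, u1, u2⟩ := q.exists_truncate
  have v1 : ((1 : Fin (m + 2)) : ℕ) = 1 := rfl
  have c2 : u.height 2 = r - 1 := by rw [u2 0, q0]; clear * -; omega
  have c3 : u.height 3 = r - 1 := by rw [u2 1, q1]; clear * -; omega
  have c4 : u.height 4 = r - 1 := by rw [u2 2]; clear * - qs1 q1; omega
  refine ⟨u, (⟨0, hm⟩ : Fin m).succ.succ, c2.trans c3.symm, c3.trans c4.symm, ?_, fun j => ?_⟩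
  · obtain ⟨t, ht⟩ := hW ⟨0, hm⟩
    rw [psi_height _ _ _ (by omega)] at ht
    simp only [Nat.zero_add, Nat.reduceAdd] at ht
    rw [Finsupp.add_apply, shiftWeight_succ]
    clear * - ht q1 x2 x3
    omega
  · rcases fin_cases₂ j with rfl | rfl | ⟨j, rfl⟩
    · simp only [Fin.val_zero, Nat.zero_add]
      rw [x1, u1, y1, sub_self]
      exact Nat.zero_le _
    · have e1 : u.height 2 = x.height 2 := by clear * - c2 x2; omega
      have e2 : y.height 2 = x.height 2 := by clear * - x2 y2; omega
      simp only [v1, Nat.reduceAdd]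
      rw [e1, e2, sub_self]
      exact Nat.zero_le _
    · obtain ⟨t, ht⟩ := hW j
      obtain ⟨s, hs⟩ := hV j
      rw [psi_height _ _ _ (by omega)] at ht hs
      rw [Finsupp.add_apply, shiftWeight_succ, shiftWeight_succ]
      simp only [Fin.val_succ]
      have ax : x.height (j.val + 1 + 2) ≤ x.height 2 := x.height_anti (Nat.le_add_left _ _)
      have ay : y.height (j.val + 1 + 2) ≤ y.height 2 := y.height_anti (Nat.le_add_left _ _)
      have := u2 (j.val + 1)
      change ((x.height (j.val + 1 + 2) : ℤ) - u.height (j.val + 1 + 2)).natAbs +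
        ((u.height (j.val + 1 + 2) : ℤ) - y.height (j.val + 1 + 2)).natAbs ≤ _
      rw [this, ht, hs]
      have hx' : x.height (j.val + 1 + 2) ≤ r - 1 := by clear * - ax x2; omega
      have hy' : y.height (j.val + 1 + 2) ≤ r - 1 := by clear * - ay y2; omega
      generalize x.height (j.val + 1 + 2) = a at *
      generalize y.height (j.val + 1 + 2) = b at *
      generalize q.height (j.val + 1) = c at *
      clear * - hx' hy'
      omega

open Classical in
/-- Expansion is multiplicative. -/
theorem Blg.sum_expand_mul_expand {T : MinType} {x y : IState (m + 2) (r + 1)}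
    (hx : T.DualAdmits x) (hy : T.DualAdmits y) (b c : Blg k m r) :
    ∑ u : {u : IState (m + 2) (r + 1) // T.DualAdmits u},
      Blg.expand k x u.1 hx u.2 b * Blg.expand k u.1 y u.2 hy c =
      Blg.expand k x y hx hy (b * c) := by
  have key : ∑ u : {u : IState (m + 2) (r + 1) // T.DualAdmits u},
      ((LinearMap.mul k (Blg k (m + 2) (r + 1))).compl₁₂ (Blg.expand k x u.1 hx u.2)
        (Blg.expand k u.1 y u.2 hy)) =
      (LinearMap.mul k (Blg k m r)).compr₂ (Blg.expand k x y hx hy) := by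
    refine Blg.linearMap_ext fun p q W hW => Blg.linearMap_ext fun p' q' V hV => ?_
    simp only [LinearMap.coe_sum, Finset.sum_apply, LinearMap.compl₁₂_apply,
      LinearMap.compr₂_apply, LinearMap.mul_apply', Blg.expand_mon]
    by_cases hqp : q = p'
    · subst hqp
      rw [Blg.mon_mul_mon hW hV, Blg.expand_mon]
      by_cases hpq : psi x hx.preferred = p ∧ psi y hy.preferred = q'
      · obtain ⟨rfl, rfl⟩ := hpq
        rw [if_pos ⟨rfl, rfl⟩, shiftWeight_add]
        by_cases hq : T.h₂ = 0 → q.height 1 + 1 = r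
        · obtain ⟨u, hu, rfl⟩ := T.exists_lift q hq
          rw [Finset.sum_eq_single_of_mem (⟨u, hu⟩ : {u // T.DualAdmits u}) (Finset.mem_univ _)]
          · rw [if_pos ⟨rfl, rfl⟩, if_pos ⟨rfl, rfl⟩,
              Blg.mon_mul_mon (hW.shift hx hu) (hV.shift hu hy)]
          · rintro ⟨v, hv⟩ - hvu
            rw [if_neg, zero_mul]
            exact fun h => hvu (Subtype.ext (hv.eq_of_psi_eq hu h.2))
        · rw [Blg.mon_of_vanishes (vanishes_shift_of_no_lift hx hy hW hV hq)]
          refine Finset.sum_eq_zero ?_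
          rintro ⟨u, hu⟩ -
          rw [if_neg, zero_mul]
          rintro ⟨-, rfl⟩
          apply hq
          intro h
          have := dualAdmits_iff.1 hu
          rw [psi_height _ _ _ le_rfl]
          have := this.2.2 h
          simp only [Nat.reduceAdd]
          omega
      · rw [if_neg hpq]
        refine Finset.sum_eq_zero fun u _ => ?_
        by_cases h1 : psi x hx.preferred = p
        · rw [if_neg (c := _ ∧ psi y hy.preferred = q') fun h => hpq ⟨h1, h.2⟩, mul_zero]
        · rw [if_neg (c := psi x hx.preferred = p ∧ _) fun h => h1 h.1, zero_mul]
    · rw [Blg.mon_mul_mon_of_ne hqp, map_zero]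
      refine Finset.sum_eq_zero fun u _ => ?_
      split_ifs with h1 h2
      · exact (hqp (h1.2.symm.trans h2.1)).elim
      · rw [mul_zero]
      · rw [zero_mul]
      · rw [zero_mul]
  have := LinearMap.congr_fun (LinearMap.congr_fun key b) c
  simpa only [LinearMap.coe_sum, Finset.sum_apply, LinearMap.compl₁₂_apply,
      LinearMap.compr₂_apply, LinearMap.mul_apply'] using this

theorem Blg.U_mul_expand {T : MinType} {x y : IState (m + 2) (r + 1)} (hx : T.DualAdmits x)
    (hy : T.DualAdmits y) (i : Fin m) (b : Blg k m r) :
    Blg.U k i.succ.succ * Blg.expand k x y hx hy b = Blg.expand k x y hx hy (Blg.U k i * b) := by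
  have key : (LinearMap.mulLeft k (Blg.U k i.succ.succ)).comp (Blg.expand k x y hx hy) =
      (Blg.expand k x y hx hy).comp (LinearMap.mulLeft k (Blg.U k i)) := by
    refine Blg.linearMap_ext fun p q W hW => ?_
    simp only [LinearMap.comp_apply, LinearMap.mulLeft_apply]
    rw [Blg.U_mul_mon fun _ => hW, Blg.expand_mon, Blg.expand_mon]
    split_ifs with h
    · obtain ⟨rfl, rfl⟩ := h
      rw [Blg.U_mul_mon fun _ => hW.shift hx hy, shiftWeight_add, shiftWeight_single]
    · rw [mul_zero]
  exact LinearMap.congr_fun key b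

open Classical in
/-- Arrows that move elements of `{0, 1, 2}` commute with expansion. -/
theorem Blg.sum_step_mul_expand {T S : MinType} {x y : IState (m + 2) (r + 1)}
    (hx : T.DualAdmits x) (hy : S.DualAdmits y) (b : Blg k m r) :
    ∑ u : {u : IState (m + 2) (r + 1) // S.DualAdmits u},
      Blg.mon k x u.1 (T.step S) * Blg.expand k u.1 y u.2 hy b =
    ∑ u : {u : IState (m + 2) (r + 1) // T.DualAdmits u},
      Blg.expand k x u.1 hx u.2 b * Blg.mon k u.1 y (T.step S) := by
  have key : ∑ u : {u : IState (m + 2) (r + 1) // S.DualAdmits u},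
      (LinearMap.mulLeft k (Blg.mon k x u.1 (T.step S))).comp (Blg.expand k u.1 y u.2 hy) =
    ∑ u : {u : IState (m + 2) (r + 1) // T.DualAdmits u},
      (LinearMap.mulRight k (Blg.mon k u.1 y (T.step S))).comp (Blg.expand k x u.1 hx u.2) := by
    refine Blg.linearMap_ext fun p q W hW => ?_
    simp only [LinearMap.coe_sum, Finset.sum_apply, LinearMap.comp_apply,
      LinearMap.mulLeft_apply, LinearMap.mulRight_apply, Blg.expand_mon]
    by_cases hpq : psi x hx.preferred = p ∧ psi y hy.preferred = q
    · obtain ⟨rfl, rfl⟩ := hpq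
      have h1 := sum_step_mul_mon (k := k) (S := S) hx hy (shiftWeight W)
      have h2 := sum_mon_mul_step (k := k) (S := T) hx hy (shiftWeight W)
      rw [add_comm (shiftWeight W), ← h1] at h2
      refine Eq.trans ?_ (h2.symm.trans ?_)
      · refine Finset.sum_congr rfl fun u _ => ?_
        split_ifs with h
        · rfl
        · rw [Blg.mon_of_not_isWeight, zero_mul, zero_mul]
          exact fun h' => h ⟨((isWeight_step_iff hx u.2).1 h').symm, rfl⟩
      · refine Finset.sum_congr rfl fun u _ => ?_
        split_ifs with h
        · rfl
        · rw [zero_mul, Blg.mon_of_not_isWeight (x := u.1) (y := y), mul_zero]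
          exact fun h' => h ⟨rfl, (isWeight_step_iff u.2 hy).1 h'⟩
    · rw [Finset.sum_eq_zero, Finset.sum_eq_zero]
      · intro u _
        split_ifs with h
        · rw [Blg.mon_of_not_isWeight (x := u.1) (y := y), mul_zero]
          exact fun h' => hpq ⟨h.1, ((isWeight_step_iff u.2 hy).1 h').symm.trans h.2⟩
        · rw [zero_mul]
      · intro u _
        split_ifs with h
        · rw [Blg.mon_of_not_isWeight (x := x) (y := u.1), zero_mul]
          exact fun h' => hpq ⟨((isWeight_step_iff hx u.2).1 h').trans h.1, h.2⟩
        · rw [mul_zero]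
  have := LinearMap.congr_fun key b
  simpa only [LinearMap.coe_sum, Finset.sum_apply, LinearMap.comp_apply,
      LinearMap.mulLeft_apply, LinearMap.mulRight_apply] using this

theorem Blg.expand_idem_mul {T : MinType} {x y : IState (m + 2) (r + 1)} (hx : T.DualAdmits x)
    (hy : T.DualAdmits y) (b : Blg k m r) :
    Blg.expand k x y hx hy (Blg.idem k (psi x hx.preferred) * b) = Blg.expand k x y hx hy b := by
  have key : (Blg.expand k x y hx hy).comp
      (LinearMap.mulLeft k (Blg.idem k (psi x hx.preferred))) = Blg.expand k x y hx hy := by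
    classical
    refine Blg.linearMap_ext fun p q W hW => ?_
    simp only [LinearMap.comp_apply, LinearMap.mulLeft_apply]
    by_cases h : psi x hx.preferred = p
    · subst h
      rw [Blg.idem_mul_mon]
    · rw [Blg.idem_mul_mon_of_ne h, map_zero, Blg.expand_mon, if_neg fun h' => h h'.1]
  exact LinearMap.congr_fun key b

theorem Blg.expand_mul_idem {T : MinType} {x y : IState (m + 2) (r + 1)} (hx : T.DualAdmits x)
    (hy : T.DualAdmits y) (b : Blg k m r) :
    Blg.expand k x y hx hy (b * Blg.idem k (psi y hy.preferred)) = Blg.expand k x y hx hy b := by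
  have key : (Blg.expand k x y hx hy).comp
      (LinearMap.mulRight k (Blg.idem k (psi y hy.preferred))) = Blg.expand k x y hx hy := by
    classical
    refine Blg.linearMap_ext fun p q W hW => ?_
    simp only [LinearMap.comp_apply, LinearMap.mulRight_apply]
    by_cases h : q = psi y hy.preferred
    · subst h
      rw [Blg.mon_mul_idem]
    · rw [Blg.mon_mul_idem_of_ne h, map_zero, Blg.expand_mon, if_neg fun h' => h h'.2.symm]
  exact LinearMap.congr_fun key b

theorem Blg.idem_mul_expand {T : MinType} {x y : IState (m + 2) (r + 1)} (hx : T.DualAdmits x)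
    (hy : T.DualAdmits y) (b : Blg k m r) :
    Blg.idem k x * Blg.expand k x y hx hy b = Blg.expand k x y hx hy b := by
  have key : (LinearMap.mulLeft k (Blg.idem k x)).comp (Blg.expand k x y hx hy) =
      Blg.expand k x y hx hy := by
    classical
    refine Blg.linearMap_ext fun p q W hW => ?_
    simp only [LinearMap.comp_apply, LinearMap.mulLeft_apply, Blg.expand_mon]
    split_ifs
    · rw [Blg.idem_mul_mon]
    · rw [mul_zero]
  exact LinearMap.congr_fun key b

theorem Blg.expand_mul_idem_right {T : MinType} {x y : IState (m + 2) (r + 1)}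
    (hx : T.DualAdmits x) (hy : T.DualAdmits y) (b : Blg k m r) :
    Blg.expand k x y hx hy b * Blg.idem k y = Blg.expand k x y hx hy b := by
  have key : (LinearMap.mulRight k (Blg.idem k y)).comp (Blg.expand k x y hx hy) =
      Blg.expand k x y hx hy := by
    classical
    refine Blg.linearMap_ext fun p q W hW => ?_
    simp only [LinearMap.comp_apply, LinearMap.mulRight_apply, Blg.expand_mon]
    split_ifs
    · rw [Blg.mon_mul_idem]
    · rw [zero_mul]
  exact LinearMap.congr_fun key b

open Classical in
theorem Blg.expand_one {T : MinType} {x y : IState (m + 2) (r + 1)} (hx : T.DualAdmits x)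
    (hy : T.DualAdmits y) :
    Blg.expand k x y hx hy 1 = if x = y then Blg.idem k x else 0 := by
  rw [← (Blg.complete_idem (k := k) m r).complete, map_sum]
  simp only [Blg.idem_eq_mon, Blg.expand_mon]
  split_ifs with h
  · subst h
    rw [Finset.sum_eq_single_of_mem (psi x hx.preferred) (Finset.mem_univ _), if_pos ⟨rfl, rfl⟩]
    · congr 1
    · intro p _ hp
      rw [if_neg fun h => hp h.1.symm]
  · refine Finset.sum_eq_zero fun p _ => ?_
    rw [if_neg]
    rintro ⟨h1, h2⟩
    exact h (hx.eq_of_psi_eq hy (h1.trans h2.symm))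

end Expand

/-! ### The arrows of the dual module -/

section Arrows

variable {k : Type} [CommRing k] {m r : ℕ}

open Classical in
theorem sum_eq_sum_subtype {α V : Type*} [Fintype α] [AddCommMonoid V] (P : α → Prop) (f : α → V)
    (h : ∀ a, ¬ P a → f a = 0) : ∑ a, f a = ∑ a : {a // P a}, f a.1 := by
  rw [← Finset.sum_subtype (Finset.univ.filter P) (by simp) f]
  refine (Finset.sum_filter_of_ne fun a _ ha => ?_).symm
  by_contra h'
  exact ha (h a h')

open Classical in
theorem sum_dualMinGen {V : Type*} [AddCommMonoid V] (f : DualMinGen m r → V) :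
    ∑ g, f g = ∑ T : MinType, ∑ u : {u : IState m r // T.DualAdmits u}, f ⟨(T, u.1), u.2⟩ := by
  rw [← Fintype.sum_sigma' (α := fun T : MinType => {u : IState m r // T.DualAdmits u})
    (fun T u => f ⟨(T, u.1), u.2⟩)]
  exact Fintype.sum_equiv (Equiv.subtypeProdEquivSigmaSubtype fun (T : MinType) (u : IState m r) =>
    T.DualAdmits u) _ _ fun _ => rfl

theorem Blg.idem_mul_idem_eq_mon (x y : IState m r) :
    Blg.idem k x * Blg.idem k y = Blg.mon k x y 0 := by
  classical
  rw [Blg.idem_mul_idem]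
  split_ifs with h
  · subst h
    exact Blg.idem_eq_mon x
  · exact (Blg.mon_zero_of_ne h).symm

theorem Blg.idem_mul_L_mul_idem_of_lt {i : Fin m} {x y : IState m r}
    (h : y.height (i.val + 1) < x.height (i.val + 1)) :
    Blg.idem k x * Blg.L k i * Blg.idem k y = Blg.mon k x y (Finsupp.single i 1) := by
  classical
  rw [Blg.idem_mul_L_mul_idem]
  split_ifs with h'
  · rfl
  · rw [Blg.mon_of_not_isWeight]
    rw [isWeight_single_one_iff]
    rintro (h'' | h'')
    · exact h' h''
    · have := h''.height_eq'
      omega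

theorem Blg.idem_mul_R_mul_idem_of_lt {i : Fin m} {x y : IState m r}
    (h : x.height (i.val + 1) < y.height (i.val + 1)) :
    Blg.idem k x * Blg.R k i * Blg.idem k y = Blg.mon k x y (Finsupp.single i 1) := by
  classical
  rw [Blg.idem_mul_R_mul_idem]
  split_ifs with h'
  · rfl
  · rw [Blg.mon_of_not_isWeight]
    rw [isWeight_single_one_iff]
    rintro (h'' | h'')
    · have := h''.height_eq'
      omega
    · exact h' h''

theorem Blg.idem_mul_mul_mul_idem (x y : IState m r) (a b : Blg k m r) :
    Blg.idem k x * (a * b) * Blg.idem k y =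
      ∑ u, (Blg.idem k x * a * Blg.idem k u) * (Blg.idem k u * b * Blg.idem k y) := by
  have h : ∀ u, (Blg.idem k x * a * Blg.idem k u) * (Blg.idem k u * b * Blg.idem k y) =
      Blg.idem k x * a * Blg.idem k u * b * Blg.idem k y := by
    intro u
    have := (Blg.complete_idem (k := k) m r).idem u
    rw [← mul_assoc, ← mul_assoc, mul_assoc (Blg.idem k x * a), this.eq]
  simp only [h]
  rw [← Finset.sum_mul, ← Finset.sum_mul, ← Finset.mul_sum,
    (Blg.complete_idem (k := k) m r).complete, mul_one, ← mul_assoc (Blg.idem k x)]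

theorem lowWeight_zero_zero : (lowWeight 0 0 : Fin (m + 2) →₀ ℕ) = 0 := by simp [lowWeight]

theorem lowWeight_one_zero : (lowWeight 1 0 : Fin (m + 2) →₀ ℕ) = Finsupp.single 0 1 := by
  simp [lowWeight]

theorem lowWeight_zero_one : (lowWeight 0 1 : Fin (m + 2) →₀ ℕ) = Finsupp.single 1 1 := by
  simp [lowWeight]

variable {x y : IState (m + 2) (r + 1)} {T S : MinType}

theorem Blg.idem_mul_L_zero_mul_idem (hx : T.DualAdmits x) (hy : S.DualAdmits y)
    (hT : T.h₁ = 1) (hS : S.h₁ = 0) (hS' : S.h₂ = 1) :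
    Blg.idem k x * Blg.L k 0 * Blg.idem k y = Blg.mon k x y (T.step S) := by
  have hx' := dualAdmits_iff.1 hx
  have hy' := dualAdmits_iff.1 hy
  have := T.h₁_le
  rw [Blg.idem_mul_L_mul_idem_of_lt, ← lowWeight_one_zero]
  · congr 1
    unfold MinType.step
    congr 1 <;> omega
  · rw [Fin.val_zero, Nat.zero_add]
    omega

theorem Blg.idem_mul_R_zero_mul_idem (hx : T.DualAdmits x) (hy : S.DualAdmits y)
    (hT : T.h₁ = 0) (hT' : T.h₂ = 1) (hS : S.h₁ = 1) :
    Blg.idem k x * Blg.R k 0 * Blg.idem k y = Blg.mon k x y (T.step S) := by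
  have hx' := dualAdmits_iff.1 hx
  have hy' := dualAdmits_iff.1 hy
  have := S.h₁_le
  rw [Blg.idem_mul_R_mul_idem_of_lt, ← lowWeight_one_zero]
  · congr 1
    unfold MinType.step
    congr 1 <;> omega
  · rw [Fin.val_zero, Nat.zero_add]
    omega

theorem Blg.idem_mul_L_one_mul_idem (hx : T.DualAdmits x) (hy : S.DualAdmits y)
    (hT : T.h₁ = 0) (hT' : T.h₂ = 1) (hS : S.h₂ = 0) :
    Blg.idem k x * Blg.L k 1 * Blg.idem k y = Blg.mon k x y (T.step S) := by
  have hx' := dualAdmits_iff.1 hx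
  have hy' := dualAdmits_iff.1 hy
  have := S.h₁_le
  rw [Blg.idem_mul_L_mul_idem_of_lt, ← lowWeight_zero_one]
  · congr 1
    unfold MinType.step
    congr 1 <;> omega
  · change y.height 2 < x.height 2
    omega

theorem Blg.idem_mul_R_one_mul_idem (hx : T.DualAdmits x) (hy : S.DualAdmits y)
    (hT : T.h₂ = 0) (hS : S.h₁ = 0) (hS' : S.h₂ = 1) :
    Blg.idem k x * Blg.R k 1 * Blg.idem k y = Blg.mon k x y (T.step S) := by
  have hx' := dualAdmits_iff.1 hx
  have hy' := dualAdmits_iff.1 hy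
  have := T.h₁_le
  rw [Blg.idem_mul_R_mul_idem_of_lt, ← lowWeight_zero_one]
  · congr 1
    unfold MinType.step
    congr 1 <;> omega
  · change x.height 2 < y.height 2
    omega

theorem MovesLeft.dualAdmits_X1 {u : IState (m + 2) (r + 1)} (hx : T.DualAdmits x)
    (hT : T.h₁ = 1) (h : MovesLeft 0 x u) : MinType.X1.DualAdmits u := by
  have hx' := dualAdmits_iff.1 hx
  have h1 := h.height_eq'
  have h2 := h.height_eq 2 (by rw [Fin.val_zero]; omega)
  have := T.h₁_le
  rw [Fin.val_zero, Nat.zero_add] at h1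
  rw [dualAdmits_iff]
  simp only [MinType.h₁, MinType.h₂, one_ne_zero, false_imp_iff, and_true]
  omega

theorem MovesLeft.dualAdmits_X1' {u : IState (m + 2) (r + 1)} (hx : T.DualAdmits x)
    (hT : T.h₂ = 0) (h : MovesLeft 1 u x) : MinType.X1.DualAdmits u := by
  have hx' := dualAdmits_iff.1 hx
  have h1 := h.height_eq'
  have v1 : ((1 : Fin (m + 2)) : ℕ) = 1 := rfl
  have h2 := h.height_eq 1 (by rw [v1]; omega)
  have := T.h₁_le
  rw [v1] at h1
  simp only [Nat.reduceAdd] at h1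
  rw [dualAdmits_iff]
  simp only [MinType.h₁, MinType.h₂, one_ne_zero, false_imp_iff, and_true]
  omega

theorem MinType.step_X1_add (hT : T.h₁ = 1) (hS : S.h₂ = 0) :
    (T.step .X1 + MinType.X1.step S : Fin (m + 2) →₀ ℕ) = T.step S := by
  have := T.h₁_le
  have := S.h₁_le
  have e1 : MinType.X1.h₁ = 0 := rfl
  have e2 : MinType.X1.h₂ = 1 := rfl
  unfold MinType.step
  rw [lowWeight_add, e1, e2]
  congr 1 <;> omega

theorem Blg.idem_mul_LL_mul_idem (hx : T.DualAdmits x) (hy : S.DualAdmits y)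
    (hT : T.h₁ = 1) (hS : S.h₂ = 0) :
    Blg.idem k x * (Blg.L k 0 * Blg.L k 1) * Blg.idem k y = Blg.mon k x y (T.step S) := by
  classical
  rw [Blg.idem_mul_mul_mul_idem, sum_eq_sum_subtype MinType.X1.DualAdmits,
    ← MinType.step_X1_add hT hS, ← sum_step_mul_mon hx hy]
  · refine Finset.sum_congr rfl fun u _ => ?_
    rw [Blg.idem_mul_L_zero_mul_idem hx u.2 hT rfl rfl,
      Blg.idem_mul_L_one_mul_idem u.2 hy rfl rfl hS]
  · intro u hu
    rw [Blg.idem_mul_L_mul_idem, if_neg fun h => hu (h.dualAdmits_X1 hx hT), zero_mul]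

theorem Blg.idem_mul_RR_mul_idem (hx : T.DualAdmits x) (hy : S.DualAdmits y)
    (hT : T.h₂ = 0) (hS : S.h₁ = 1) :
    Blg.idem k x * (Blg.R k 1 * Blg.R k 0) * Blg.idem k y = Blg.mon k x y (T.step S) := by
  classical
  rw [Blg.idem_mul_mul_mul_idem, sum_eq_sum_subtype MinType.X1.DualAdmits,
    MinType.step_comm, ← MinType.step_X1_add hS hT, add_comm (S.step _), MinType.step_comm _ T,
    ← sum_step_mul_mon hx hy]
  · refine Finset.sum_congr rfl fun u _ => ?_
    rw [Blg.idem_mul_R_one_mul_idem hx u.2 hT rfl rfl, MinType.step_comm S,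
      Blg.idem_mul_R_zero_mul_idem u.2 hy rfl rfl hS]
  · intro u hu
    rw [Blg.idem_mul_R_mul_idem, if_neg fun h => hu (h.dualAdmits_X1' hx hT), zero_mul]

variable (k) in
/-- The second tensor factors of the arrows of the dual module; the first factor of an arrow from
`T` to `S` is the basis element of weight `T.step S`. -/
def dualCliff (w z : k) (M : Matching m) :
    MinType → MinType → CliffordAlgebra (M.extend.quad k)
  | .X1, .X2 | .X1, .X0 | .X1, .Y1 | .X0, .Y2 | .Y2, .Y1 | .X2, .Y0 | .Y0, .Y1 => 1
  | .X2, .X1 | .Y1, .Y2 | .Y0, .X0 => z • 1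
  | .X0, .X1 | .Y1, .Y0 | .Y2, .X2 => w • 1
  | .Y1, .X1 => (w * z) • 1
  | .X1, .Y0 | .X0, .Y1 => M.extend.e k 1
  | .X1, .Y2 | .X2, .Y1 => M.extend.e k 0
  | .X1, .X1 | .Y1, .Y1 => w • M.extend.e k 0 + z • M.extend.e k 1
  | .X0, .X0 | .Y0, .Y0 => w • M.extend.e k 0
  | .X2, .X2 | .Y2, .Y2 => z • M.extend.e k 1
  | _, _ => 0

theorem Matching.extend_e_zero_e_one (M : Matching m) :
    M.extend.e k 0 * M.extend.e k 1 + M.extend.e k 1 * M.extend.e k 0 = 1 := by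
  rw [M.extend.e_mul_e_add]
  exact if_pos rfl

theorem MinType.step_self (hT : T.h₁ = S.h₁) (hS : T.h₂ = S.h₂) :
    (T.step S : Fin (m + 2) →₀ ℕ) = 0 := by
  rw [← lowWeight_zero_zero, MinType.step]
  congr 1 <;> omega

theorem DuAlg.of_mul_tmul {M : Matching m} (a b : Blg k m r) (c : CliffordAlgebra (M.quad k)) :
    (DuAlg.of a : DuAlg k M r) * (b ⊗ₜ c) = (a * b) ⊗ₜ c := by
  rw [DuAlg.of, Algebra.TensorProduct.tmul_mul_tmul, one_mul]

theorem DuAlg.tmul_mul_of {M : Matching m} (a b : Blg k m r) (c : CliffordAlgebra (M.quad k)) :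
    (b ⊗ₜ c : DuAlg k M r) * DuAlg.of a = (b * a) ⊗ₜ c := by
  rw [DuAlg.of, Algebra.TensorProduct.tmul_mul_tmul, mul_one]

/-- The part of an arrow of the dual module between two given states is a single basis element: the
relevant products of `L₁`, `L₂`, `R₁`, `R₂` all realize the shortest path between the states. -/
theorem dualArrow_eq (w z : k) (M : Matching m) (hx : T.DualAdmits x) (hy : S.DualAdmits y) :
    DuAlg.of (Blg.idem k x) * dualArrow k w z M.extend (r + 1) T S * DuAlg.of (Blg.idem k y) =
      Blg.mon k x y (T.step S) ⊗ₜ dualCliff k w z M T S := by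
  have e : ∀ i, (DuAlg.E k i : DuAlg k M.extend (r + 1)) = 1 ⊗ₜ M.extend.e k i := fun _ => rfl
  have o : ∀ b, (DuAlg.of b : DuAlg k M.extend (r + 1)) = b ⊗ₜ 1 := fun _ => rfl
  have one : (1 : DuAlg k M.extend (r + 1)) = 1 ⊗ₜ 1 := rfl
  cases T <;> cases S <;> simp only [dualArrow, dualCliff] <;>
    simp only [e, o, one, Algebra.TensorProduct.tmul_mul_tmul, ← TensorProduct.tmul_smul,
      ← TensorProduct.tmul_add, M.extend_e_zero_e_one, mul_one, one_mul, mul_zero, zero_mul,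
      TensorProduct.tmul_zero, mul_smul_comm] <;>
    refine congrArg (· ⊗ₜ[k] _) ?_
  case X0.X0 | X1.X1 | X2.X2 | Y0.Y0 | Y1.Y1 | Y2.Y2 | X1.Y1 | Y1.X1 | Y0.X0 | Y2.X2 =>
    exact (Blg.idem_mul_idem_eq_mon x y).trans (congrArg _ (MinType.step_self rfl rfl).symm)
  case X0.X1 | X0.Y1 | Y0.Y1 => exact Blg.idem_mul_L_zero_mul_idem hx hy rfl rfl rfl
  case X1.X0 | X1.Y0 | Y1.Y0 => exact Blg.idem_mul_R_zero_mul_idem hx hy rfl rfl rfl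
  case X1.X2 | X1.Y2 | Y1.Y2 => exact Blg.idem_mul_L_one_mul_idem hx hy rfl rfl rfl
  case X2.X1 | X2.Y1 | Y2.Y1 => exact Blg.idem_mul_R_one_mul_idem hx hy rfl rfl rfl
  case X0.Y2 => exact Blg.idem_mul_LL_mul_idem hx hy rfl rfl
  case X2.Y0 => exact Blg.idem_mul_RR_mul_idem hx hy rfl rfl

/-- The structure equation without inputs, sorted by weights. It does not involve the states, since
by `sum_step_mul_mon` products of arrows are determined by their weights; so it is an identity in
the Clifford algebra for each of the 36 pairs of types. -/
theorem dualCliff_relation [CharP k 2] (w z : k) (M : Matching m) {V : Type} [AddCommGroup V]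
    [Module k V] (f : (Fin (m + 2) →₀ ℕ) → CliffordAlgebra (M.extend.quad k) →ₗ[k] V)
    (T S : MinType) :
    (f (T.step S + lowWeight 2 0) (CliffordAlgebra.contractLeft (Q := M.extend.quad k)
      (LinearMap.proj 0) (dualCliff k w z M T S)) +
    f (T.step S + lowWeight 0 2) (CliffordAlgebra.contractLeft (Q := M.extend.quad k)
      (LinearMap.proj 1) (dualCliff k w z M T S))) +
    ∑ R : MinType, f (T.step R + R.step S) (dualCliff k w z M T R * dualCliff k w z M R S) = 0 := by
  have hsum : ∀ g : MinType → V,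
      ∑ R, g R = g .X0 + (g .X1 + (g .X2 + (g .Y0 + (g .Y1 + g .Y2)))) := by
    intro g
    change ∑ R ∈ ({.X0, .X1, .X2, .Y0, .Y1, .Y2} : Finset MinType), g R = _
    simp
  have h00 := M.extend.e_mul_self (k := k) 0
  have h11 := M.extend.e_mul_self (k := k) 1
  have h10 : M.extend.e k 1 * M.extend.e k 0 = M.extend.e k 0 * M.extend.e k 1 + 1 := by
    rw [← M.extend_e_zero_e_one, ← add_assoc, add_self_of_char_two (k := k), zero_add]
  have two : (2 : k) = 0 := CharTwo.two_eq_zero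
  have n01 : (0 : Fin (m + 2)) ≠ 1 := Fin.zero_ne_one
  rw [hsum]
  cases T <;> cases S <;> simp only [dualCliff, MinType.step, MinType.h₁, MinType.h₂,
    lowWeight_add] <;>
    norm_num [h00, h11, h10, add_mul, mul_add, smul_smul, M.extend.contractLeft_e, n01, n01.symm,
      CliffordAlgebra.contractLeft_one] <;>
    match_scalars <;> ring_nf <;> simp [two]

end Arrows

/-! ### The dual module is a type DA bimodule -/

section DualExpand

variable {k : Type} [CommRing k] {m r : ℕ} {M : Matching m}

/-- Linear maps on `B'` that agree on products of basis elements of `B` with elements of the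
Clifford algebra are equal. -/
theorem DuAlg.linearMap_ext {V : Type*} [AddCommGroup V] [Module k V]
    {f g : DuAlg k M r →ₗ[k] V} (h : ∀ b c, f (b ⊗ₜ c) = g (b ⊗ₜ c)) : f = g :=
  TensorProduct.ext' h

variable {x y : IState (m + 2) (r + 1)} {T S : MinType}

theorem DuAlg.expand_tmul (hx : T.DualAdmits x) (hy : T.DualAdmits y) (b : Blg k m r)
    (c : CliffordAlgebra (M.quad k)) :
    DuAlg.expand k M hx hy (b ⊗ₜ c) = Blg.expand k x y hx hy b ⊗ₜ M.shiftE k c := rfl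

open Classical in
theorem DuAlg.sum_expand_mul_expand (hx : T.DualAdmits x) (hy : T.DualAdmits y)
    (b c : DuAlg k M r) :
    ∑ u : {u : IState (m + 2) (r + 1) // T.DualAdmits u},
      DuAlg.expand k M hx u.2 b * DuAlg.expand k M u.2 hy c =
      DuAlg.expand k M hx hy (b * c) := by
  have key : ∑ u : {u : IState (m + 2) (r + 1) // T.DualAdmits u},
      ((LinearMap.mul k (DuAlg k M.extend (r + 1))).compl₁₂ (DuAlg.expand k M hx u.2)
        (DuAlg.expand k M u.2 hy)) =
      (LinearMap.mul k (DuAlg k M r)).compr₂ (DuAlg.expand k M hx hy) := by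
    refine DuAlg.linearMap_ext fun b c => DuAlg.linearMap_ext fun b' c' => ?_
    simp only [LinearMap.coe_sum, Finset.sum_apply, LinearMap.compl₁₂_apply,
      LinearMap.compr₂_apply, LinearMap.mul_apply', Algebra.TensorProduct.tmul_mul_tmul,
      DuAlg.expand_tmul, map_mul]
    rw [← TensorProduct.sum_tmul, Blg.sum_expand_mul_expand]
  have := LinearMap.congr_fun (LinearMap.congr_fun key b) c
  simpa only [LinearMap.coe_sum, Finset.sum_apply, LinearMap.compl₁₂_apply,
      LinearMap.compr₂_apply, LinearMap.mul_apply'] using this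

theorem sum_fin_add_two {V : Type*} [AddCommMonoid V] (f : Fin (m + 2) → V) :
    ∑ i, f i = f 0 + f 1 + ∑ i : Fin m, f i.succ.succ := by
  rw [Fin.sum_univ_succ, Fin.sum_univ_succ, ← add_assoc]
  rfl

/-- Expansion commutes with the differentials. -/
theorem DuAlg.d_expand (hx : T.DualAdmits x) (hy : T.DualAdmits y) (b : DuAlg k M r) :
    DuAlg.d k M.extend (r + 1) (DuAlg.expand k M hx hy b) =
      DuAlg.expand k M hx hy (DuAlg.d k M r b) := by
  have key : (DuAlg.d k M.extend (r + 1)).comp (DuAlg.expand k M hx hy) =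
      (DuAlg.expand k M hx hy).comp (DuAlg.d k M r) := by
    refine DuAlg.linearMap_ext fun b c => ?_
    rw [LinearMap.comp_apply, LinearMap.comp_apply, DuAlg.expand_tmul, DuAlg.d_tmul, DuAlg.d_tmul,
      map_sum, sum_fin_add_two, M.contractLeft_shiftE_of_lt Nat.zero_lt_two,
      M.contractLeft_shiftE_of_lt Nat.one_lt_two, TensorProduct.tmul_zero,
      TensorProduct.tmul_zero, add_zero, zero_add]
    refine Finset.sum_congr rfl fun i _ => ?_
    rw [DuAlg.expand_tmul, M.contractLeft_shiftE_succ, Blg.U_mul_expand]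
  exact LinearMap.congr_fun key b

theorem dualCliff_commute_shiftE [CharP k 2] (w z : k) (T S : MinType)
    (c : CliffordAlgebra (M.quad k)) : Commute (dualCliff k w z M T S) (M.shiftE k c) := by
  have h0 := M.e_commute_shiftE (i := 0) Nat.zero_lt_two c
  have h1 := M.e_commute_shiftE (i := 1) Nat.one_lt_two c
  cases T <;> cases S <;> simp only [dualCliff] <;>
    first
    | exact Commute.one_left _
    | exact Commute.zero_left _
    | exact (Commute.one_left _).smul_left _
    | exact h0
    | exact h1
    | exact h0.smul_left _
    | exact h1.smul_left _
    | exact (h0.smul_left _).add_left (h1.smul_left _)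

open Classical in
/-- The arrows of the dual module commute with the operation that has one input. -/
theorem DuAlg.sum_arrow_mul_expand [CharP k 2] (w z : k) (hx : T.DualAdmits x)
    (hy : S.DualAdmits y) (b : DuAlg k M r) :
    ∑ u : {u : IState (m + 2) (r + 1) // S.DualAdmits u},
      (Blg.mon k x u.1 (T.step S) ⊗ₜ[k] dualCliff k w z M T S) * DuAlg.expand k M u.2 hy b =
    ∑ u : {u : IState (m + 2) (r + 1) // T.DualAdmits u},
      DuAlg.expand k M hx u.2 b * (Blg.mon k u.1 y (T.step S) ⊗ₜ[k] dualCliff k w z M T S) := by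
  have key : ∑ u : {u : IState (m + 2) (r + 1) // S.DualAdmits u},
      (LinearMap.mulLeft k (Blg.mon k x u.1 (T.step S) ⊗ₜ[k] dualCliff k w z M T S)).comp
        (DuAlg.expand k M u.2 hy) =
    ∑ u : {u : IState (m + 2) (r + 1) // T.DualAdmits u},
      (LinearMap.mulRight k (Blg.mon k u.1 y (T.step S) ⊗ₜ[k] dualCliff k w z M T S)).comp
        (DuAlg.expand k M hx u.2) := by
    refine DuAlg.linearMap_ext fun b c => ?_
    simp only [LinearMap.coe_sum, Finset.sum_apply, LinearMap.comp_apply,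
      LinearMap.mulLeft_apply, LinearMap.mulRight_apply, DuAlg.expand_tmul,
      Algebra.TensorProduct.tmul_mul_tmul, ← TensorProduct.sum_tmul]
    rw [Blg.sum_step_mul_expand hx hy, (dualCliff_commute_shiftE w z T S c).eq]
  have := LinearMap.congr_fun key b
  simpa only [LinearMap.coe_sum, Finset.sum_apply, LinearMap.comp_apply,
      LinearMap.mulLeft_apply, LinearMap.mulRight_apply] using this

theorem Blg.U_mul_mon_step_add (hx : T.DualAdmits x) (hy : S.DualAdmits y) {i : Fin (m + 2)}
    (hi : i.val < 2) :
    Blg.U k i * Blg.mon k x y (T.step S) = Blg.mon k x y (T.step S + Finsupp.single i 2) := by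
  refine Blg.U_mul_mon fun h => ?_
  rw [isWeight_step_iff hx hy, psi_eq_iff]
  refine height_eq_of_fin fun j => ?_
  obtain ⟨t, ht⟩ := (isWeight_iff_low.1 h).2.2 j
  rw [Finsupp.add_apply, MinType.step, lowWeight_succ, Finsupp.single_eq_of_ne] at ht
  · omega
  · rintro rfl
    simp only [Fin.val_succ] at hi
    omega

/-- The differential of an arrow of the dual module, where only `E₁` and `E₂` contribute. -/
theorem DuAlg.d_arrow (w z : k) (hx : T.DualAdmits x) (hy : S.DualAdmits y) :
    DuAlg.d k M.extend (r + 1) (Blg.mon k x y (T.step S) ⊗ₜ[k] dualCliff k w z M T S) =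
      Blg.mon k x y (T.step S + lowWeight 2 0) ⊗ₜ
        CliffordAlgebra.contractLeft (Q := M.extend.quad k) (LinearMap.proj 0)
          (dualCliff k w z M T S) +
      Blg.mon k x y (T.step S + lowWeight 0 2) ⊗ₜ
        CliffordAlgebra.contractLeft (Q := M.extend.quad k) (LinearMap.proj 1)
          (dualCliff k w z M T S) := by
  have h : ∀ i : Fin m, CliffordAlgebra.contractLeft (Q := M.extend.quad k)
      (LinearMap.proj i.succ.succ) (dualCliff k w z M T S) = 0 := by
    intro i
    have n0 : i.succ.succ ≠ 0 := Fin.succ_ne_zero _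
    have n1 : i.succ.succ ≠ 1 := fun h => Fin.succ_ne_zero _ (Fin.succ_injective _ h)
    cases T <;> cases S <;> simp only [dualCliff, map_add, map_smul, M.extend.contractLeft_e,
      CliffordAlgebra.contractLeft_one, if_neg n0, if_neg n1, map_zero, smul_zero, add_zero]
  have e0 : (lowWeight 2 0 : Fin (m + 2) →₀ ℕ) = Finsupp.single 0 2 := by simp [lowWeight]
  have e1 : (lowWeight 0 2 : Fin (m + 2) →₀ ℕ) = Finsupp.single 1 2 := by simp [lowWeight]
  rw [DuAlg.d_tmul, sum_fin_add_two, Blg.U_mul_mon_step_add hx hy Nat.zero_lt_two,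
    Blg.U_mul_mon_step_add hx hy Nat.one_lt_two, Finset.sum_eq_zero, add_zero, e0, e1]
  intro i _
  rw [h, TensorProduct.tmul_zero]

end DualExpand

section DA

variable {k : Type} [CommRing k] {A I B J : Type} [Ring A] [Algebra k A] [Fintype I] [Ring B]
  [Algebra k B] [Fintype J] {C : CurvedDG k A I} {D : CurvedDG k B J}

/-- The structure equation of a type DA bimodule, over algebras without curvature, whose operations
have at most one input. -/
theorem PreDA.relation_of_length_le_one {X : PreDA C D} (hX : ∀ bs, 2 ≤ bs.length → X.δ bs = 0)
    (hC : C.curv = 0) (hD : D.curv = 0) (hz : X.δ [0] = 0)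
    (h0 : (X.δ []).map C.d + X.δ [] * X.δ [] = 0)
    (h1 : ∀ b, (X.δ [b]).map C.d + (X.δ [] * X.δ [b] + X.δ [b] * X.δ []) + X.δ [D.d b] = 0)
    (h2 : ∀ b c, X.δ [b] * X.δ [c] + X.δ [b * c] = 0) (bs : List B) : X.Relation bs := by
  have hmap : (0 : Matrix X.Gen X.Gen A).map C.d = 0 := by ext; simp
  unfold PreDA.Relation
  match bs with
  | [] =>
    simp only [splits, differentials, contractions, insertions, List.map_nil, List.sum_nil,
      List.map_cons, List.sum_cons, hC, hD, zero_mul, hz, List.length_nil, List.take_nil,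
      List.drop_nil, zero_add, Finset.sum_range_one, add_zero, if_true, h0,
      Matrix.diagonal_zero]
  | [b] =>
    have e : splits X.δ [b] = X.δ [] * X.δ [b] + X.δ [b] * X.δ [] := by
      simp [splits, Finset.sum_range_succ]
    rw [e]
    simp only [differentials, contractions, insertions, List.map_nil, List.sum_nil,
      List.map_cons, List.sum_cons, hX [D.curv, b] le_rfl, hX [b, D.curv] le_rfl, add_zero, h1,
      reduceCtorEq, if_false]
  | [b, c] =>
    have e : splits X.δ [b, c] = X.δ [b] * X.δ [c] := by
      simp [splits, Finset.sum_range_succ, hX [b, c] le_rfl]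
    rw [e, hX [b, c] le_rfl, hmap]
    simp [differentials, contractions, insertions, hX, h2]
  | b :: c :: e :: bs =>
    have hs : splits X.δ (b :: c :: e :: bs) = 0 := by
      refine Finset.sum_eq_zero fun i _ => ?_
      rcases Nat.lt_or_ge i 2 with hi | hi
      · rw [hX (List.drop i _), mul_zero]
        rw [List.length_drop]
        simp only [List.length_cons]
        omega
      · rw [hX (List.take i _), zero_mul]
        rw [List.length_take]
        simp only [List.length_cons]
        omega
    have hl : ∀ L : List (List B), (∀ l ∈ L, 2 ≤ l.length) → (L.map X.δ).sum = 0 := by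
      intro L hL
      refine List.sum_eq_zero fun a ha => ?_
      obtain ⟨l, hl, rfl⟩ := List.mem_map.1 ha
      exact hX l (hL l hl)
    have hd : ∀ l : List B, ∀ l' ∈ differentials D.d l, l'.length = l.length := by
      intro l
      induction l with
      | nil => simp [differentials]
      | cons a l ih =>
        intro l' h
        simp only [differentials, List.mem_cons, List.mem_map] at h
        rcases h with rfl | ⟨l'', h, rfl⟩
        · rfl
        · rw [List.length_cons, List.length_cons, ih _ h]
    have hc : ∀ l : List B, ∀ l' ∈ contractions l, l'.length + 1 = l.length := by
      intro l
      induction l with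
      | nil => simp [contractions]
      | cons a l ih =>
        cases l with
        | nil => simp [contractions]
        | cons a' l =>
          intro l' h
          simp only [contractions, List.mem_cons, List.mem_map] at h
          rcases h with rfl | ⟨l'', h, rfl⟩
          · rfl
          · rw [List.length_cons, List.length_cons, ih _ h]
    have hi : ∀ l : List B, ∀ l' ∈ insertions D.curv l, l'.length = l.length + 1 := by
      intro l
      induction l with
      | nil => simp [insertions]
      | cons a l ih =>
        intro l' h
        simp only [insertions, List.mem_cons, List.mem_map] at h
        rcases h with rfl | ⟨l'', h, rfl⟩
        · rfl
        · rw [List.length_cons, List.length_cons, ih _ h]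
    rw [hs, hX _ (by simp), hmap, hl, hl, hl]
    · simp
    · intro l h
      rw [hi _ _ h]
      simp
    · intro l h
      have := hc _ _ h
      simp only [List.length_cons] at this
      omega
    · intro l h
      rw [hd _ _ h]
      simp

end DA

section Dual

variable {k : Type} [CommRing k] [CharP k 2] {m r : ℕ} (w z : k) (M : Matching m)

theorem dualMarkedMin_nil (g h : DualMinGen (m + 2) (r + 1)) :
    (dualMarkedMin k w z M r).δ [] g h =
      Blg.mon k g.1.2 h.1.2 (g.1.1.step h.1.1) ⊗ₜ dualCliff k w z M g.1.1 h.1.1 :=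
  dualArrow_eq w z M g.2 h.2

theorem dualMarkedMin_singleton {T : MinType} {x y : IState (m + 2) (r + 1)}
    (hx : T.DualAdmits x) (hy : T.DualAdmits y) (b : DuAlg k M r) :
    (dualMarkedMin k w z M r).δ [b] ⟨(T, x), hx⟩ ⟨(T, y), hy⟩ = DuAlg.expand k M hx hy b :=
  dif_pos rfl

theorem dualMarkedMin_singleton_of_ne {g h : DualMinGen (m + 2) (r + 1)} (hgh : g.1.1 ≠ h.1.1)
    (b : DuAlg k M r) : (dualMarkedMin k w z M r).δ [b] g h = 0 :=
  dif_neg hgh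

theorem dualMarkedMin_of_two_le {bs : List (DuAlg k M r)} (h : 2 ≤ bs.length) :
    (dualMarkedMin k w z M r).δ bs = 0 := by
  match bs with
  | [] => simp at h
  | [b] => simp at h
  | b :: c :: bs => rfl

/-- The operation with one input as a linear map. -/
theorem dualMarkedMin_exists_linear (g h : DualMinGen (m + 2) (r + 1)) :
    ∃ f : DuAlg k M r →ₗ[k] DuAlg k M.extend (r + 1),
      ∀ b, (dualMarkedMin k w z M r).δ [b] g h = f b := by
  obtain ⟨⟨T, x⟩, hx⟩ := g
  obtain ⟨⟨S, y⟩, hy⟩ := h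
  by_cases hTS : T = S
  · subst hTS
    exact ⟨DuAlg.expand k M hx hy, dualMarkedMin_singleton w z M hx hy⟩
  · exact ⟨0, dualMarkedMin_singleton_of_ne w z M hTS⟩

theorem dualMarkedMin_relation_nil :
    ((dualMarkedMin k w z M r).δ []).map (DuAlg.d k M.extend (r + 1)) +
      (dualMarkedMin k w z M r).δ [] * (dualMarkedMin k w z M r).δ [] = 0 := by
  classical
  ext g h
  obtain ⟨⟨T, x⟩, hx⟩ := g
  obtain ⟨⟨S, y⟩, hy⟩ := h
  have e := sum_dualMinGen (fun u : DualMinGen (m + 2) (r + 1) =>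
    (dualMarkedMin k w z M r).δ [] ⟨(T, x), hx⟩ u * (dualMarkedMin k w z M r).δ [] u ⟨(S, y), hy⟩)
  refine (congrArg₂ (· + ·) ?_ (Matrix.mul_apply.trans (e.trans ?_))).trans
    (dualCliff_relation w z M (fun W =>
      (TensorProduct.mk k (Blg k (m + 2) (r + 1)) _) (Blg.mon k x y W)) T S)
  · refine Eq.trans ?_ (DuAlg.d_arrow w z hx hy)
    exact congrArg (DuAlg.d k M.extend (r + 1)) (dualMarkedMin_nil w z M _ _)
  · refine Finset.sum_congr rfl fun R _ => ?_
    simp only [dualMarkedMin_nil, Algebra.TensorProduct.tmul_mul_tmul,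
      ← TensorProduct.sum_tmul, sum_step_mul_mon hx hy, TensorProduct.mk_apply]

theorem dualMarkedMin_relation_singleton (b : DuAlg k M r) :
    ((dualMarkedMin k w z M r).δ [b]).map (DuAlg.d k M.extend (r + 1)) +
      ((dualMarkedMin k w z M r).δ [] * (dualMarkedMin k w z M r).δ [b] +
        (dualMarkedMin k w z M r).δ [b] * (dualMarkedMin k w z M r).δ []) +
      (dualMarkedMin k w z M r).δ [DuAlg.d k M r b] = 0 := by
  classical
  have h1 : (dualMarkedMin k w z M r).δ [] * (dualMarkedMin k w z M r).δ [b] =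
      (dualMarkedMin k w z M r).δ [b] * (dualMarkedMin k w z M r).δ [] := by
    ext g h
    obtain ⟨⟨T, x⟩, hx⟩ := g
    obtain ⟨⟨S, y⟩, hy⟩ := h
    refine Matrix.mul_apply.trans (Eq.trans ?_ Matrix.mul_apply.symm)
    refine (sum_dualMinGen _).trans (Eq.trans ?_ (sum_dualMinGen _).symm)
    rw [Finset.sum_eq_single_of_mem S (Finset.mem_univ _),
      Finset.sum_eq_single_of_mem T (Finset.mem_univ _)]
    · simp only [dualMarkedMin_nil, dualMarkedMin_singleton]
      exact DuAlg.sum_arrow_mul_expand w z hx hy b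
    · intro R _ hR
      refine Finset.sum_eq_zero fun u _ => ?_
      rw [dualMarkedMin_singleton_of_ne w z M (Ne.symm hR), zero_mul]
    · intro R _ hR
      refine Finset.sum_eq_zero fun u _ => ?_
      rw [dualMarkedMin_singleton_of_ne w z M hR, mul_zero]
  have h2 : ((dualMarkedMin k w z M r).δ [b]).map (DuAlg.d k M.extend (r + 1)) =
      (dualMarkedMin k w z M r).δ [DuAlg.d k M r b] := by
    ext g h
    obtain ⟨⟨T, x⟩, hx⟩ := g
    obtain ⟨⟨S, y⟩, hy⟩ := h
    change DuAlg.d k M.extend (r + 1) ((dualMarkedMin k w z M r).δ [b] _ _) = _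
    by_cases hTS : T = S
    · subst hTS
      rw [dualMarkedMin_singleton, dualMarkedMin_singleton, DuAlg.d_expand]
    · rw [dualMarkedMin_singleton_of_ne w z M hTS, dualMarkedMin_singleton_of_ne w z M hTS,
        map_zero]
  rw [h1, h2, add_self_of_char_two (k := k), add_zero, add_self_of_char_two (k := k)]

theorem dualMarkedMin_mul (b c : DuAlg k M r) :
    (dualMarkedMin k w z M r).δ [b] * (dualMarkedMin k w z M r).δ [c] =
      (dualMarkedMin k w z M r).δ [b * c] := by
  classical
  ext g h
  obtain ⟨⟨T, x⟩, hx⟩ := g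
  obtain ⟨⟨S, y⟩, hy⟩ := h
  refine Matrix.mul_apply.trans ((sum_dualMinGen _).trans ?_)
  by_cases hTS : T = S
  · subst hTS
    rw [Finset.sum_eq_single_of_mem T (Finset.mem_univ _)]
    · simp only [dualMarkedMin_singleton]
      exact DuAlg.sum_expand_mul_expand hx hy b c
    · intro R _ hR
      refine Finset.sum_eq_zero fun u _ => ?_
      rw [dualMarkedMin_singleton_of_ne w z M (Ne.symm hR), zero_mul]
  · rw [dualMarkedMin_singleton_of_ne w z M hTS]
    refine Finset.sum_eq_zero fun R _ => Finset.sum_eq_zero fun u _ => ?_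
    by_cases hR : T = R
    · rw [dualMarkedMin_singleton_of_ne w z M (h := ⟨(S, y), hy⟩) fun h => hTS (hR.trans h),
        mul_zero]
    · rw [dualMarkedMin_singleton_of_ne w z M hR, zero_mul]

theorem dualMarkedMin_isTypeDA : (dualMarkedMin k w z M r).IsTypeDA := by
  classical
  have long : ∀ (bs cs : List (DuAlg k M r)) b, ¬ (bs = [] ∧ cs = []) →
      (dualMarkedMin k w z M r).δ (bs ++ b :: cs) = 0 := by
    intro bs cs b h
    apply dualMarkedMin_of_two_le
    rw [List.length_append, List.length_cons]
    by_contra h'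
    exact h ⟨List.eq_nil_of_length_eq_zero (by omega), List.eq_nil_of_length_eq_zero (by omega)⟩
  refine ⟨?_, ?_, ?_, ?_, ?_, ?_, ?_, ?_, ?_⟩
  · intro bs cs b c
    by_cases h : bs = [] ∧ cs = []
    · obtain ⟨rfl, rfl⟩ := h
      ext g h
      obtain ⟨f, hf⟩ := dualMarkedMin_exists_linear w z M (r := r) g h
      rw [Matrix.add_apply, List.nil_append, List.nil_append, List.nil_append, hf, hf, hf, map_add]
    · rw [long _ _ _ h, long _ _ _ h, long _ _ _ h, add_zero]
  · intro bs cs t b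
    by_cases h : bs = [] ∧ cs = []
    · obtain ⟨rfl, rfl⟩ := h
      ext g h
      obtain ⟨f, hf⟩ := dualMarkedMin_exists_linear w z M (r := r) g h
      rw [Matrix.smul_apply, List.nil_append, List.nil_append, hf, hf, map_smul]
    · rw [long _ _ _ h, long _ _ _ h, smul_zero]
  · rintro bs ⟨⟨T, x⟩, hx⟩ ⟨⟨S, y⟩, hy⟩
    change DuAlg.of (Blg.idem k x) * _ = _
    match bs with
    | [] => rw [dualMarkedMin_nil, DuAlg.of_mul_tmul, Blg.idem_mul_mon]
    | [b] =>
      by_cases hTS : T = S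
      · subst hTS
        rw [dualMarkedMin_singleton]
        have : (LinearMap.mulLeft k (DuAlg.of (Blg.idem k x))).comp (DuAlg.expand k M hx hy) =
            DuAlg.expand k M hx hy := DuAlg.linearMap_ext fun b c => by
          rw [LinearMap.comp_apply, LinearMap.mulLeft_apply, DuAlg.expand_tmul, DuAlg.of_mul_tmul,
            Blg.idem_mul_expand]
        exact LinearMap.congr_fun this b
      · rw [dualMarkedMin_singleton_of_ne w z M hTS, mul_zero]
    | b :: c :: bs => exact mul_zero _
  · rintro bs ⟨⟨T, x⟩, hx⟩ ⟨⟨S, y⟩, hy⟩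
    change _ * DuAlg.of (Blg.idem k y) = _
    match bs with
    | [] => rw [dualMarkedMin_nil, DuAlg.tmul_mul_of, Blg.mon_mul_idem]
    | [b] =>
      by_cases hTS : T = S
      · subst hTS
        rw [dualMarkedMin_singleton]
        have : (LinearMap.mulRight k (DuAlg.of (Blg.idem k y))).comp (DuAlg.expand k M hx hy) =
            DuAlg.expand k M hx hy := DuAlg.linearMap_ext fun b c => by
          rw [LinearMap.comp_apply, LinearMap.mulRight_apply, DuAlg.expand_tmul, DuAlg.tmul_mul_of,
            Blg.expand_mul_idem_right]
        exact LinearMap.congr_fun this b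
      · rw [dualMarkedMin_singleton_of_ne w z M hTS, zero_mul]
    | b :: c :: bs => exact zero_mul _
  · rintro ⟨⟨T, x⟩, hx⟩ ⟨⟨S, y⟩, hy⟩ hne
    rw [dualMarkedMin_nil, Blg.mon_of_not_isWeight fun h => hne ((isWeight_step_iff hx hy).1 h),
      TensorProduct.zero_tmul]
  · rintro b bs ⟨⟨T, x⟩, hx⟩ ⟨⟨S, y⟩, hy⟩
    match bs with
    | [] =>
      by_cases hTS : T = S
      · subst hTS
        rw [dualMarkedMin_singleton, dualMarkedMin_singleton]
        change DuAlg.expand k M hx hy (DuAlg.of (Blg.idem k (psi x hx.preferred)) * b) = _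
        have : (DuAlg.expand k M hx hy).comp
            (LinearMap.mulLeft k (DuAlg.of (Blg.idem k (psi x hx.preferred)))) =
            DuAlg.expand k M hx hy := DuAlg.linearMap_ext fun b c => by
          rw [LinearMap.comp_apply, LinearMap.mulLeft_apply, DuAlg.of_mul_tmul, DuAlg.expand_tmul,
            DuAlg.expand_tmul, Blg.expand_idem_mul]
        exact LinearMap.congr_fun this b
      · rw [dualMarkedMin_singleton_of_ne w z M hTS, dualMarkedMin_singleton_of_ne w z M hTS]
    | c :: bs => rfl
  · intro bs cs b c j
    rw [long _ _ _ (by simp), long _ _ _ (by simp)]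
  · rintro bs b ⟨⟨T, x⟩, hx⟩ ⟨⟨S, y⟩, hy⟩
    by_cases h : bs = []
    · subst h
      rw [List.nil_append, List.nil_append]
      by_cases hTS : T = S
      · subst hTS
        rw [dualMarkedMin_singleton, dualMarkedMin_singleton]
        change DuAlg.expand k M hx hy (b * DuAlg.of (Blg.idem k (psi y hy.preferred))) = _
        have : (DuAlg.expand k M hx hy).comp
            (LinearMap.mulRight k (DuAlg.of (Blg.idem k (psi y hy.preferred)))) =
            DuAlg.expand k M hx hy := DuAlg.linearMap_ext fun b c => by
          rw [LinearMap.comp_apply, LinearMap.mulRight_apply, DuAlg.tmul_mul_of, DuAlg.expand_tmul,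
            DuAlg.expand_tmul, Blg.expand_mul_idem]
        exact LinearMap.congr_fun this b
      · rw [dualMarkedMin_singleton_of_ne w z M hTS, dualMarkedMin_singleton_of_ne w z M hTS]
    · rw [long _ _ _ fun h' => h h'.1, long _ _ _ fun h' => h h'.1]
  · refine PreDA.relation_of_length_le_one (fun bs h => dualMarkedMin_of_two_le w z M h) rfl rfl ?_
      (dualMarkedMin_relation_nil w z M) (dualMarkedMin_relation_singleton w z M) fun b c => ?_
    · ext g h
      obtain ⟨f, hf⟩ := dualMarkedMin_exists_linear w z M (r := r) g h
      rw [hf, map_zero, Matrix.zero_apply]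
    · rw [dualMarkedMin_mul]
      exact add_self_of_char_two (k := k) _

theorem dualMarkedMin_isUnital : (dualMarkedMin k w z M r).IsUnital := by
  classical
  refine ⟨?_, fun bs h _ => dualMarkedMin_of_two_le w z M h⟩
  ext g h
  rw [Matrix.diagonal_apply]
  obtain ⟨⟨T, x⟩, hx⟩ := g
  obtain ⟨⟨S, y⟩, hy⟩ := h
  by_cases hTS : T = S
  · subst hTS
    rw [dualMarkedMin_singleton, Algebra.TensorProduct.one_def, DuAlg.expand_tmul,
      map_one (M.shiftE k),
      Blg.expand_one]
    by_cases hxy : x = y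
    · subst hxy
      rw [if_pos rfl]
      exact (if_pos rfl).symm
    · rw [if_neg hxy, if_neg, TensorProduct.zero_tmul]
      intro h
      exact hxy (congrArg (fun p : DualMinGen (m + 2) (r + 1) => p.1.2) h)
  · rw [dualMarkedMin_singleton_of_ne w z M hTS, if_neg]
    intro h
    exact hTS (congrArg (fun p : DualMinGen (m + 2) (r + 1) => p.1.1) h)

end Dual

/-! ### Box tensor products -/

section Box

variable {k : Type} [CommRing k] {A I B J E K : Type} [Ring A] [Algebra k A] [Fintype I] [Ring B]
  [Algebra k B] [Fintype J] [Ring E] [Algebra k E] [Fintype K]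
  {C : CurvedDG k A I} {D : CurvedDG k B J} {F : CurvedDG k E K}

theorem PreDD.iter_eq_zero (Y : PreDD D F) (κ₁ : Y.Gen) (j : ℕ) (κ : Y.Gen) (φ : List B → A)
    (h : ∀ bs, bs.length = j → φ bs = 0) : Y.iter κ₁ j κ φ = 0 := by
  induction j generalizing κ φ with
  | zero =>
    rw [PreDD.iter, h [] rfl, TensorProduct.zero_tmul, ite_self]
  | succ j ih =>
    rw [PreDD.iter]
    refine Finset.sum_eq_zero fun κ' _ => Finset.sum_eq_zero fun t _ => ?_
    rw [ih, mul_zero]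
    intro bs hbs
    exact h _ (by rw [List.length_cons, hbs])

open Classical in
theorem PreDD.iter_zero (Y : PreDD D F) (κ₁ κ : Y.Gen) (φ : List B → A) :
    Y.iter κ₁ 0 κ φ = if κ = κ₁ then φ [] ⊗ₜ F.idem (Y.ι₂ κ) else 0 := rfl

theorem PreDD.iter_one (Y : PreDD D F) (κ₁ κ : Y.Gen) (φ : List B → A) :
    Y.iter κ₁ 1 κ φ = ∑ t, φ [Y.fst t κ κ₁] ⊗ₜ (Y.snd t κ κ₁ * F.idem (Y.ι₂ κ₁)) := by
  classical
  rw [PreDD.iter, Finset.sum_eq_single_of_mem κ₁ (Finset.mem_univ _)]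
  · refine Finset.sum_congr rfl fun t _ => ?_
    rw [PreDD.iter, if_pos rfl, Algebra.TensorProduct.tmul_mul_tmul, one_mul]
  · intro κ' _ h
    refine Finset.sum_eq_zero fun t _ => ?_
    rw [PreDD.iter, if_neg h, mul_zero]

theorem map_id_mul_one_tmul (f : B →ₗ[k] A) (a : B ⊗[k] E) (e : E) :
    TensorProduct.map f LinearMap.id (a * (1 ⊗ₜ e)) =
      TensorProduct.map f LinearMap.id a * (1 ⊗ₜ e) := by
  induction a using TensorProduct.induction_on with
  | zero => simp
  | add a b ha hb => rw [add_mul, map_add, ha, hb, map_add, add_mul]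
  | tmul b e' =>
    rw [Algebra.TensorProduct.tmul_mul_tmul, TensorProduct.map_tmul, TensorProduct.map_tmul,
      mul_one, Algebra.TensorProduct.tmul_mul_tmul, mul_one]
    rfl

namespace PreDA

variable {X : PreDA C D}

/-- The operation with one input as a linear map. -/
def IsTypeDA.lin (hX : X.IsTypeDA) (g h : X.Gen) : B →ₗ[k] A where
  toFun b := X.δ [b] g h
  map_add' b c := congrFun (congrFun (hX.map_add [] [] b c) g) h
  map_smul' t b := congrFun (congrFun (hX.map_smul [] [] t b) g) h

variable (E) in
/-- The operation with one input, tensored with the identity. -/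
def IsTypeDA.tens (hX : X.IsTypeDA) (g h : X.Gen) : B ⊗[k] E →ₗ[k] A ⊗[k] E :=
  TensorProduct.map (hX.lin g h) LinearMap.id

theorem IsTypeDA.tens_tmul (hX : X.IsTypeDA) (g h : X.Gen) (b : B) (e : E) :
    hX.tens E g h (b ⊗ₜ e) = X.δ [b] g h ⊗ₜ e := rfl

theorem IsTypeDA.tens_mul_one_tmul (hX : X.IsTypeDA) (g h : X.Gen) (a : B ⊗[k] E) (e : E) :
    hX.tens E g h (a * (1 ⊗ₜ e)) = hX.tens E g h a * (1 ⊗ₜ e) :=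
  map_id_mul_one_tmul _ a e

theorem IsTypeDA.tens_one_tmul_mul (hX : X.IsTypeDA) (g h : X.Gen) (a : B ⊗[k] E) (e : E) :
    hX.tens E g h ((1 ⊗ₜ e) * a) = (1 ⊗ₜ e) * hX.tens E g h a := by
  induction a using TensorProduct.induction_on with
  | zero => simp
  | add a b ha hb => rw [mul_add, _root_.map_add, ha, hb, _root_.map_add, mul_add]
  | tmul b e' =>
    rw [Algebra.TensorProduct.tmul_mul_tmul, hX.tens_tmul, hX.tens_tmul, one_mul,
      Algebra.TensorProduct.tmul_mul_tmul, one_mul]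

theorem IsTypeDA.tens_mul_idem (hX : X.IsTypeDA) (g h : X.Gen) (a : B ⊗[k] E) :
    hX.tens E g h (a * (D.idem (X.r h) ⊗ₜ 1)) = hX.tens E g h a := by
  induction a using TensorProduct.induction_on with
  | zero => simp
  | add a b ha hb => rw [add_mul, _root_.map_add, ha, hb, _root_.map_add]
  | tmul b e =>
    have := hX.in_right [] b g h
    simp only [List.nil_append] at this
    rw [Algebra.TensorProduct.tmul_mul_tmul, mul_one, hX.tens_tmul, hX.tens_tmul, this]

theorem IsTypeDA.idem_mul_tens (hX : X.IsTypeDA) (g h : X.Gen) (a : B ⊗[k] E) :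
    (C.idem (X.l g) ⊗ₜ 1) * hX.tens E g h a = hX.tens E g h a := by
  induction a using TensorProduct.induction_on with
  | zero => simp
  | add a b ha hb => rw [_root_.map_add, mul_add, ha, hb]
  | tmul b e =>
    rw [hX.tens_tmul, Algebra.TensorProduct.tmul_mul_tmul, one_mul, hX.out_left]

theorem IsTypeDA.tens_mul_idem_left (hX : X.IsTypeDA) (g h : X.Gen) (a : B ⊗[k] E) :
    hX.tens E g h a * (C.idem (X.l h) ⊗ₜ 1) = hX.tens E g h a := by
  induction a using TensorProduct.induction_on with
  | zero => simp
  | add a b ha hb => rw [_root_.map_add, add_mul, ha, hb]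
  | tmul b e =>
    rw [hX.tens_tmul, Algebra.TensorProduct.tmul_mul_tmul, mul_one, hX.out_right]

theorem eq_of_add_eq_zero [CharP k 2] {V : Type} [AddCommGroup V] [Module k V] {a b : V}
    (h : a + b = 0) : a = b := by
  rw [eq_neg_of_add_eq_zero_left h]
  exact neg_eq_of_add_eq_zero_left (add_self_of_char_two (k := k) b)

theorem eq_zero_of_add_add_eq [CharP k 2] {V : Type} [AddCommGroup V] [Module k V] {a b c v : V}
    (h : v + c + c = a + b) (ha : a = 0) (hb : b = 0) : v = 0 := by
  rw [ha, hb, add_assoc, add_self_of_char_two (k := k), add_zero, add_zero] at h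
  exact h

theorem IsTypeDA.mul_eq [CharP k 2] (hX : X.IsTypeDA)
    (hlen : ∀ bs, 2 ≤ bs.length → X.δ bs = 0) (b c : B) :
    X.δ [b] * X.δ [c] = X.δ [b * c] := by
  have h := hX.relation [b, c]
  have e : splits X.δ [b, c] = X.δ [b] * X.δ [c] := by
    simp [splits, Finset.sum_range_succ, hlen [b, c] le_rfl]
  have hmap : (0 : Matrix X.Gen X.Gen A).map C.d = 0 := by ext; simp
  unfold PreDA.Relation at h
  rw [e, hlen [b, c] le_rfl, hmap] at h
  simp [differentials, contractions, insertions, hlen] at h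
  exact eq_of_add_eq_zero (k := k) h

theorem IsTypeDA.relation_one (hX : X.IsTypeDA) (hlen : ∀ bs, 2 ≤ bs.length → X.δ bs = 0) (b : B) :
    (X.δ [b]).map C.d + (X.δ [] * X.δ [b] + X.δ [b] * X.δ []) + X.δ [D.d b] = 0 := by
  have h := hX.relation [b]
  unfold PreDA.Relation at h
  simpa [splits, Finset.sum_range_succ, differentials, contractions, insertions, hlen] using h

open Classical in
theorem IsTypeDA.relation_nil (hX : X.IsTypeDA) :
    (X.δ []).map C.d + X.δ [] * X.δ [] + X.δ [D.curv] +
      Matrix.diagonal (fun g => C.curv * C.idem (X.l g)) = 0 := by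
  have h := hX.relation []
  unfold PreDA.Relation at h
  simpa [splits, Finset.sum_range_succ, differentials, contractions, insertions] using h

/-- Without operations with two inputs, the operation with one input is multiplicative. -/
theorem IsTypeDA.sum_tens_mul_tens [CharP k 2] (hX : X.IsTypeDA)
    (hlen : ∀ bs, 2 ≤ bs.length → X.δ bs = 0)
    (g h : X.Gen) (a b : B ⊗[k] E) :
    ∑ u, hX.tens E g u a * hX.tens E u h b = hX.tens E g h (a * b) := by
  induction a using TensorProduct.induction_on with
  | zero => simp
  | add a a' ha ha' =>
    simp only [_root_.map_add, add_mul, Finset.sum_add_distrib]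
    rw [ha, ha']
  | tmul b₁ e₁ =>
    induction b using TensorProduct.induction_on with
    | zero => simp
    | add b b' hb hb' =>
      simp only [_root_.map_add, mul_add, Finset.sum_add_distrib]
      rw [hb, hb']
    | tmul b₂ e₂ =>
      simp only [hX.tens_tmul, Algebra.TensorProduct.tmul_mul_tmul]
      rw [← TensorProduct.sum_tmul, ← hX.mul_eq hlen, Matrix.mul_apply]

theorem IsTypeDA.tens_relation_one (hX : X.IsTypeDA) (hlen : ∀ bs, 2 ≤ bs.length → X.δ bs = 0)
    (g h : X.Gen) (a : B ⊗[k] E) :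
    TensorProduct.map C.d LinearMap.id (hX.tens E g h a) +
      (∑ u, (X.δ [] g u ⊗ₜ 1) * hX.tens E u h a + ∑ u, hX.tens E g u a * (X.δ [] u h ⊗ₜ 1)) +
      hX.tens E g h (TensorProduct.map D.d LinearMap.id a) = 0 := by
  induction a using TensorProduct.induction_on with
  | zero => simp
  | add a a' ha ha' =>
    rw [← add_zero (0 : A ⊗[k] E)]
    nth_rewrite 1 [← ha]
    rw [← ha']
    simp only [_root_.map_add, mul_add, add_mul, Finset.sum_add_distrib]
    abel
  | tmul b e =>
    have hr := congrFun (congrFun (hX.relation_one hlen b) g) h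
    simp only [Matrix.add_apply, Matrix.map_apply, Matrix.mul_apply, Matrix.zero_apply] at hr
    simp only [hX.tens_tmul, Algebra.TensorProduct.tmul_mul_tmul, TensorProduct.map_tmul,
      LinearMap.id_apply, one_mul, mul_one]
    rw [← TensorProduct.sum_tmul, ← TensorProduct.sum_tmul, ← TensorProduct.add_tmul,
      ← TensorProduct.add_tmul, ← TensorProduct.add_tmul, hr, TensorProduct.zero_tmul]

theorem IsTypeDA.map_tens (hX : X.IsTypeDA) (g h : X.Gen) (f : E →ₗ[k] E) (a : B ⊗[k] E) :
    TensorProduct.map LinearMap.id f (hX.tens E g h a) =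
      hX.tens E g h (TensorProduct.map LinearMap.id f a) := by
  induction a using TensorProduct.induction_on with
  | zero => simp
  | add a a' ha ha' => simp only [_root_.map_add, ha, ha']
  | tmul b e => rfl

end PreDA

/-- The matrix of the structure map of a type DD bimodule. -/
def PreDD.mat (Y : PreDD D F) : Matrix Y.Gen Y.Gen (B ⊗[k] E) :=
  fun κ κ' => ∑ t, Y.fst t κ κ' ⊗ₜ Y.snd t κ κ'

open Classical in
theorem PreDD.isTypeD_iff [CharP k 2] (Y : PreDD D F) : Y.toTypeD.IsTypeD ↔
    (∀ κ κ', (D.idem (Y.ι₁ κ) ⊗ₜ F.idem (Y.ι₂ κ)) * Y.mat κ κ' = Y.mat κ κ' ∧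
      Y.mat κ κ' * (D.idem (Y.ι₁ κ') ⊗ₜ F.idem (Y.ι₂ κ')) = Y.mat κ κ') ∧
    ∀ κ κ', (D.tensor F).d (Y.mat κ κ') + ∑ ν, Y.mat κ ν * Y.mat ν κ' +
      (if κ = κ' then (D.curv ⊗ₜ 1 + 1 ⊗ₜ F.curv) *
        (D.idem (Y.ι₁ κ) ⊗ₜ F.idem (Y.ι₂ κ)) else 0) = 0 := by
  refine and_congr Iff.rfl ⟨fun h κ κ' => ?_, fun h => ?_⟩
  · exact congrFun (congrFun h κ) κ'
  · ext κ κ'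
    exact h κ κ'

namespace PreDA

variable {X : PreDA C D} [CharP k 2] {Y : PreDD D F}

open Classical in
/-- The formula for the structure map of the box tensor product, for all pairs of generators. -/
def IsTypeDA.boxEntry (hX : X.IsTypeDA) (Y : PreDD D F) (p q : X.Gen × Y.Gen) : A ⊗[k] E :=
  (if p.2 = q.2 then X.δ [] p.1 q.1 ⊗ₜ F.idem (Y.ι₂ p.2) else 0) +
    hX.tens E p.1 q.1 (Y.mat p.2 q.2)

theorem toTypeD_mul_idem (hY : Y.toTypeD.IsTypeD) (κ κ' : Y.Gen) :
    Y.mat κ κ' * (D.idem (Y.ι₁ κ') ⊗ₜ 1) = Y.mat κ κ' ∧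
    Y.mat κ κ' * (1 ⊗ₜ F.idem (Y.ι₂ κ')) = Y.mat κ κ' ∧
    (1 ⊗ₜ F.idem (Y.ι₂ κ)) * Y.mat κ κ' = Y.mat κ κ' := by
  obtain ⟨h1, h2⟩ := (Y.isTypeD_iff.1 hY).1 κ κ'
  refine ⟨?_, ?_, ?_⟩
  · rw [← h2, mul_assoc, Algebra.TensorProduct.tmul_mul_tmul, (D.complete.idem _).eq, mul_one]
  · rw [← h2, mul_assoc, Algebra.TensorProduct.tmul_mul_tmul, (F.complete.idem _).eq, mul_one]
  · rw [← h1, ← mul_assoc, Algebra.TensorProduct.tmul_mul_tmul, (F.complete.idem _).eq, one_mul]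

/-- Only the operations with no and with one input contribute to the box tensor product. -/
theorem IsTypeDA.box_δ (hX : X.IsTypeDA) (hlen : ∀ bs, 2 ≤ bs.length → X.δ bs = 0)
    (hY : Y.toTypeD.IsTypeD) (p q : (X.box Y).Gen) :
    (X.box Y).δ p q = hX.boxEntry Y p.1 q.1 := by
  change (∑ᶠ j : ℕ, Y.iter q.1.2 j p.1.2 (fun bs => X.δ bs p.1.1 q.1.1)) = _
  rw [finsum_eq_sum_of_support_subset (s := Finset.range 2)]
  · rw [Finset.sum_range_succ, Finset.sum_range_one, PreDD.iter_zero, PreDD.iter_one]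
    unfold IsTypeDA.boxEntry
    congr 1
    nth_rewrite 1 [← (toTypeD_mul_idem hY _ _).2.1]
    rw [hX.tens_mul_one_tmul]
    change _ = hX.tens E _ _ (∑ t, Y.fst t p.1.2 q.1.2 ⊗ₜ Y.snd t p.1.2 q.1.2) * _
    rw [map_sum, Finset.sum_mul]
    refine Finset.sum_congr rfl fun t _ => ?_
    rw [hX.tens_tmul, Algebra.TensorProduct.tmul_mul_tmul, mul_one]
  · intro j hj
    rw [Function.mem_support] at hj
    rw [Finset.coe_range, Set.mem_Iio]
    by_contra h
    refine hj (PreDD.iter_eq_zero _ _ _ _ _ fun bs hbs => ?_)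
    rw [hlen bs (by omega)]
    rfl

open Classical in
/-- The formula `boxEntry` vanishes if exactly the second pair is not a generator of the box tensor
product, so that sums over generators may be extended to sums over all pairs. -/
theorem IsTypeDA.boxEntry_eq_zero (hX : X.IsTypeDA) (hY : Y.toTypeD.IsTypeD)
    {p q : X.Gen × Y.Gen} (hp : X.r p.1 = Y.ι₁ p.2) (hq : X.r q.1 ≠ Y.ι₁ q.2) :
    hX.boxEntry Y p q = 0 := by
  unfold IsTypeDA.boxEntry
  have h1 : (if p.2 = q.2 then X.δ [] p.1 q.1 ⊗ₜ F.idem (Y.ι₂ p.2) else 0 : A ⊗[k] E) = 0 := by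
    split_ifs with h
    · rw [hX.in_nil, TensorProduct.zero_tmul]
      rw [hp, h]
      exact hq.symm
    · rfl
  have ho := D.complete.ortho hq.symm
  simp only at ho
  rw [h1, zero_add, ← hX.tens_mul_idem, ← (toTypeD_mul_idem hY _ _).1, mul_assoc,
    Algebra.TensorProduct.tmul_mul_tmul, ho, TensorProduct.zero_tmul, mul_zero, map_zero]

/-- The box tensor product of a type DA bimodule without operations with several inputs with a type
DD bimodule is a type D structure. The structure equation of the bimodule with one input, applied to
the structure map of `Y`, turns the structure equation of `Y` into the one for the tensor product; the
curvature of `Y` passes through the bimodule because it is unital. -/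
theorem IsTypeDA.box_isTypeD (hX : X.IsTypeDA) (hlen : ∀ bs, 2 ≤ bs.length → X.δ bs = 0)
    (hU : X.IsUnital) (hY : Y.toTypeD.IsTypeD) : (X.box Y).IsTypeD := by
  classical
  have idem_mul : ∀ κ, F.idem (Y.ι₂ κ) * F.idem (Y.ι₂ κ) = F.idem (Y.ι₂ κ) :=
    fun κ => (F.complete.idem _).eq
  constructor
  · intro p q
    rw [hX.box_δ hlen hY]
    change (C.idem (X.l p.1.1) ⊗ₜ F.idem (Y.ι₂ p.1.2)) * _ = _ ∧
      _ * (C.idem (X.l q.1.1) ⊗ₜ F.idem (Y.ι₂ q.1.2)) = _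
    obtain ⟨⟨g, κ⟩, hp⟩ := p
    obtain ⟨⟨h, κ'⟩, hq⟩ := q
    dsimp only
    have e1 : (C.idem (X.l g) ⊗ₜ F.idem (Y.ι₂ κ) : A ⊗[k] E) =
        (C.idem (X.l g) ⊗ₜ 1) * (1 ⊗ₜ F.idem (Y.ι₂ κ)) := by simp
    have e2 : (C.idem (X.l h) ⊗ₜ F.idem (Y.ι₂ κ') : A ⊗[k] E) =
        (1 ⊗ₜ F.idem (Y.ι₂ κ')) * (C.idem (X.l h) ⊗ₜ 1) := by simp
    unfold IsTypeDA.boxEntry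
    dsimp only
    constructor
    · rw [mul_add]
      congr 1
      · split_ifs
        · rw [Algebra.TensorProduct.tmul_mul_tmul, hX.out_left, idem_mul]
        · rw [mul_zero]
      · rw [e1, mul_assoc, ← hX.tens_one_tmul_mul, hX.idem_mul_tens,
          (toTypeD_mul_idem hY κ κ').2.2]
    · rw [add_mul]
      congr 1
      · split_ifs with hκ
        · rw [Algebra.TensorProduct.tmul_mul_tmul, hX.out_right, hκ, idem_mul]
        · rw [zero_mul]
      · rw [e2, ← mul_assoc, ← hX.tens_mul_one_tmul, hX.tens_mul_idem_left,
          (toTypeD_mul_idem hY κ κ').2.1]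
  · ext p q
    rw [Matrix.add_apply, Matrix.add_apply, Matrix.map_apply, Matrix.zero_apply,
      Matrix.diagonal_apply]
    have hprod : ((X.box Y).δ * (X.box Y).δ) p q =
        ∑ u, hX.boxEntry Y p.1 u * hX.boxEntry Y u q.1 := by
      refine Matrix.mul_apply.trans ?_
      rw [sum_eq_sum_subtype (fun u : X.Gen × Y.Gen => X.r u.1 = Y.ι₁ u.2)
        (fun u => hX.boxEntry Y p.1 u * hX.boxEntry Y u q.1)
        (fun u hu => by rw [hX.boxEntry_eq_zero hY p.2 hu, zero_mul])]
      refine Fintype.sum_equiv (Equiv.refl _) _ _ fun u => ?_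
      rw [hX.box_δ hlen hY, hX.box_δ hlen hY]
      rfl
    rw [hprod, hX.box_δ hlen hY]
    have hcurv : (if p = q then (C.tensor F).curv * (C.tensor F).idem ((X.box Y).ι p) else 0) =
        if p.1.2 = q.1.2 then (if p.1.1 = q.1.1 then
          (C.curv * C.idem (X.l p.1.1)) ⊗ₜ F.idem (Y.ι₂ p.1.2) +
          C.idem (X.l p.1.1) ⊗ₜ (F.curv * F.idem (Y.ι₂ p.1.2)) else 0) else (0 : A ⊗[k] E) := by
      have he : p = q ↔ p.1.2 = q.1.2 ∧ p.1.1 = q.1.1 :=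
        ⟨fun h => by rw [h]; exact ⟨rfl, rfl⟩, fun h => Subtype.ext (Prod.ext h.2 h.1)⟩
      by_cases h : p = q
      · rw [if_pos h, if_pos (he.1 h).1, if_pos (he.1 h).2]
        change (C.curv ⊗ₜ 1 + 1 ⊗ₜ F.curv) * (C.idem (X.l p.1.1) ⊗ₜ F.idem (Y.ι₂ p.1.2)) = _
        rw [add_mul, Algebra.TensorProduct.tmul_mul_tmul, Algebra.TensorProduct.tmul_mul_tmul,
          one_mul, one_mul]
      · rw [if_neg h]
        by_cases h1 : p.1.2 = q.1.2
        · rw [if_pos h1, if_neg fun h2 => h (he.2 ⟨h1, h2⟩)]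
        · rw [if_neg h1]
    rw [hcurv]
    obtain ⟨⟨g, κ⟩, hp⟩ := p
    obtain ⟨⟨h, κ'⟩, hq⟩ := q
    dsimp only at hp hq ⊢
    have hdd : (C.tensor F).d (hX.boxEntry Y (g, κ) (h, κ')) =
        (if κ = κ' then C.d (X.δ [] g h) ⊗ₜ F.idem (Y.ι₂ κ) else 0) +
        (TensorProduct.map C.d LinearMap.id (hX.tens E g h (Y.mat κ κ')) +
          hX.tens E g h (TensorProduct.map LinearMap.id F.d (Y.mat κ κ'))) := by
      rw [← hX.map_tens]
      unfold IsTypeDA.boxEntry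
      rw [_root_.map_add]
      congr 1
      split_ifs
      · change C.d (X.δ [] g h) ⊗ₜ F.idem (Y.ι₂ κ) + X.δ [] g h ⊗ₜ F.d (F.idem (Y.ι₂ κ)) = _
        rw [F.d_idem, TensorProduct.tmul_zero, add_zero]
      · rw [map_zero]
    have hsq : ∑ u, hX.boxEntry Y (g, κ) u * hX.boxEntry Y u (h, κ') =
        (if κ = κ' then (X.δ [] * X.δ []) g h ⊗ₜ F.idem (Y.ι₂ κ) else 0) +
        (∑ u, (X.δ [] g u ⊗ₜ 1) * hX.tens E u h (Y.mat κ κ') +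
          ∑ u, hX.tens E g u (Y.mat κ κ') * (X.δ [] u h ⊗ₜ 1)) +
        hX.tens E g h (∑ ν, Y.mat κ ν * Y.mat ν κ') := by
      rw [Fintype.sum_prod_type]
      unfold IsTypeDA.boxEntry
      dsimp only
      simp only [add_mul, mul_add, Finset.sum_add_distrib]
      have e1 : ∑ u, ∑ ν, (if κ = ν then X.δ [] g u ⊗ₜ F.idem (Y.ι₂ κ) else 0) *
          (if ν = κ' then X.δ [] u h ⊗ₜ F.idem (Y.ι₂ ν) else 0) =
          (if κ = κ' then (X.δ [] * X.δ []) g h ⊗ₜ F.idem (Y.ι₂ κ) else (0 : A ⊗[k] E)) := by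
        simp only [ite_mul, zero_mul, Finset.sum_ite_eq, Finset.mem_univ, if_true]
        split_ifs
        · simp only [Algebra.TensorProduct.tmul_mul_tmul, idem_mul]
          rw [← TensorProduct.sum_tmul, Matrix.mul_apply]
        · simp
      have e2 : ∑ u, ∑ ν, (if κ = ν then X.δ [] g u ⊗ₜ F.idem (Y.ι₂ κ) else 0) *
          hX.tens E u h (Y.mat ν κ') =
          ∑ u, (X.δ [] g u ⊗ₜ 1) * hX.tens E u h (Y.mat κ κ') := by
        simp only [ite_mul, zero_mul, Finset.sum_ite_eq, Finset.mem_univ, if_true]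
        refine Finset.sum_congr rfl fun u _ => ?_
        nth_rewrite 2 [← (toTypeD_mul_idem hY κ κ').2.2]
        rw [hX.tens_one_tmul_mul, ← mul_assoc, Algebra.TensorProduct.tmul_mul_tmul, mul_one,
          one_mul]
      have e3 : ∑ u, ∑ ν, hX.tens E g u (Y.mat κ ν) *
          (if ν = κ' then X.δ [] u h ⊗ₜ F.idem (Y.ι₂ ν) else 0) =
          ∑ u, hX.tens E g u (Y.mat κ κ') * (X.δ [] u h ⊗ₜ 1) := by
        simp only [mul_ite, mul_zero, Finset.sum_ite_eq', Finset.mem_univ, if_true]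
        refine Finset.sum_congr rfl fun u _ => ?_
        nth_rewrite 2 [← (toTypeD_mul_idem hY κ κ').2.1]
        rw [hX.tens_mul_one_tmul, mul_assoc, Algebra.TensorProduct.tmul_mul_tmul, mul_one,
          one_mul]
      have e4 : ∑ u, ∑ ν, hX.tens E g u (Y.mat κ ν) * hX.tens E u h (Y.mat ν κ') =
          hX.tens E g h (∑ ν, Y.mat κ ν * Y.mat ν κ') := by
        rw [Finset.sum_comm, map_sum]
        exact Finset.sum_congr rfl fun ν _ => hX.sum_tens_mul_tens hlen g h _ _
      rw [e1, e2, e3, e4]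
      abel
    have hr1 := hX.tens_relation_one hlen g h (Y.mat κ κ')
    have hYr := eq_of_add_eq_zero (k := k) ((Y.isTypeD_iff.1 hY).2 κ κ')
    have hYr' : hX.tens E g h (TensorProduct.map D.d LinearMap.id (Y.mat κ κ')) +
        hX.tens E g h (TensorProduct.map LinearMap.id F.d (Y.mat κ κ')) +
        hX.tens E g h (∑ ν, Y.mat κ ν * Y.mat ν κ') =
        if κ = κ' then X.δ [D.curv] g h ⊗ₜ F.idem (Y.ι₂ κ) +
          (if g = h then C.idem (X.l g) ⊗ₜ (F.curv * F.idem (Y.ι₂ κ)) else 0) else 0 := by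
      rw [← _root_.map_add, ← _root_.map_add]
      refine (congrArg (hX.tens E g h) hYr).trans ?_
      by_cases hκ : κ = κ'
      · subst hκ
        rw [if_pos rfl, if_pos rfl]
        have h1 := hX.in_right [] D.curv g h
        have h2 := hX.in_right [] 1 g h
        simp only [List.nil_append, one_mul] at h1 h2
        rw [add_mul, Algebra.TensorProduct.tmul_mul_tmul, Algebra.TensorProduct.tmul_mul_tmul,
          one_mul, one_mul, _root_.map_add, hX.tens_tmul, hX.tens_tmul, ← hq, h1, h2, hU.1,
          Matrix.diagonal_apply]
        split_ifs
        · rfl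
        · rw [TensorProduct.zero_tmul]
      · rw [if_neg hκ, if_neg hκ, map_zero]
    have hr0 := congrFun (congrFun hX.relation_nil g) h
    rw [Matrix.add_apply, Matrix.add_apply, Matrix.add_apply, Matrix.map_apply,
      Matrix.zero_apply, Matrix.diagonal_apply] at hr0
    rw [hdd, hsq]
    have hfin : (if κ = κ' then C.d (X.δ [] g h) ⊗ₜ F.idem (Y.ι₂ κ) else 0) +
        (if κ = κ' then (X.δ [] * X.δ []) g h ⊗ₜ F.idem (Y.ι₂ κ) else 0) +
        (if κ = κ' then X.δ [D.curv] g h ⊗ₜ F.idem (Y.ι₂ κ) +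
          (if g = h then C.idem (X.l g) ⊗ₜ (F.curv * F.idem (Y.ι₂ κ)) else 0) else 0) +
        (if κ = κ' then (if g = h then
          (C.curv * C.idem (X.l g)) ⊗ₜ F.idem (Y.ι₂ κ) +
          C.idem (X.l g) ⊗ₜ (F.curv * F.idem (Y.ι₂ κ)) else 0) else (0 : A ⊗[k] E)) = 0 := by
      by_cases hκ : κ = κ'
      · simp only [if_pos hκ]
        have hr0' := congrArg (fun a : A => a ⊗ₜ[k] F.idem (Y.ι₂ κ)) hr0
        rw [TensorProduct.zero_tmul, TensorProduct.add_tmul, TensorProduct.add_tmul,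
          TensorProduct.add_tmul] at hr0'
        by_cases hg : g = h
        · simp only [if_pos hg] at hr0' ⊢
          have := add_self_of_char_two (k := k)
            (C.idem (X.l g) ⊗ₜ[k] (F.curv * F.idem (Y.ι₂ κ)))
          rw [← add_zero (0 : A ⊗[k] E)]
          nth_rewrite 1 [← hr0']
          rw [← this]
          abel
        · simp only [if_neg hg, TensorProduct.zero_tmul, add_zero] at hr0' ⊢
          exact hr0'
      · simp only [if_neg hκ, add_zero]
    rw [← hYr'] at hfin
    refine eq_zero_of_add_add_eq (k := k)
      (c := hX.tens E g h (TensorProduct.map D.d LinearMap.id (Y.mat κ κ'))) ?_ hfin hr1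
    abel

end PreDA

end Box

/-! ### The canonical DD bimodule is a type D structure -/

section Complement

variable {m r s : ℕ}

theorem IState.compl_has_iff (hrs : r + s = m + 1) (x : IState m r) {t : ℕ} (ht : t ≤ m) :
    (x.compl hrs).Has t ↔ ¬ x.Has t := by
  have h1 := x.mem_iff_has ⟨t, Nat.lt_succ_of_le ht⟩
  have h2 := (x.compl hrs).mem_iff_has ⟨t, Nat.lt_succ_of_le ht⟩
  rw [← h2, ← h1]
  exact Finset.mem_compl

theorem IState.height_compl (hrs : r + s = m + 1) (x : IState m r) {t : ℕ} (ht : t ≤ m + 1) :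
    (x.compl hrs).height t + x.height t = m + 1 - t := by
  classical
  obtain ⟨j, hj⟩ : ∃ j, t + j = m + 1 := ⟨m + 1 - t, by omega⟩
  induction j generalizing t with
  | zero =>
    rw [IState.height_top _ (by omega), IState.height_top _ (by omega)]
    omega
  | succ j ih =>
    have := ih (t := t + 1) (by omega) (by omega)
    have hc := IState.compl_has_iff hrs x (t := t) (by omega)
    rw [IState.height_succ, x.height_succ t]
    by_cases h : x.Has t
    · rw [if_pos h, if_neg fun h' => hc.1 h' h]
      omega
    · rw [if_neg h, if_pos (hc.2 h)]
      omega

theorem IState.compl_injective (hrs : r + s = m + 1) :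
    Function.Injective (IState.compl hrs : IState m r → IState m s) := fun _ _ h =>
  Subtype.ext (_root_.compl_injective (congrArg Subtype.val h))

theorem isWeight_compl_iff (hrs : r + s = m + 1) {x y : IState m r} {W : Fin m →₀ ℕ} :
    IsWeight (x.compl hrs) (y.compl hrs) W ↔ IsWeight x y W := by
  refine forall_congr' fun i => exists_congr fun t => ?_
  have h1 := IState.height_compl hrs x (t := i.val + 1) (by omega)
  have h2 := IState.height_compl hrs y (t := i.val + 1) (by omega)
  omega

theorem movesLeft_compl_iff (hrs : r + s = m + 1) {i : Fin m} {x y : IState m r} :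
    MovesLeft i (x.compl hrs) (y.compl hrs) ↔ MovesLeft i y x := by
  have h1 := IState.height_compl hrs x (t := i.val + 1) (by omega)
  have h2 := IState.height_compl hrs y (t := i.val + 1) (by omega)
  constructor
  · intro h
    refine movesLeft_of_height (fun t ht => ?_) ?_
    · rcases Nat.lt_or_ge (m + 1) t with h3 | h3
      · rw [x.height_top (by omega), y.height_top (by omega)]
      · have h4 := IState.height_compl hrs x h3
        have h5 := IState.height_compl hrs y h3
        have h6 := h.height_eq t ht
        omega
    · have := h.height_eq'
      omega
  · intro h
    refine movesLeft_of_height (fun t ht => ?_) ?_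
    · rcases Nat.lt_or_ge (m + 1) t with h3 | h3
      · rw [IState.height_top _ (by omega), IState.height_top _ (by omega)]
      · have h4 := IState.height_compl hrs x h3
        have h5 := IState.height_compl hrs y h3
        have h6 := h.height_eq t ht
        omega
    · have := h.height_eq'
      omega

theorem IsWeight.natAbs_le {x y : IState m r} {W : Fin m →₀ ℕ} (h : IsWeight x y W) (j : Fin m) :
    ((x.height (j.val + 1) : ℤ) - y.height (j.val + 1)).natAbs ≤ W j := by
  obtain ⟨t, ht⟩ := h j
  omega

theorem vanishes_of_heights_eq {x y : IState m r} {W : Fin m →₀ ℕ} (h : IsWeight x y W) {i : Fin m}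
    (hi : 1 ≤ W i) (h1 : x.height i.val = x.height (i.val + 1 + 1)) : Vanishes x y W := by
  have s1 := x.height_step i.val
  have s2 := x.height_step (i.val + 1)
  refine ⟨x, i, by omega, by omega, hi, fun j => ?_⟩
  rw [sub_self, Int.natAbs_zero, zero_add]
  exact h.natAbs_le j

theorem IsWeight.height_eq_of_single {x y : IState m r} {i : Fin m}
    (h : IsWeight x y (Finsupp.single i 1)) {t : ℕ} (ht : t ≠ i.val + 1) :
    x.height t = y.height t := by
  rcases isWeight_single_one_iff.1 h with h | h
  · exact (h.height_eq t ht).symm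
  · exact h.height_eq t ht

theorem IsWeight.height_eq_of_single_same {x y : IState m r} {i : Fin m}
    (h : IsWeight x y (Finsupp.single i 1)) :
    x.height i.val = x.height (i.val + 1 + 1) + 1 ∧
      y.height (i.val + 1) + x.height (i.val + 1) = 2 * x.height (i.val + 1 + 1) + 1 := by
  have e0 := h.height_eq_of_single (t := i.val) (by omega)
  have e2 := h.height_eq_of_single (t := i.val + 1 + 1) (by omega)
  have x1 := x.height_step i.val
  have x2 := x.height_step (i.val + 1)
  have y1 := y.height_step i.val
  have y2 := y.height_step (i.val + 1)
  rcases isWeight_single_one_iff.1 h with h | h <;>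
  · have := h.height_eq'
    omega

theorem IsWeight.eq_of_single {x y y' : IState m r} {i : Fin m}
    (h : IsWeight x y (Finsupp.single i 1)) (h' : IsWeight x y' (Finsupp.single i 1)) :
    y = y' := by
  apply IState.ext_height
  intro t
  by_cases ht : t = i.val + 1
  · have := h.height_eq_of_single_same.2
    have := h'.height_eq_of_single_same.2
    subst ht
    omega
  · rw [← h.height_eq_of_single ht, ← h'.height_eq_of_single ht]

/-- A state that contains exactly one of `i`, `i + 1` has a neighbour where the other one is
occupied. -/
theorem exists_isWeight_single {x : IState m r} {i : Fin m}
    (h : x.height i.val = x.height (i.val + 1 + 1) + 1) :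
    ∃ u, IsWeight x u (Finsupp.single i 1) := by
  have x1 := x.height_step i.val
  have x2 := x.height_step (i.val + 1)
  obtain ⟨u, hu⟩ := IState.exists_of_path (m := m) (r := r)
    (fun t => if t = i.val + 1 then 2 * x.height (i.val + 1 + 1) + 1 - x.height (i.val + 1)
      else x.height t) (by rw [if_neg (by omega), x.height_zero])
    (by rw [if_neg (by omega), x.height_top le_rfl]) (by
      intro t _
      have x3 := x.height_step t
      by_cases h1 : t = i.val
      · subst h1
        rw [if_pos rfl, if_neg (by omega)]
        omega
      · rw [if_neg (by omega : ¬ t + 1 = i.val + 1)]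
        by_cases h2 : t = i.val + 1
        · subst h2
          rw [if_pos rfl]
          omega
        · rw [if_neg h2]
          exact x3)
  refine ⟨u, fun j => ⟨0, ?_⟩⟩
  rw [hu (j.val + 1) (by omega)]
  by_cases hj : i = j
  · subst hj
    rw [Finsupp.single_eq_same, if_pos rfl]
    omega
  · rw [Finsupp.single_eq_of_ne' hj, if_neg fun h' => hj (Fin.ext (by omega))]
    omega

/-- Of two consecutive elementary steps, the second one exists as soon as the first one and the
composition do. -/
theorem IsWeight.of_single_add {x y u : IState m r} {i j : Fin m}
    (h : IsWeight x y (Finsupp.single i 1 + Finsupp.single j 1))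
    (hu : IsWeight x u (Finsupp.single i 1)) : IsWeight u y (Finsupp.single j 1) := by
  have hxi := hu.height_eq_of_single_same
  have hoff : ∀ l : Fin m, l ≠ i → l ≠ j → x.height (l.val + 1) = y.height (l.val + 1) := by
    intro l hi hj
    have := h.natAbs_le l
    rw [Finsupp.add_apply, Finsupp.single_eq_of_ne hi, Finsupp.single_eq_of_ne hj] at this
    omega
  intro l
  by_cases hli : l = i
  · subst hli
    obtain ⟨t, ht⟩ := h l
    rw [Finsupp.add_apply, Finsupp.single_eq_same] at ht
    have x1 := x.height_step l.val
    have x2 := x.height_step (l.val + 1)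
    have y1 := y.height_step l.val
    have y2 := y.height_step (l.val + 1)
    by_cases hlj : l = j
    · subst hlj
      rw [Finsupp.single_eq_same] at ht ⊢
      have e0 : x.height l.val = y.height l.val := by
        rcases Nat.eq_zero_or_pos l.val with h0 | h0
        · rw [h0, x.height_zero, y.height_zero]
        · have := hoff ⟨l.val - 1, by omega⟩ (fun h => by rw [Fin.ext_iff] at h; simp at h; omega)
            (fun h => by rw [Fin.ext_iff] at h; simp at h; omega)
          simp only [Nat.sub_add_cancel h0] at this
          exact this
      exact ⟨0, by omega⟩
    · rw [Finsupp.single_eq_of_ne hlj] at ht ⊢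
      refine ⟨0, ?_⟩
      -- at least one of the two neighbouring heights is the same for `x` and for `y`
      have key : x.height l.val = y.height l.val ∨
          x.height (l.val + 1 + 1) = y.height (l.val + 1 + 1) := by
        by_cases hj : j.val = l.val + 1
        · left
          rcases Nat.eq_zero_or_pos l.val with h0 | h0
          · rw [h0, x.height_zero, y.height_zero]
          · have := hoff ⟨l.val - 1, by omega⟩
              (fun h => by rw [Fin.ext_iff] at h; simp at h; omega)
              (fun h => by rw [Fin.ext_iff] at h; simp at h; omega)
            simp only [Nat.sub_add_cancel h0] at this
            exact this
        · right
          rcases Nat.lt_or_ge (l.val + 1) m with h0 | h0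
          · exact hoff ⟨l.val + 1, h0⟩ (fun h => by rw [Fin.ext_iff] at h; simp at h)
              (fun h => by rw [Fin.ext_iff] at h; simp at h; omega)
          · rw [x.height_top (by omega), y.height_top (by omega)]
      clear hoff h hu
      omega
  · obtain ⟨t, ht⟩ := h l
    rw [Finsupp.add_apply, Finsupp.single_eq_of_ne hli, zero_add] at ht
    exact ⟨t, by rw [← hu.height_eq_of_single fun h => hli (Fin.ext (by omega))]; exact ht⟩

end Complement

section CanonProducts

variable {k : Type} [CommRing k] {m r s : ℕ}

/-- Two elementary steps, taken simultaneously on a state and on its complement. Where the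
intermediate state does not exist, the product vanishes on one of the two sides, because the two
places at which the first step happens are both empty or both occupied. -/
theorem sum_single_mul_single (hrs : r + s = m + 1) {V : Type} [Ring V] [Algebra k V]
    (x y : IState m r) (i j : Fin m) (c : V) :
    ∑ u : IState m r, (Blg.mon k x u (Finsupp.single i 1) *
        Blg.mon k u y (Finsupp.single j 1)) ⊗ₜ[k]
      ((Blg.mon k (x.compl hrs) (u.compl hrs) (Finsupp.single i 1) *
        Blg.mon k (u.compl hrs) (y.compl hrs) (Finsupp.single j 1)) ⊗ₜ[k] c) =
    Blg.mon k x y (Finsupp.single i 1 + Finsupp.single j 1) ⊗ₜ[k]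
      (Blg.mon k (x.compl hrs) (y.compl hrs)
        (Finsupp.single i 1 + Finsupp.single j 1) ⊗ₜ[k] c) := by
  by_cases hu : ∃ u, IsWeight x u (Finsupp.single i 1)
  · obtain ⟨u, hu⟩ := hu
    rw [Finset.sum_eq_single u]
    · by_cases h : IsWeight u y (Finsupp.single j 1)
      · rw [Blg.mon_mul_mon hu h,
          Blg.mon_mul_mon ((isWeight_compl_iff hrs).2 hu) ((isWeight_compl_iff hrs).2 h)]
      · rw [Blg.mon_of_not_isWeight h, mul_zero, TensorProduct.zero_tmul,
          Blg.mon_of_not_isWeight fun h' => h (h'.of_single_add hu), TensorProduct.zero_tmul]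
    · intro u' _ hne
      rw [Blg.mon_of_not_isWeight fun h' => hne (h'.eq_of_single hu), zero_mul,
        TensorProduct.zero_tmul]
    · exact fun h => (h (Finset.mem_univ _)).elim
  · rw [Finset.sum_eq_zero]
    · symm
      by_cases h : IsWeight x y (Finsupp.single i 1 + Finsupp.single j 1)
      · have hi : 1 ≤ (Finsupp.single i 1 + Finsupp.single j 1 : Fin m →₀ ℕ) i := by
          rw [Finsupp.add_apply, Finsupp.single_eq_same]
          exact Nat.le_add_right _ _
        have hx : x.height i.val ≠ x.height (i.val + 1 + 1) + 1 := fun h' =>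
          hu (exists_isWeight_single h')
        have x1 := x.height_step i.val
        have x2 := x.height_step (i.val + 1)
        by_cases h0 : x.height i.val = x.height (i.val + 1 + 1)
        · rw [Blg.mon_of_vanishes (vanishes_of_heights_eq h hi h0), TensorProduct.zero_tmul]
        · have c0 := IState.height_compl hrs x (t := i.val) (by omega)
          have c1 := IState.height_compl hrs x (t := i.val + 1 + 1) (by omega)
          rw [Blg.mon_of_vanishes (vanishes_of_heights_eq ((isWeight_compl_iff hrs).2 h) hi
            (by omega)), TensorProduct.zero_tmul, TensorProduct.tmul_zero]
      · rw [Blg.mon_of_not_isWeight h, TensorProduct.zero_tmul]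
    · intro u _
      rw [Blg.mon_of_not_isWeight fun h => hu ⟨u, h⟩, zero_mul, TensorProduct.zero_tmul]

/-- The terms `L_i ⊗ R_i + R_i ⊗ L_i` of the structure map of the canonical bimodule. -/
def canonLR (k : Type) [CommRing k] (M : Matching m) (hrs : r + s = m + 1) (i : Fin m)
    (x y : IState m r) : Blg k m r ⊗[k] DuAlg k M s :=
  Blg.mon k x y (Finsupp.single i 1) ⊗ₜ
    (Blg.mon k (x.compl hrs) (y.compl hrs) (Finsupp.single i 1) ⊗ₜ 1)

/-- The term `U_i ⊗ E_i` of the structure map of the canonical bimodule. -/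
def canonUE (k : Type) [CommRing k] (M : Matching m) (hrs : r + s = m + 1) (i : Fin m)
    (x y : IState m r) : Blg k m r ⊗[k] DuAlg k M s :=
  Blg.mon k x y (Finsupp.single i 2) ⊗ₜ
    (Blg.mon k (x.compl hrs) (y.compl hrs) 0 ⊗ₜ M.e k i)

theorem canonUE_of_ne {M : Matching m} (hrs : r + s = m + 1) (i : Fin m)
    {x y : IState m r} (h : x ≠ y) : canonUE k M hrs i x y = 0 := by
  rw [canonUE, Blg.mon_zero_of_ne fun h' => h (IState.compl_injective hrs h'),
    TensorProduct.zero_tmul, TensorProduct.tmul_zero]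

theorem sum_sum_eq_sum_diag_add {ι V : Type*} [Fintype ι] [LinearOrder ι] [AddCommMonoid V]
    (g : ι → ι → V) : ∑ i, ∑ j, g i j =
      ∑ i, g i i + ∑ i, ∑ j, if i < j then g i j + g j i else 0 := by
  have h : ∀ i j, g i j = (if i = j then g i j else 0) +
      ((if i < j then g i j else 0) + if j < i then g i j else 0) := by
    intro i j
    rcases lt_trichotomy i j with h | h | h
    · simp [h, h.ne, h.not_gt]
    · simp [h]
    · simp [h, h.ne', h.not_gt]
  have h2 : ∀ i j, (if i < j then g i j + g j i else 0) =
      (if i < j then g i j else 0) + if i < j then g j i else 0 := by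
    intro i j
    split_ifs <;> simp
  rw [Finset.sum_congr rfl fun i _ => Finset.sum_congr rfl fun j _ => h i j]
  simp only [h2, Finset.sum_add_distrib, Finset.sum_ite_eq, Finset.mem_univ, if_true]
  congr 2
  exact Finset.sum_comm

theorem sum_canonLR_mul_canonLR (M : Matching m) (hrs : r + s = m + 1) (i j : Fin m)
    (x y : IState m r) : ∑ u, canonLR k M hrs i x u * canonLR k M hrs j u y =
      Blg.mon k x y (Finsupp.single i 1 + Finsupp.single j 1) ⊗ₜ[k]
      (Blg.mon k (x.compl hrs) (y.compl hrs)
        (Finsupp.single i 1 + Finsupp.single j 1) ⊗ₜ[k] 1) := by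
  rw [← sum_single_mul_single]
  refine Finset.sum_congr rfl fun u _ => ?_
  rw [canonLR, canonLR, Algebra.TensorProduct.tmul_mul_tmul, Algebra.TensorProduct.tmul_mul_tmul,
    mul_one]

theorem sum_canonLR_mul_canonUE (M : Matching m) (hrs : r + s = m + 1) (i j : Fin m)
    (x y : IState m r) : ∑ u, canonLR k M hrs i x u * canonUE k M hrs j u y =
      ∑ u, canonUE k M hrs j x u * canonLR k M hrs i u y := by
  rw [Finset.sum_eq_single_of_mem y (Finset.mem_univ _) fun u _ hu => by
      rw [canonUE_of_ne hrs j hu, mul_zero],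
    Finset.sum_eq_single_of_mem x (Finset.mem_univ _) fun u _ hu => by
      rw [canonUE_of_ne hrs j (Ne.symm hu), zero_mul]]
  unfold canonLR canonUE
  simp only [Algebra.TensorProduct.tmul_mul_tmul, one_mul, mul_one]
  by_cases h : IsWeight x y (Finsupp.single i 1)
  · have h' := (isWeight_compl_iff hrs).2 h
    rw [Blg.mon_mul_mon h (isWeight_two y j), Blg.mon_mul_mon (isWeight_two x j) h,
      Blg.mon_mul_mon h' (IsWeight.zero _), Blg.mon_mul_mon (IsWeight.zero _) h', add_zero,
      zero_add, add_comm (Finsupp.single i 1)]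
  · rw [Blg.mon_of_not_isWeight h]
    simp

theorem sum_canonUE_mul_canonUE (M : Matching m) (hrs : r + s = m + 1) (i j : Fin m)
    (x y : IState m r) : ∑ u, canonUE k M hrs i x u * canonUE k M hrs j u y =
      if x = y then (Blg.U k i * Blg.U k j * Blg.idem k x) ⊗ₜ[k]
        (Blg.idem k (x.compl hrs) ⊗ₜ[k] (M.e k i * M.e k j)) else 0 := by
  rw [Finset.sum_eq_single_of_mem x (Finset.mem_univ _) fun u _ hu => by
      rw [canonUE_of_ne hrs i (Ne.symm hu), zero_mul]]
  split_ifs with h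
  · subst h
    rw [canonUE, canonUE]
    simp only [Algebra.TensorProduct.tmul_mul_tmul]
    rw [Blg.mon_mul_mon (isWeight_two x i) (isWeight_two x j),
      Blg.mon_mul_mon (IsWeight.zero _) (IsWeight.zero _), mul_assoc, Blg.idem_eq_mon,
      Blg.idem_eq_mon, Blg.U_mul_mon (fun _ => IsWeight.zero x),
      Blg.U_mul_mon (fun _ => by rw [zero_add]; exact isWeight_two x j), zero_add, zero_add,
      add_comm (Finsupp.single i 2)]
  · rw [canonUE_of_ne hrs j h, mul_zero]

theorem IsWeight.eq_of_single_two {x y : IState m r} {i : Fin m}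
    (h : IsWeight x y (Finsupp.single i 2)) : x = y := by
  have hoff : ∀ t, t ≠ i.val + 1 → x.height t = y.height t := by
    intro t ht
    rcases Nat.eq_zero_or_pos t with h0 | h0
    · rw [h0, x.height_zero, y.height_zero]
    · rcases Nat.lt_or_ge m t with h1 | h1
      · rw [x.height_top h1, y.height_top h1]
      · have := h.natAbs_le ⟨t - 1, by omega⟩
        rw [Finsupp.single_eq_of_ne (fun h => by rw [Fin.ext_iff] at h; simp at h; omega)] at this
        simp only [Nat.sub_add_cancel h0] at this
        omega
  apply IState.ext_height
  intro t
  by_cases ht : t = i.val + 1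
  · subst ht
    obtain ⟨t, ht⟩ := h i
    rw [Finsupp.single_eq_same] at ht
    have e0 := hoff i.val (by omega)
    have x1 := x.height_step i.val
    have y1 := y.height_step i.val
    clear hoff h
    omega
  · exact hoff t ht

variable (k) in
/-- The matrix of the structure map of the canonical bimodule. -/
def canonMat (M : Matching m) (hrs : r + s = m + 1) (x y : IState m r) :
    Blg k m r ⊗[k] DuAlg k M s :=
  ∑ i, (canonLR k M hrs i x y + canonUE k M hrs i x y)

theorem canonLR_eq (M : Matching m) (hrs : r + s = m + 1) (i : Fin m) (x y : IState m r) :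
    (Blg.idem k x * Blg.L k i * Blg.idem k y) ⊗ₜ[k]
        ((Blg.idem k (x.compl hrs) ⊗ₜ[k] (1 : CliffordAlgebra (M.quad k))) *
          (Blg.R k i ⊗ₜ[k] 1) * (Blg.idem k (y.compl hrs) ⊗ₜ[k] 1)) +
      (Blg.idem k x * Blg.R k i * Blg.idem k y) ⊗ₜ[k]
        ((Blg.idem k (x.compl hrs) ⊗ₜ[k] (1 : CliffordAlgebra (M.quad k))) *
          (Blg.L k i ⊗ₜ[k] 1) * (Blg.idem k (y.compl hrs) ⊗ₜ[k] 1)) =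
      canonLR k M hrs i x y := by
  classical
  simp only [Algebra.TensorProduct.tmul_mul_tmul, mul_one]
  rw [Blg.idem_mul_L_mul_idem, Blg.idem_mul_R_mul_idem, Blg.idem_mul_L_mul_idem,
    Blg.idem_mul_R_mul_idem]
  simp only [movesLeft_compl_iff]
  unfold canonLR
  by_cases h1 : MovesLeft i x y
  · have h2 : ¬ MovesLeft i y x := fun h => h1.asymm h
    simp [h1, h2]
  · by_cases h2 : MovesLeft i y x
    · simp [h1, h2]
    · rw [Blg.mon_of_not_isWeight fun h => (isWeight_single_one_iff.1 h).elim h1 h2]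
      simp [h1, h2]

theorem canonUE_eq (M : Matching m) (hrs : r + s = m + 1) (i : Fin m) (x y : IState m r) :
    (Blg.idem k x * Blg.U k i * Blg.idem k y) ⊗ₜ[k]
        ((Blg.idem k (x.compl hrs) ⊗ₜ[k] (1 : CliffordAlgebra (M.quad k))) *
          (1 ⊗ₜ[k] M.e k i) * (Blg.idem k (y.compl hrs) ⊗ₜ[k] 1)) = canonUE k M hrs i x y := by
  classical
  simp only [Algebra.TensorProduct.tmul_mul_tmul, mul_one, one_mul]
  rw [Blg.idem_mul_U_mul_idem, Blg.idem_mul_idem]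
  by_cases h : x = y
  · subst h
    rw [if_pos rfl, if_pos rfl, canonUE, Blg.idem_eq_mon]
  · rw [canonUE_of_ne hrs i h, if_neg h, TensorProduct.zero_tmul]

theorem idem_mul_canonMat (M : Matching m) (hrs : r + s = m + 1) (x y : IState m r) :
    (Blg.idem k x ⊗ₜ[k] (Blg.idem k (x.compl hrs) ⊗ₜ[k] 1)) * canonMat k M hrs x y =
      canonMat k M hrs x y := by
  rw [canonMat, Finset.mul_sum]
  refine Finset.sum_congr rfl fun i _ => ?_
  simp only [canonLR, canonUE, mul_add, Algebra.TensorProduct.tmul_mul_tmul,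
    Blg.idem_mul_mon, one_mul]

theorem canonMat_mul_idem (M : Matching m) (hrs : r + s = m + 1) (x y : IState m r) :
    canonMat k M hrs x y * (Blg.idem k y ⊗ₜ[k] (Blg.idem k (y.compl hrs) ⊗ₜ[k] 1)) =
      canonMat k M hrs x y := by
  rw [canonMat, Finset.sum_mul]
  refine Finset.sum_congr rfl fun i _ => ?_
  simp only [canonLR, canonUE, add_mul, Algebra.TensorProduct.tmul_mul_tmul,
    Blg.mon_mul_idem, mul_one]

variable [CharP k 2]

theorem canonDD_mat (M : Matching m) (hrs : r + s = m + 1) :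
    (canonDD k M hrs).mat = canonMat k M hrs := by
  funext x y
  change ∑ t : Fin m × CanonKind, _ = _
  rw [Fintype.sum_prod_type]
  refine Finset.sum_congr rfl fun i _ => ?_
  have huniv : (Finset.univ : Finset CanonKind) = {.LR, .RL, .UE} := rfl
  rw [huniv, Finset.sum_insert (by decide), Finset.sum_insert (by decide), Finset.sum_singleton,
    ← add_assoc]
  exact congrArg₂ (· + ·) (canonLR_eq M hrs i x y) (canonUE_eq M hrs i x y)

theorem d_canonLR (M : Matching m) (hrs : r + s = m + 1) (i : Fin m) (x y : IState m r) :
    ((cBlg k M r).tensor (nDuAlg k M s)).d (canonLR k M hrs i x y) = 0 := by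
  change (0 : Blg k m r) ⊗ₜ[k] _ + _ ⊗ₜ[k] DuAlg.d k M s (DuAlg.of _) = _
  rw [DuAlg.d_of, TensorProduct.zero_tmul, TensorProduct.tmul_zero, add_zero]

theorem d_canonUE (M : Matching m) (hrs : r + s = m + 1) (i : Fin m) (x y : IState m r) :
    ((cBlg k M r).tensor (nDuAlg k M s)).d (canonUE k M hrs i x y) =
      Blg.mon k x y (Finsupp.single i 1 + Finsupp.single i 1) ⊗ₜ[k]
      (Blg.mon k (x.compl hrs) (y.compl hrs)
        (Finsupp.single i 1 + Finsupp.single i 1) ⊗ₜ[k] 1) := by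
  rw [← Finsupp.single_add]
  change (0 : Blg k m r) ⊗ₜ[k] _ + Blg.mon k x y (Finsupp.single i 2) ⊗ₜ[k]
    DuAlg.d k M s (_ ⊗ₜ _) = _
  rw [TensorProduct.zero_tmul, zero_add, DuAlg.d_tmul, Finset.sum_eq_single_of_mem i
    (Finset.mem_univ _) fun j _ hj => by
      rw [M.contractLeft_e, if_neg hj, TensorProduct.tmul_zero], M.contractLeft_e, if_pos rfl]
  by_cases h : x = y
  · subst h
    rw [Blg.U_mul_mon (fun _ => IsWeight.zero _), zero_add]
  · rw [Blg.mon_of_not_isWeight fun h' => h h'.eq_of_single_two, TensorProduct.zero_tmul,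
      TensorProduct.zero_tmul]

/-- In the square of the structure map, the terms `L_i ⊗ R_i + R_i ⊗ L_i` cancel in pairs up to
`∑ U_i ⊗ U_i`, which is the differential of `∑ U_i ⊗ E_i`, and the terms `U_i ⊗ E_i` give the
curvature by the relations between the `E_i`. -/
theorem canonMat_relation (M : Matching m) (hrs : r + s = m + 1) (x y : IState m r)
    [Decidable (x = y)] : ((cBlg k M r).tensor (nDuAlg k M s)).d (canonMat k M hrs x y) +
      ∑ u, canonMat k M hrs x u * canonMat k M hrs u y +
      (if x = y then ((cBlg k M r).curv ⊗ₜ 1 + 1 ⊗ₜ 0) *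
        (Blg.idem k x ⊗ₜ[k] (Blg.idem k (x.compl hrs) ⊗ₜ[k] 1)) else 0) = 0 := by
  have hsum : ∑ u, canonMat k M hrs x u * canonMat k M hrs u y =
      ∑ i : Fin m, ∑ j : Fin m, ∑ u, canonLR k M hrs i x u * canonLR k M hrs j u y +
        (∑ i : Fin m, ∑ j : Fin m, ∑ u, canonLR k M hrs i x u * canonUE k M hrs j u y +
          ∑ i : Fin m, ∑ j : Fin m, ∑ u, canonUE k M hrs i x u * canonLR k M hrs j u y) +
        ∑ i : Fin m, ∑ j : Fin m, ∑ u, canonUE k M hrs i x u * canonUE k M hrs j u y := by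
    simp only [← Finset.sum_add_distrib]
    unfold canonMat
    simp only [Finset.sum_mul_sum]
    rw [Finset.sum_comm]
    refine Finset.sum_congr rfl fun i _ => ?_
    rw [Finset.sum_comm]
    refine Finset.sum_congr rfl fun j _ => Finset.sum_congr rfl fun u _ => ?_
    rw [add_mul, mul_add, mul_add]
    abel
  have hd : ((cBlg k M r).tensor (nDuAlg k M s)).d (canonMat k M hrs x y) =
      ∑ i : Fin m, ∑ u, canonLR k M hrs i x u * canonLR k M hrs i u y := by
    rw [canonMat, map_sum]
    refine Finset.sum_congr rfl fun i _ => ?_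
    rw [map_add, d_canonLR, d_canonUE, zero_add, sum_canonLR_mul_canonLR]
  have hLR : ∑ i : Fin m, ∑ j : Fin m, ∑ u, canonLR k M hrs i x u * canonLR k M hrs j u y =
      ∑ i : Fin m, ∑ u, canonLR k M hrs i x u * canonLR k M hrs i u y := by
    rw [sum_sum_eq_sum_diag_add, add_eq_left]
    refine Finset.sum_eq_zero fun i _ => Finset.sum_eq_zero fun j _ => ?_
    rw [sum_canonLR_mul_canonLR, sum_canonLR_mul_canonLR, add_comm (Finsupp.single j 1),
      add_self_of_char_two (k := k), ite_self]
  have hLU : ∑ i : Fin m, ∑ j : Fin m, ∑ u, canonLR k M hrs i x u * canonUE k M hrs j u y +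
      ∑ i : Fin m, ∑ j : Fin m, ∑ u, canonUE k M hrs i x u * canonLR k M hrs j u y = 0 := by
    simp only [sum_canonLR_mul_canonUE]
    rw [Finset.sum_comm]
    exact add_self_of_char_two (k := k) _
  have hUE : ∑ i : Fin m, ∑ j : Fin m, ∑ u, canonUE k M hrs i x u * canonUE k M hrs j u y =
      if x = y then ((cBlg k M r).curv ⊗ₜ 1 + 1 ⊗ₜ 0) *
        (Blg.idem k x ⊗ₜ[k] (Blg.idem k (x.compl hrs) ⊗ₜ[k] 1)) else 0 := by
    simp only [sum_canonUE_mul_canonUE]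
    split_ifs with h
    · rw [sum_sum_eq_sum_diag_add, Finset.sum_eq_zero fun i _ => by
        rw [M.e_mul_self, TensorProduct.tmul_zero, TensorProduct.tmul_zero], zero_add,
        TensorProduct.tmul_zero, add_zero, Algebra.TensorProduct.tmul_mul_tmul, one_mul]
      change _ = ((∑ i ∈ Finset.univ.filter (fun i => i < M.partner i),
        Blg.U k i * Blg.U k (M.partner i)) * _) ⊗ₜ[k] _
      rw [Finset.sum_filter, Finset.sum_mul, TensorProduct.sum_tmul]
      refine Finset.sum_congr rfl fun i _ => ?_
      rw [Finset.sum_eq_single_of_mem (M.partner i) (Finset.mem_univ _)]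
      · split_ifs
        · rw [Blg.U_comm (M.partner i), ← TensorProduct.tmul_add, ← TensorProduct.tmul_add,
            M.e_mul_e_add, if_pos rfl]
        · rw [zero_mul, TensorProduct.zero_tmul]
      · intro j _ hj
        rw [Blg.U_comm j, ← TensorProduct.tmul_add, ← TensorProduct.tmul_add,
          M.e_mul_e_add, if_neg (Ne.symm hj), TensorProduct.tmul_zero, TensorProduct.tmul_zero,
          ite_self]
    · simp
  rw [hsum, hd, hLR, hLU, hUE, add_zero, ← add_assoc, add_self_of_char_two (k := k), zero_add,
    add_self_of_char_two (k := k)]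

theorem canonDD_isTypeD (M : Matching m) (hrs : r + s = m + 1) :
    (canonDD k M hrs).toTypeD.IsTypeD := by
  classical
  rw [PreDD.isTypeD_iff, canonDD_mat]
  exact ⟨fun x y => ⟨idem_mul_canonMat M hrs x y, canonMat_mul_idem M hrs x y⟩,
    fun x y => @canonMat_relation k _ m r s _ M hrs x y (Classical.propDecidable _)⟩

end CanonProducts

/-! ### Exchanging the algebras and relabelling the generators -/

section Relabel

variable {k : Type} [CommRing k] {A I : Type} [Ring A] [Algebra k A] [Fintype I]

theorem PreTypeD.IsTypeD.swap [CharP k 2] {B J : Type} [Ring B] [Algebra k B] [Fintype J]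
    {C : CurvedDG k A I} {D : CurvedDG k B J} {X : PreTypeD (C.tensor D)} (hX : X.IsTypeD) :
    X.swap.IsTypeD := by
  classical
  let σ : A ⊗[k] B ≃ₐ[k] B ⊗[k] A := Algebra.TensorProduct.comm k A B
  have hidem : ∀ g, (D.tensor C).idem (X.ι g).swap = σ ((C.tensor D).idem (X.ι g)) := fun g => rfl
  have hd : ∀ a, (D.tensor C).d (σ a) = σ ((C.tensor D).d a) := by
    intro a
    induction a using TensorProduct.induction_on with
    | zero => simp only [map_zero]
    | add a b ha hb => simp only [map_add, ha, hb]
    | tmul a b =>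
      change D.d b ⊗ₜ a + b ⊗ₜ C.d a = σ (C.d a ⊗ₜ b + a ⊗ₜ D.d b)
      rw [map_add, add_comm]
      rfl
  have hcurv : (D.tensor C).curv = σ ((C.tensor D).curv) := by
    change D.curv ⊗ₜ 1 + 1 ⊗ₜ C.curv = σ (C.curv ⊗ₜ 1 + 1 ⊗ₜ D.curv)
    rw [map_add, add_comm]
    rfl
  refine ⟨fun (g : X.Gen) (h : X.Gen) => ?_, Matrix.ext fun (g : X.Gen) (h : X.Gen) => ?_⟩
  · change (D.tensor C).idem (X.ι g).swap * σ (X.δ g h) = σ (X.δ g h) ∧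
      σ (X.δ g h) * (D.tensor C).idem (X.ι h).swap = σ (X.δ g h)
    rw [hidem, hidem, ← map_mul, ← map_mul, (hX.1 g h).1, (hX.1 g h).2]
    exact ⟨rfl, rfl⟩
  · have h0 := congrArg σ (congrFun (congrFun hX.2 g) h)
    rw [Matrix.add_apply, Matrix.add_apply, Matrix.map_apply, Matrix.mul_apply, Matrix.zero_apply,
      Matrix.diagonal_apply, map_add, map_add, map_sum, map_zero] at h0
    refine Eq.trans (congrArg₂ (· + ·) (congrArg₂ (· + ·) (hd _)
      (Finset.sum_congr rfl fun u _ => (map_mul σ _ _).symm)) ?_) h0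
    rw [apply_ite σ, map_zero, map_mul, ← hcurv, ← hidem]
    exact Matrix.diagonal_apply _ _ _

/-- Exchanging the algebras of a type DD bimodule exchanges them in its type D structure. -/
theorem PreDD.swap_toTypeD [CharP k 2] {B J E K : Type} [Ring B] [Algebra k B] [Fintype J] [Ring E]
    [Algebra k E] [Fintype K] {D : CurvedDG k B J} {F : CurvedDG k E K} (Y : PreDD D F) :
    Y.swap.toTypeD = Y.toTypeD.swap := by
  unfold PreDD.toTypeD PreTypeD.swap
  congr 1
  funext (g : Y.Gen) (h : Y.Gen)
  exact (map_sum (TensorProduct.comm k B E) (fun t => Y.fst t g h ⊗ₜ[k] Y.snd t g h) _).symm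

variable {C : CurvedDG k A I}

/-- Two type D structures that differ only by the names of the generators are homotopy equivalent:
the relabelling and its inverse are given by matrices of idempotents. -/
theorem PreTypeD.homotopyEquivalent_of_equiv [CharP k 2] {X Y : PreTypeD C} (e : X.Gen ≃ Y.Gen)
    (hι : ∀ g, Y.ι (e g) = X.ι g) (hδ : ∀ g h, Y.δ (e g) (e h) = X.δ g h) (hX : X.IsTypeD) :
    X.HomotopyEquivalent Y := by
  classical
  have idem_idem : ∀ i, C.idem i * C.idem i = C.idem i := fun i => (C.complete.idem i).eq
  have hY : Y.IsTypeD := by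
    constructor
    · intro y y'
      obtain ⟨g, rfl⟩ := e.surjective y
      obtain ⟨g', rfl⟩ := e.surjective y'
      rw [hι, hι, hδ]
      exact hX.1 g g'
    · ext y y'
      obtain ⟨g, rfl⟩ := e.surjective y
      obtain ⟨g', rfl⟩ := e.surjective y'
      have h0 := congrFun (congrFun hX.2 g) g'
      rw [Matrix.add_apply, Matrix.add_apply, Matrix.map_apply, Matrix.mul_apply,
        Matrix.diagonal_apply] at h0 ⊢
      rw [← e.sum_comp]
      simp only [hδ, hι, e.apply_eq_iff_eq]
      exact h0
  let f : Matrix X.Gen Y.Gen A := fun g y => if e g = y then C.idem (X.ι g) else 0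
  let f' : Matrix Y.Gen X.Gen A := fun y g => if e g = y then C.idem (X.ι g) else 0
  have hf : ∀ (w : Y.Gen → A) g, ∑ y, f g y * w y = C.idem (X.ι g) * w (e g) := fun w g => by
    rw [Finset.sum_eq_single_of_mem (e g) (Finset.mem_univ _) fun y _ hy => by
      rw [show f g y = 0 from if_neg (Ne.symm hy), zero_mul]]
    rw [show f g (e g) = C.idem (X.ι g) from if_pos rfl]
  have hf' : ∀ (w : X.Gen → A) h, ∑ g, w g * f g (e h) = w h * C.idem (X.ι h) := fun w h => by
    rw [Finset.sum_eq_single_of_mem h (Finset.mem_univ _) fun g _ hg => by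
      rw [show f g (e h) = 0 from if_neg (e.injective.ne hg), mul_zero]]
    rw [show f h (e h) = C.idem (X.ι h) from if_pos rfl]
  have hdf : ∀ g y, C.d (f g y) = 0 := fun g y => by
    rw [show f g y = if e g = y then C.idem (X.ι g) else 0 from rfl]
    split_ifs
    · exact C.d_idem _
    · exact map_zero _
  have hff : ∀ g y, f' y g = f g y := fun _ _ => rfl
  have h0 : ∀ Z : PreTypeD C, Z.dMor Z 0 = 0 := fun Z => by
    unfold PreTypeD.dMor
    rw [mul_zero, zero_mul, add_zero, add_zero]
    ext
    simp
  refine ⟨hX, hY, f, f', 0, 0, ?_, ?_, fun g h => by simp, fun g h => by simp, ?_, ?_, ?_, ?_⟩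
  · intro g y
    rw [show f g y = if e g = y then C.idem (X.ι g) else 0 from rfl]
    split_ifs with h
    · rw [← h, hι, idem_idem]
      exact ⟨rfl, rfl⟩
    · simp
  · intro y g
    rw [show f' y g = if e g = y then C.idem (X.ι g) else 0 from rfl]
    split_ifs with h
    · rw [← h, hι, idem_idem]
      exact ⟨rfl, rfl⟩
    · simp
  · ext g y
    obtain ⟨h, rfl⟩ := e.surjective y
    unfold PreTypeD.dMor
    rw [Matrix.add_apply, Matrix.add_apply, Matrix.map_apply, hdf, Matrix.mul_apply,
      Matrix.mul_apply, hf, hf', hδ, (hX.1 g h).1, (hX.1 g h).2, zero_add]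
    exact add_self_of_char_two (k := k) _
  · ext y h
    obtain ⟨g, rfl⟩ := e.surjective y
    unfold PreTypeD.dMor
    rw [Matrix.add_apply, Matrix.add_apply, Matrix.map_apply, hff, hdf, Matrix.mul_apply,
      Matrix.mul_apply, ← e.sum_comp]
    have e1 : ∑ u, Y.δ (e g) (e u) * f' (e u) h = X.δ g h := by
      rw [Finset.sum_eq_single_of_mem h (Finset.mem_univ _) fun u _ hu => by
        rw [show f' (e u) h = 0 from if_neg (e.injective.ne hu.symm), mul_zero]]
      rw [show f' (e h) h = C.idem (X.ι h) from if_pos rfl, hδ, (hX.1 g h).2]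
    have e2 : ∑ u, f' (e g) u * X.δ u h = X.δ g h := by
      rw [Finset.sum_eq_single_of_mem g (Finset.mem_univ _) fun u _ hu => by
        rw [show f' (e g) u = 0 from if_neg (e.injective.ne hu), zero_mul]]
      rw [show f' (e g) g = C.idem (X.ι g) from if_pos rfl, (hX.1 g h).1]
    rw [e1, e2, zero_add]
    exact add_self_of_char_two (k := k) _
  · rw [h0]
    ext g h
    rw [Matrix.add_apply, Matrix.mul_apply, hf, PreTypeD.one, Matrix.diagonal_apply]
    rw [show f' (e g) h = if e h = e g then C.idem (X.ι h) else 0 from rfl]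
    by_cases hg : g = h
    · subst hg
      rw [if_pos rfl, if_pos rfl, idem_idem]
      exact add_self_of_char_two (k := k) _
    · rw [if_neg hg, if_neg (e.injective.ne (Ne.symm hg)), mul_zero, add_zero]
      rfl
  · rw [h0]
    ext y y'
    obtain ⟨g, rfl⟩ := e.surjective y
    obtain ⟨h, rfl⟩ := e.surjective y'
    rw [Matrix.add_apply, Matrix.mul_apply, hf', PreTypeD.one, Matrix.diagonal_apply]
    rw [show f' (e g) h = if e h = e g then C.idem (X.ι h) else 0 from rfl]
    by_cases hg : g = h
    · subst hg
      rw [if_pos rfl, if_pos rfl, idem_idem, hι]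
      exact add_self_of_char_two (k := k) _
    · rw [if_neg (e.injective.ne hg), if_neg (e.injective.ne (Ne.symm hg)), zero_mul, add_zero]
      rfl

end Relabel

/-! ### The tensor product with `MarkedMin` -/

section Iterates

variable {k : Type} [CommRing k] [CharP k 2] {A B J E K : Type} [Ring A] [Algebra k A] [Ring B]
  [Algebra k B] [Fintype J] [Ring E] [Algebra k E] [Fintype K] {D : CurvedDG k B J}
  {F : CurvedDG k E K} {Y : PreDD D F}

/-- The iterate with one input, if the operation is a combination of linear maps; the structure map
of the type DD bimodule then enters only through its matrix. -/
theorem PreDD.iter_one_eq (hY : Y.toTypeD.IsTypeD) {Q : Type} [Fintype Q] (κ₁ κ : Y.Gen)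
    {φ : List B → A} (c : Q → k) (f : Q → B →ₗ[k] A) (h : ∀ b, φ [b] = ∑ q, c q • f q b) :
    Y.iter κ₁ 1 κ φ = ∑ q, c q • TensorProduct.map (f q) LinearMap.id (Y.mat κ κ₁) := by
  have key : ∀ q, TensorProduct.map (f q) LinearMap.id (Y.mat κ κ₁) =
      ∑ t, f q (Y.fst t κ κ₁) ⊗ₜ (Y.snd t κ κ₁ * F.idem (Y.ι₂ κ₁)) := by
    intro q
    rw [← (PreDA.toTypeD_mul_idem hY κ κ₁).2.1, map_id_mul_one_tmul,
      show Y.mat κ κ₁ = ∑ t, Y.fst t κ κ₁ ⊗ₜ Y.snd t κ κ₁ from rfl, map_sum, Finset.sum_mul]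
    refine Finset.sum_congr rfl fun t _ => ?_
    rw [TensorProduct.map_tmul, Algebra.TensorProduct.tmul_mul_tmul, mul_one, LinearMap.id_apply]
  rw [PreDD.iter_one]
  simp only [key, h, TensorProduct.sum_tmul, Finset.smul_sum, TensorProduct.smul_tmul']
  exact Finset.sum_comm

/-- The iterate with two inputs, if the operation is a combination of products of linear maps. -/
theorem PreDD.iter_two_eq (hY : Y.toTypeD.IsTypeD) {Q : Type} [Fintype Q] (κ₁ κ : Y.Gen)
    {φ : List B → A} (c : Q → k) (f g : Q → B →ₗ[k] A)
    (h : ∀ a b, φ [a, b] = ∑ q, c q • (f q a * g q b)) :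
    Y.iter κ₁ 2 κ φ = ∑ q, c q • ∑ κ', TensorProduct.map (f q) LinearMap.id (Y.mat κ κ') *
      TensorProduct.map (g q) LinearMap.id (Y.mat κ' κ₁) := by
  rw [PreDD.iter]
  simp only [Finset.smul_sum]
  rw [Finset.sum_comm (s := Finset.univ (α := Q))]
  refine Finset.sum_congr rfl fun κ' _ => ?_
  have h1 : ∀ t, Y.iter κ₁ 1 κ' (fun bs => φ (Y.fst t κ κ' :: bs)) =
      ∑ q, c q • TensorProduct.map (LinearMap.mulLeft k (f q (Y.fst t κ κ')) ∘ₗ g q) LinearMap.id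
        (Y.mat κ' κ₁) := fun t =>
    PreDD.iter_one_eq hY κ₁ κ' c (fun q => LinearMap.mulLeft k (f q (Y.fst t κ κ')) ∘ₗ g q)
      fun b => h _ b
  simp only [h1, Finset.mul_sum]
  rw [Finset.sum_comm]
  refine Finset.sum_congr rfl fun q _ => ?_
  rw [show Y.mat κ κ' = ∑ t, Y.fst t κ κ' ⊗ₜ Y.snd t κ κ' from rfl, map_sum, Finset.sum_mul,
    Finset.smul_sum]
  refine Finset.sum_congr rfl fun t _ => ?_
  rw [TensorProduct.map_tmul, mul_smul_comm]
  congr 1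
  induction Y.mat κ' κ₁ using TensorProduct.induction_on with
  | zero => simp
  | add a b ha hb => simp only [map_add, mul_add, ha, hb]
  | tmul b e =>
    simp only [TensorProduct.map_tmul, Algebra.TensorProduct.tmul_mul_tmul, one_mul,
      LinearMap.comp_apply, LinearMap.mulLeft_apply, LinearMap.id_apply]

end Iterates

section MinStates

variable {m r s : ℕ}

/-- The states of the type `T` in `MarkedMin` and in the dual module are complementary. -/
theorem MinType.admits_iff_compl (hrs : (r + 1) + (s + 1) = m + 2 + 1) {T : MinType}
    {x : IState (m + 2) (r + 1)} : T.Admits x ↔ T.DualAdmits (x.compl hrs) := by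
  have h0 := IState.compl_has_iff hrs x (t := 0) (by omega)
  have h1 := IState.compl_has_iff hrs x (t := 1) (by omega)
  have h2 := IState.compl_has_iff hrs x (t := 2) (by omega)
  cases T <;> simp only [MinType.Admits, MinType.DualAdmits, h0, h1, h2, not_not]

theorem IState.compl_compl (hrs : r + s = m + 1) (hsr : s + r = m + 1) (x : IState m r) :
    (x.compl hrs).compl hsr = x := Subtype.ext (_root_.compl_compl x.1)

/-- The map `ψ` commutes with complements. -/
theorem psi_compl (hrs : r + s = m + 1) (hrs' : (r + 1) + (s + 1) = m + 2 + 1)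
    {x : IState (m + 2) (r + 1)} (hx : x.Preferred) (hx' : (x.compl hrs').Preferred) :
    psi (x.compl hrs') hx' = (psi x hx).compl hrs := by
  apply IState.ext_height_fin
  intro i
  have h1 := IState.height_compl hrs (psi x hx) (t := i.val + 1) (by omega)
  have h2 := IState.height_compl hrs' x (t := i.val + 1 + 2) (by omega)
  rw [psi_height _ _ _ (by omega)] at h1 ⊢
  omega

theorem tailWeight_single_zero (c : ℕ) :
    tailWeight (Finsupp.single (0 : Fin (m + 2)) c) = 0 := by
  ext i
  rw [tailWeight_apply, Finsupp.single_eq_of_ne (Fin.succ_ne_zero _)]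
  rfl

theorem tailWeight_single_one (c : ℕ) :
    tailWeight (Finsupp.single (1 : Fin (m + 2)) c) = 0 := by
  ext i
  have h1 : i.succ.succ ≠ (1 : Fin (m + 2)) := fun h => Fin.succ_ne_zero _ (Fin.succ_injective _ h)
  rw [tailWeight_apply, Finsupp.single_eq_of_ne h1]
  rfl

theorem tailWeight_single_succ (i : Fin m) (c : ℕ) :
    tailWeight (Finsupp.single i.succ.succ c) = Finsupp.single i c := by
  ext j
  rw [tailWeight_apply, Finsupp.single_apply, Finsupp.single_apply]
  simp only [Fin.succ_inj]

end MinStates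

section MinLetters

variable {k : Type} [CommRing k] {m r s : ℕ}

theorem MinType.Admits.has_zero_iff {T : MinType} {x : IState m r} (h : T.Admits x) :
    ¬ x.Has 0 ↔ T.h₁ = 0 := by
  cases T <;> simp only [MinType.Admits] at h <;> simp [MinType.h₁, h]

theorem MinType.Admits.has_or_iff {T : MinType} {x : IState m r} (h : T.Admits x) :
    (x.Has 0 ∨ x.Has 1) ↔ T.h₂ = 1 := by
  cases T <;> simp only [MinType.Admits] at h <;> simp [MinType.h₂, h]

variable (k) in
/-- The element `1` or `E_i` of the Clifford algebra (with `i = 1` for the first and `i = 2` for the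
second kind of input factors) that accompanies the input factors of this kind between the states
admitted by two types. -/
def letterCliff (M : Matching m) : Letter → MinType → MinType → CliffordAlgebra (M.extend.quad k)
  | .one, _, _ => 0
  | .first, T, S =>
      if T.h₂ = 1 ∧ S.h₂ = 1 then (if T.h₁ = S.h₁ then M.extend.e k 0 else 1) else 0
  | .second, T, S =>
      if T.h₁ = 0 ∧ S.h₁ = 0 then (if T.h₂ = S.h₂ then M.extend.e k 1 else 1) else 0

variable (hrs : r + s = m + 1) (hrs' : (r + 1) + (s + 1) = m + 2 + 1) {T S : MinType}
  {x y : IState (m + 2) (r + 1)}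

/-- The map `minShrink`, tensored with the identity. -/
def minTens (w z : k) (M : Matching m) (s : ℕ) (l : Letter) (hx : T.Admits x) (hy : S.Admits y) :
    Blg k (m + 2) (r + 1) ⊗[k] DuAlg k M.extend (s + 1) →ₗ[k]
      Blg k m r ⊗[k] DuAlg k M.extend (s + 1) :=
  TensorProduct.map (minShrink k w z l hx hy) LinearMap.id

variable (w z : k) (M : Matching m) (l : Letter)

theorem minTens_canonLR (hx : T.Admits x) (hy : S.Admits y) (i : Fin (m + 2)) :
    minTens w z M s l hx hy (canonLR k M.extend hrs' i x y) =
      l.coef w z x y (Finsupp.single i 1 0) (Finsupp.single i 1 1) •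
        (Blg.mon k (psi x hx.mpreferred.1) (psi y hy.mpreferred.1)
          (tailWeight (Finsupp.single i 1)) ⊗ₜ[k]
        (Blg.mon k (x.compl hrs') (y.compl hrs') (Finsupp.single i 1) ⊗ₜ[k] 1)) := by
  classical
  by_cases h : IsWeight x y (Finsupp.single i 1)
  · change Blg.shrink k w z l x y _ _ (Blg.mon k x y (Finsupp.single i 1)) ⊗ₜ _ = _
    rw [Blg.shrink_mon, if_pos ⟨rfl, rfl, h⟩, TensorProduct.smul_tmul']
    rfl
  · rw [canonLR, Blg.mon_of_not_isWeight fun h' => h ((isWeight_compl_iff hrs').1 h')]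
    simp

theorem minTens_canonUE (hx : T.Admits x) (hy : S.Admits y) (i : Fin (m + 2)) :
    minTens w z M s l hx hy (canonUE k M.extend hrs' i x y) =
      l.coef w z x y (Finsupp.single i 2 0) (Finsupp.single i 2 1) •
        (Blg.mon k (psi x hx.mpreferred.1) (psi y hy.mpreferred.1)
          (tailWeight (Finsupp.single i 2)) ⊗ₜ[k]
        (Blg.mon k (x.compl hrs') (y.compl hrs') 0 ⊗ₜ[k] M.extend.e k i)) := by
  classical
  by_cases h : x = y
  · subst h
    change Blg.shrink k w z l x x _ _ (Blg.mon k x x (Finsupp.single i 2)) ⊗ₜ _ = _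
    rw [Blg.shrink_mon, if_pos ⟨rfl, rfl, isWeight_two x i⟩, TensorProduct.smul_tmul']
    rfl
  · rw [canonUE_of_ne hrs' i h, map_zero,
      Blg.mon_zero_of_ne fun h' => h (IState.compl_injective hrs' h')]
    simp

theorem minTens_canonMat_of_ne (hx : T.Admits x) (hy : S.Admits y) {p q : IState (m + 2) (r + 1)}
    (h : ¬ (x = p ∧ y = q)) :
    minTens w z M s l hx hy (canonMat k M.extend hrs' p q) = 0 := by
  classical
  rw [canonMat, map_sum]
  refine Finset.sum_eq_zero fun i _ => ?_
  have key : ∀ W, minShrink k w z l hx hy (Blg.mon k p q W) = 0 := fun W => by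
    refine (Blg.shrink_mon l hx.mpreferred hy.mpreferred p q W).trans (if_neg fun h' => ?_)
    exact h ⟨h'.1, h'.2.1⟩
  rw [map_add, canonLR, canonUE, minTens, TensorProduct.map_tmul, TensorProduct.map_tmul, key, key,
    TensorProduct.zero_tmul, TensorProduct.zero_tmul, add_zero]

/-- The inputs without first and second weights are those of the dual module. -/
theorem minTens_one_canonMat (hx : T.Admits x) (hy : S.Admits y) :
    minTens w z M s .one hx hy (canonMat k M.extend hrs' x y) =
      ∑ i : Fin m,
        (Blg.mon k (psi x hx.mpreferred.1) (psi y hy.mpreferred.1) (Finsupp.single i 1) ⊗ₜ[k]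
          (Blg.mon k (x.compl hrs') (y.compl hrs') (Finsupp.single i.succ.succ 1) ⊗ₜ[k] 1) +
        Blg.mon k (psi x hx.mpreferred.1) (psi y hy.mpreferred.1) (Finsupp.single i 2) ⊗ₜ[k]
          (Blg.mon k (x.compl hrs') (y.compl hrs') 0 ⊗ₜ[k] M.extend.e k i.succ.succ)) := by
  have h1 : ∀ i : Fin m, i.succ.succ ≠ (1 : Fin (m + 2)) := fun i h =>
    Fin.succ_ne_zero _ (Fin.succ_injective _ h)
  rw [canonMat, map_sum, sum_fin_add_two]
  simp only [map_add, minTens_canonLR, minTens_canonUE, tailWeight_single_succ]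
  simp [Letter.coef, h1]

theorem Blg.mon_single_zero_eq {x y : IState (m + 2) (r + 1)} (hx : T.DualAdmits x)
    (hy : S.DualAdmits y) (h₂ : T.h₂ = S.h₂) :
    Blg.mon k x y (Finsupp.single 0 1) = if T.h₁ = S.h₁ then 0 else Blg.mon k x y (T.step S) := by
  have hT := T.h₁_le
  have hS := S.h₁_le
  have hx' := (dualAdmits_iff.1 hx).1
  have hy' := (dualAdmits_iff.1 hy).1
  split_ifs with h₁
  · refine Blg.mon_of_not_isWeight fun h => ?_
    obtain ⟨t, ht⟩ := h 0
    rw [Finsupp.single_eq_same] at ht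
    change 1 = ((x.height 1 : ℤ) - y.height 1).natAbs + 2 * t at ht
    omega
  · rw [MinType.step, show ((T.h₁ : ℤ) - S.h₁).natAbs = 1 by omega,
      show ((T.h₂ : ℤ) - S.h₂).natAbs = 0 by omega, lowWeight_one_zero]

theorem Blg.mon_single_one_eq {x y : IState (m + 2) (r + 1)} (hx : T.DualAdmits x)
    (hy : S.DualAdmits y) (h₁ : T.h₁ = S.h₁) :
    Blg.mon k x y (Finsupp.single 1 1) = if T.h₂ = S.h₂ then 0 else Blg.mon k x y (T.step S) := by
  have hT := T.h₁_le
  have hS := S.h₁_le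
  have hx' := (dualAdmits_iff.1 hx).2.1
  have hy' := (dualAdmits_iff.1 hy).2.1
  split_ifs with h₂
  · refine Blg.mon_of_not_isWeight fun h => ?_
    obtain ⟨t, ht⟩ := h 1
    rw [Finsupp.single_eq_same] at ht
    change 1 = ((x.height 2 : ℤ) - y.height 2).natAbs + 2 * t at ht
    omega
  · rw [MinType.step, show ((T.h₁ : ℤ) - S.h₁).natAbs = 0 by omega,
      show ((T.h₂ : ℤ) - S.h₂).natAbs = 1 by omega, lowWeight_zero_one]

theorem Blg.mon_zero_eq {x y : IState (m + 2) (r + 1)} (hx : T.DualAdmits x)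
    (hy : S.DualAdmits y) : Blg.mon k x y 0 =
      if T.h₁ = S.h₁ ∧ T.h₂ = S.h₂ then Blg.mon k x y (T.step S) else 0 := by
  split_ifs with h
  · rw [MinType.step_self h.1 h.2]
  · refine Blg.mon_zero_of_ne fun h' => h ?_
    subst h'
    have hx' := dualAdmits_iff.1 hx
    have hy' := dualAdmits_iff.1 hy
    omega

/-- The inputs with positive first weight, or with positive second weight, are those that occur as
coefficients of the arrows of the dual module. -/
theorem minTens_letter_canonMat (hx : T.Admits x) (hy : S.Admits y) (hl : l ≠ .one) :
    minTens w z M s l hx hy (canonMat k M.extend hrs' x y) =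
      Blg.mon k (psi x hx.mpreferred.1) (psi y hy.mpreferred.1) 0 ⊗ₜ[k]
        (Blg.mon k (x.compl hrs') (y.compl hrs') (T.step S) ⊗ₜ[k] letterCliff k M l T S) := by
  have hx' := (MinType.admits_iff_compl hrs').1 hx
  have hy' := (MinType.admits_iff_compl hrs').1 hy
  have h1 : ∀ i : Fin m, i.succ.succ ≠ (1 : Fin (m + 2)) := fun i h =>
    Fin.succ_ne_zero _ (Fin.succ_injective _ h)
  rw [canonMat, map_sum, sum_fin_add_two]
  simp only [map_add, minTens_canonLR, minTens_canonUE, tailWeight_single_zero,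
    tailWeight_single_one]
  match l, hl with
  | .first, _ =>
    simp only [Letter.coef, hx.has_or_iff, hy.has_or_iff, letterCliff]
    by_cases h : T.h₂ = 1 ∧ S.h₂ = 1
    · rw [if_pos h, Blg.mon_single_zero_eq hx' hy' (h.1.trans h.2.symm), Blg.mon_zero_eq hx' hy']
      have h2 : T.h₂ = S.h₂ := h.1.trans h.2.symm
      by_cases h' : T.h₁ = S.h₁ <;> simp [h, h', h1]
    · simp [h]
  | .second, _ =>
    simp only [Letter.coef, hx.has_zero_iff, hy.has_zero_iff, letterCliff]
    by_cases h : T.h₁ = 0 ∧ S.h₁ = 0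
    · rw [if_pos h, Blg.mon_single_one_eq hx' hy' (h.1.trans h.2.symm), Blg.mon_zero_eq hx' hy']
      by_cases h' : T.h₂ = S.h₂ <;> simp [h, h', h1]
    · have h' : ∀ p : Prop, ¬ (T.h₁ = 0 ∧ S.h₁ = 0 ∧ p) := fun p h' => h ⟨h'.1, h'.2.1⟩
      simp [h, h', -not_and]

/-- Two inputs as in `minTens_letter_canonMat`, with an intermediate state admitted by `X1`. -/
theorem sum_minTens_mul_minTens (hx : T.Admits x) (hy : S.Admits y) {l l' : Letter}
    (hl : l ≠ .one) (hl' : l' ≠ .one)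
    [Fintype {u : IState (m + 2) (r + 1) // MinType.X1.Admits u}] :
    ∑ u : {u : IState (m + 2) (r + 1) // MinType.X1.Admits u},
      minTens w z M s l hx u.2 (canonMat k M.extend hrs' x u.1) *
        minTens w z M s l' u.2 hy (canonMat k M.extend hrs' u.1 y) =
      Blg.mon k (psi x hx.mpreferred.1) (psi y hy.mpreferred.1) 0 ⊗ₜ[k]
        (Blg.mon k (x.compl hrs') (y.compl hrs') (T.step .X1 + MinType.X1.step S) ⊗ₜ[k]
          (letterCliff k M l T .X1 * letterCliff k M l' .X1 S)) := by
  classical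
  have hx' := (MinType.admits_iff_compl hrs').1 hx
  have hy' := (MinType.admits_iff_compl hrs').1 hy
  have hsr' : (s + 1) + (r + 1) = m + 2 + 1 := by omega
  have hrs : r + s = m + 1 := by omega
  rw [← sum_step_mul_mon hx' hy', TensorProduct.sum_tmul, TensorProduct.tmul_sum]
  refine Fintype.sum_equiv ((Equiv.ofBijective (IState.compl hrs')
    ⟨IState.compl_injective hrs', fun v =>
      ⟨v.compl hsr', IState.compl_compl hsr' hrs' v⟩⟩).subtypeEquiv
        fun u => MinType.admits_iff_compl hrs') _ _ fun u => ?_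
  rw [minTens_letter_canonMat hrs' w z M l hx u.2 hl,
    minTens_letter_canonMat hrs' w z M l' u.2 hy hl',
    Algebra.TensorProduct.tmul_mul_tmul, Algebra.TensorProduct.tmul_mul_tmul]
  have hu' := (MinType.admits_iff_compl hrs').1 u.2
  change _ = Blg.mon k (psi x hx.mpreferred.1) (psi y hy.mpreferred.1) 0 ⊗ₜ[k]
    ((Blg.mon k (x.compl hrs') (u.1.compl hrs') (T.step .X1) *
      Blg.mon k (u.1.compl hrs') (y.compl hrs') (MinType.X1.step S)) ⊗ₜ[k] _)
  by_cases h : psi x hx.mpreferred.1 = psi u.1 u.2.mpreferred.1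
  · rw [← h, ← Blg.idem_eq_mon, Blg.idem_mul_mon]
  · rw [Blg.mon_of_not_isWeight (x := x.compl hrs') fun h' => h ?_]
    · simp
    · rw [isWeight_step_iff hx' hu', psi_compl hrs hrs' hx.mpreferred.1,
        psi_compl hrs hrs' u.2.mpreferred.1] at h'
      exact IState.compl_injective hrs h'

end MinLetters

section MinBox

variable {k : Type} [CommRing k] {m r s : ℕ}

theorem minCoef₀_smul (w z : k) {V : Type} [AddCommGroup V] [Module k V] (T S : MinType)
    (f : (Fin (m + 2) →₀ ℕ) → V) :
    minCoef₀ w z T S • f (T.step S) = minCoef₀ w z T S • f 0 := by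
  by_cases h : T.h₁ = S.h₁ ∧ T.h₂ = S.h₂
  · rw [MinType.step_self h.1 h.2]
  · cases T <;> cases S <;> simp [MinType.h₁, MinType.h₂] at h <;> simp [minCoef₀]

theorem minCoef₂_smul {V : Type} [AddCommGroup V] [Module k V] (T S : MinType) (l l' : Letter)
    (f : (Fin (m + 2) →₀ ℕ) → V) :
    (minCoef₂ T S l l' : k) • f (T.step .X1 + MinType.X1.step S) =
      (minCoef₂ T S l l' : k) • f (T.step S) := by
  by_cases h : (T.h₁ : ℤ) * S.h₁ = 0 ∧ (1 - T.h₂ : ℤ) * (1 - S.h₂) = 0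
  · congr 2
    unfold MinType.step
    rw [lowWeight_add]
    cases T <;> cases S <;> first | rfl | simp [MinType.h₁, MinType.h₂] at h
  · cases T <;> cases S <;> simp [MinType.h₁, MinType.h₂] at h <;>
      cases l <;> cases l' <;> simp [minCoef₂]

theorem minCoef₁_one (w z : k) (T S : MinType) :
    minCoef₁ w z T S .one = if T = S then 1 else 0 := by
  cases T <;> cases S <;> simp [minCoef₁]

/-- The operations of `MarkedMin` with no, one and two inputs add up to the arrows of the dual
module. Of the powers of `U₁` and `U₂` in the inputs, only those of lowest order meet the canonical
bimodule; the two operations `X1 → Y1` with two inputs give `E₁ E₂ + E₂ E₁ = 1`. -/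
theorem sum_minCoef_smul (w z : k) (M : Matching m) (T S : MinType) :
    minCoef₀ w z T S • (1 : CliffordAlgebra (M.extend.quad k)) +
      (minCoef₁ w z T S .first • letterCliff k M .first T S +
        minCoef₁ w z T S .second • letterCliff k M .second T S) +
      ((minCoef₂ T S .first .second : k) •
          (letterCliff k M .first T .X1 * letterCliff k M .second .X1 S) +
        (minCoef₂ T S .second .first : k) •
          (letterCliff k M .second T .X1 * letterCliff k M .first .X1 S)) =
      dualCliff k w z M T S := by
  have h := M.extend_e_zero_e_one (k := k)
  cases T <;> cases S <;>
    simp [minCoef₀, minCoef₁, minCoef₂, letterCliff, dualCliff, MinType.h₁, MinType.h₂, h]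

end MinBox

/-! ### The comparison of the two tensor products -/

section Comparison

variable {k : Type} [CommRing k] {m r s : ℕ}

open Classical in
variable (k) in
/-- The common value of the structure maps of the two tensor products, for generators given by types
and by states for `B(m + 2, r + 1)`. -/
def boxFormula (w z : k) (M : Matching m) (hrs' : (r + 1) + (s + 1) = m + 2 + 1) {T S : MinType}
    {x y : IState (m + 2) (r + 1)} (hx : T.Admits x) (hy : S.Admits y) :
    Blg k m r ⊗[k] DuAlg k M.extend (s + 1) :=
  Blg.mon k (psi x hx.mpreferred.1) (psi y hy.mpreferred.1) 0 ⊗ₜ[k]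
    (Blg.mon k (x.compl hrs') (y.compl hrs') (T.step S) ⊗ₜ[k] dualCliff k w z M T S) +
  if T = S then ∑ i : Fin m,
    (Blg.mon k (psi x hx.mpreferred.1) (psi y hy.mpreferred.1) (Finsupp.single i 1) ⊗ₜ[k]
      (Blg.mon k (x.compl hrs') (y.compl hrs') (Finsupp.single i.succ.succ 1) ⊗ₜ[k] 1) +
    Blg.mon k (psi x hx.mpreferred.1) (psi y hy.mpreferred.1) (Finsupp.single i 2) ⊗ₜ[k]
      (Blg.mon k (x.compl hrs') (y.compl hrs') 0 ⊗ₜ[k] M.extend.e k i.succ.succ)) else 0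

variable [CharP k 2] (w z : k) (M : Matching m) (hrs : r + s = m + 1)
  (hrs' : (r + 1) + (s + 1) = m + 2 + 1) {T S : MinType} {x y : IState (m + 2) (r + 1)}

theorem markedMin_of_three_le {bs : List (Blg k (m + 2) (r + 1))} (h : 3 ≤ bs.length) :
    (markedMin k w z M r).δ bs = 0 := by
  match bs with
  | [] => simp at h
  | [_] => simp at h
  | [_, _] => simp at h
  | _ :: _ :: _ :: _ => rfl

theorem iter_markedMin_zero (hx : T.Admits x) (hy : S.Admits y) :
    (canonDD k M.extend hrs').iter y 0 x
      (fun bs => (markedMin k w z M r).δ bs ⟨(T, x), hx⟩ ⟨(S, y), hy⟩) =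
    minCoef₀ w z T S • (Blg.mon k (psi x hx.mpreferred.1) (psi y hy.mpreferred.1) 0 ⊗ₜ[k]
      (Blg.mon k (x.compl hrs') (y.compl hrs') (T.step S) ⊗ₜ[k]
        (1 : CliffordAlgebra (M.extend.quad k)))) := by
  classical
  refine (PreDD.iter_zero _ _ _ _).trans ?_
  rw [minCoef₀_smul w z T S fun W =>
    Blg.mon k (psi x hx.mpreferred.1) (psi y hy.mpreferred.1) 0 ⊗ₜ[k]
      (Blg.mon k (x.compl hrs') (y.compl hrs') W ⊗ₜ[k] (1 : CliffordAlgebra (M.extend.quad k)))]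
  by_cases h : x = y
  · subst h
    refine (if_pos rfl).trans ?_
    change (if x = x then minCoef₀ w z T S • Blg.idem k (psi x _) else 0) ⊗ₜ[k]
      (Blg.idem k (x.compl hrs') ⊗ₜ[k] (1 : CliffordAlgebra (M.extend.quad k))) = _
    rw [if_pos rfl, TensorProduct.smul_tmul', Blg.idem_eq_mon, Blg.idem_eq_mon]
  · refine (if_neg h).trans ?_
    rw [Blg.mon_zero_of_ne fun h' => h (IState.compl_injective hrs' h')]
    simp

theorem univ_letter : (Finset.univ : Finset Letter) = {.one, .first, .second} := rfl

theorem sum_letter {V : Type} [AddCommMonoid V] (f : Letter → V) :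
    ∑ l, f l = f .one + (f .first + f .second) := by
  rw [univ_letter, Finset.sum_insert (by decide), Finset.sum_insert (by decide),
    Finset.sum_singleton]

theorem iter_markedMin_one (hx : T.Admits x) (hy : S.Admits y) :
    (canonDD k M.extend hrs').iter y 1 x
      (fun bs => (markedMin k w z M r).δ bs ⟨(T, x), hx⟩ ⟨(S, y), hy⟩) =
    ∑ l, minCoef₁ w z T S l • minTens w z M s l hx hy (canonMat k M.extend hrs' x y) := by
  have h := PreDD.iter_one_eq (canonDD_isTypeD (k := k) M.extend hrs') y x
    (φ := fun bs => (markedMin k w z M r).δ bs ⟨(T, x), hx⟩ ⟨(S, y), hy⟩)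
    (minCoef₁ w z T S) (fun l => minShrink k w z l hx hy) (fun b => rfl)
  rw [canonDD_mat] at h
  exact h

open Classical in
theorem iter_markedMin_two (hx : T.Admits x) (hy : S.Admits y) :
    (canonDD k M.extend hrs').iter y 2 x
      (fun bs => (markedMin k w z M r).δ bs ⟨(T, x), hx⟩ ⟨(S, y), hy⟩) =
    ∑ l, ∑ l', (minCoef₂ T S l l' : k) •
      ∑ u : {u : IState (m + 2) (r + 1) // MinType.X1.Admits u},
        minTens w z M s l hx u.2 (canonMat k M.extend hrs' x u.1) *
          minTens w z M s l' u.2 hy (canonMat k M.extend hrs' u.1 y) := by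
  have h := PreDD.iter_two_eq (canonDD_isTypeD (k := k) M.extend hrs') y x
    (φ := fun bs => (markedMin k w z M r).δ bs ⟨(T, x), hx⟩ ⟨(S, y), hy⟩)
    (Q := Letter × Letter × {u : IState (m + 2) (r + 1) // MinType.X1.Admits u})
    (fun q => minCoef₂ T S q.1 q.2.1) (fun q => minShrink k w z q.1 hx q.2.2.2)
    (fun q => minShrink k w z q.2.1 q.2.2.2 hy) (fun a b => by
      rw [Fintype.sum_prod_type]
      simp only [Fintype.sum_prod_type]
      rfl)
  rw [canonDD_mat] at h
  refine h.trans ?_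
  rw [Fintype.sum_prod_type]
  simp only [Fintype.sum_prod_type]
  refine Finset.sum_congr rfl fun l _ => Finset.sum_congr rfl fun l' _ => ?_
  rw [Finset.smul_sum]
  refine Finset.sum_congr rfl fun u _ => congrArg _ ?_
  refine Finset.sum_eq_single_of_mem (f := fun v : IState (m + 2) (r + 1) =>
    minTens w z M s l hx u.2 (canonMat k M.extend hrs' x v) *
      minTens w z M s l' u.2 hy (canonMat k M.extend hrs' v y)) u.1
    (Finset.mem_univ _) fun v _ hv => ?_
  rw [minTens_canonMat_of_ne hrs' w z M l hx u.2 fun h => hv h.2.symm, zero_mul]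

/-- The structure map of the tensor product with `MarkedMin`. -/
theorem markedMin_box_δ (hx : T.Admits x) (hy : S.Admits y) :
    ((markedMin k w z M r).box (canonDD k M.extend hrs')).δ ⟨(⟨(T, x), hx⟩, x), rfl⟩
      ⟨(⟨(S, y), hy⟩, y), rfl⟩ = boxFormula k w z M hrs' hx hy := by
  classical
  change (∑ᶠ j : ℕ, (canonDD k M.extend hrs').iter y j x
    (fun bs => (markedMin k w z M r).δ bs ⟨(T, x), hx⟩ ⟨(S, y), hy⟩)) = _
  rw [finsum_eq_sum_of_support_subset (s := Finset.range 3)]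
  · rw [Finset.sum_range_succ, Finset.sum_range_succ, Finset.sum_range_one, iter_markedMin_zero,
      iter_markedMin_one, iter_markedMin_two]
    have hsum : ∀ l l' : Letter, (minCoef₂ T S l l' : k) •
        ∑ u : {u : IState (m + 2) (r + 1) // MinType.X1.Admits u},
          minTens w z M s l hx u.2 (canonMat k M.extend hrs' x u.1) *
            minTens w z M s l' u.2 hy (canonMat k M.extend hrs' u.1 y) =
        (minCoef₂ T S l l' : k) •
          (Blg.mon k (psi x hx.mpreferred.1) (psi y hy.mpreferred.1) 0 ⊗ₜ[k]
            (Blg.mon k (x.compl hrs') (y.compl hrs') (T.step S) ⊗ₜ[k]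
              (letterCliff k M l T .X1 * letterCliff k M l' .X1 S))) := by
      intro l l'
      by_cases hl : l = .one ∨ l' = .one
      · have : (minCoef₂ T S l l' : k) = 0 := by
          rcases hl with rfl | rfl
          · cases T <;> cases S <;> rfl
          · cases T <;> cases S <;> cases l <;> rfl
        rw [this, zero_smul, zero_smul]
      · rw [sum_minTens_mul_minTens hrs' w z M hx hy (fun h => hl (Or.inl h))
          (fun h => hl (Or.inr h))]
        exact minCoef₂_smul T S l l' fun W =>
          Blg.mon k (psi x hx.mpreferred.1) (psi y hy.mpreferred.1) 0 ⊗ₜ[k]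
            (Blg.mon k (x.compl hrs') (y.compl hrs') W ⊗ₜ[k]
              (letterCliff k M l T .X1 * letterCliff k M l' .X1 S))
    have h11 : (minCoef₂ T S .first .first : k) = 0 := by cases T <;> cases S <;> rfl
    have h22 : (minCoef₂ T S .second .second : k) = 0 := by cases T <;> cases S <;> rfl
    simp only [hsum]
    simp only [sum_letter, minTens_one_canonMat, letterCliff, h11, h22, zero_smul, zero_mul,
      mul_zero, TensorProduct.tmul_zero, smul_zero, zero_add, add_zero, minCoef₁_one,
      minTens_letter_canonMat hrs' w z M .first hx hy (by decide),
      minTens_letter_canonMat hrs' w z M .second hx hy (by decide)]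
    rw [boxFormula, ← sum_minCoef_smul]
    simp only [letterCliff, TensorProduct.tmul_add, TensorProduct.tmul_smul, ite_smul, one_smul,
      zero_smul]
    abel
  · intro j hj
    rw [Function.mem_support] at hj
    rw [Finset.coe_range, Set.mem_Iio]
    by_contra h
    refine hj (PreDD.iter_eq_zero _ _ _ _ _ fun bs hbs => ?_)
    rw [markedMin_of_three_le w z M (by omega)]
    rfl


/-- The structure map of the tensor product with the dual module. -/
theorem dualMarkedMin_box_δ (hx : T.Admits x) (hy : S.Admits y)
    (hx' : T.DualAdmits (x.compl hrs')) (hy' : S.DualAdmits (y.compl hrs'))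
    (hpx : psi (x.compl hrs') hx'.preferred = (psi x hx.mpreferred.1).compl hrs)
    (hpy : psi (y.compl hrs') hy'.preferred = (psi y hy.mpreferred.1).compl hrs) :
    ((dualMarkedMin k w z M s).box (canonDD k M hrs).swap).swap.δ
      ⟨(⟨(T, x.compl hrs'), hx'⟩, psi x hx.mpreferred.1), hpx⟩
      ⟨(⟨(S, y.compl hrs'), hy'⟩, psi y hy.mpreferred.1), hpy⟩ = boxFormula k w z M hrs' hx hy := by
  classical
  have hDA := dualMarkedMin_isTypeDA w z M (r := s)
  have hY : (canonDD k M hrs).swap.toTypeD.IsTypeD := by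
    rw [PreDD.swap_toTypeD]
    exact (canonDD_isTypeD M hrs).swap
  let g : DualMinGen (m + 2) (s + 1) := ⟨(T, x.compl hrs'), hx'⟩
  let h : DualMinGen (m + 2) (s + 1) := ⟨(S, y.compl hrs'), hy'⟩
  let p := psi x hx.mpreferred.1
  let q := psi y hy.mpreferred.1
  let σ := TensorProduct.comm k (DuAlg k M.extend (s + 1)) (Blg k m r)
  have hmat : (canonDD k M hrs).swap.mat p q =
      TensorProduct.comm k (Blg k m r) (DuAlg k M s) (canonMat k M hrs p q) := by
    rw [← canonDD_mat]
    exact (map_sum (TensorProduct.comm k (Blg k m r) (DuAlg k M s))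
      (fun t => (canonDD k M hrs).fst t p q ⊗ₜ[k] (canonDD k M hrs).snd t p q) _).symm
  have e1 : σ (@ite _ (p = q) (Classical.propDecidable _)
      ((dualMarkedMin k w z M s).δ [] g h ⊗ₜ Blg.idem k p) 0) =
      Blg.mon k p q 0 ⊗ₜ[k]
        (Blg.mon k (x.compl hrs') (y.compl hrs') (T.step S) ⊗ₜ[k] dualCliff k w z M T S) := by
    rw [dualMarkedMin_nil]
    by_cases hpq : p = q
    · rw [if_pos hpq, ← hpq, Blg.idem_eq_mon]
      rfl
    · rw [if_neg hpq, map_zero, Blg.mon_zero_of_ne hpq, TensorProduct.zero_tmul]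
  have e2 : σ (hDA.tens (Blg k m r) g h ((canonDD k M hrs).swap.mat p q)) =
      if T = S then ∑ i : Fin m, (Blg.mon k p q (Finsupp.single i 1) ⊗ₜ[k]
        (Blg.mon k (x.compl hrs') (y.compl hrs') (Finsupp.single i.succ.succ 1) ⊗ₜ[k] 1) +
      Blg.mon k p q (Finsupp.single i 2) ⊗ₜ[k]
        (Blg.mon k (x.compl hrs') (y.compl hrs') 0 ⊗ₜ[k] M.extend.e k i.succ.succ)) else 0 := by
    rw [hmat, canonMat, map_sum, map_sum, map_sum]
    have key : ∀ (b : DuAlg k M s) (c : Blg k m r),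
        σ (hDA.tens (Blg k m r) g h (TensorProduct.comm k _ _ (c ⊗ₜ[k] b))) =
          c ⊗ₜ[k] (dualMarkedMin k w z M s).δ [b] g h := fun b c => rfl
    split_ifs with hTS
    · subst hTS
      refine Finset.sum_congr rfl fun i _ => ?_
      simp only [map_add, canonLR, canonUE, key]
      rw [dualMarkedMin_singleton w z M hx' hy', dualMarkedMin_singleton w z M hx' hy',
        DuAlg.expand_tmul, DuAlg.expand_tmul, Blg.expand_mon, Blg.expand_mon, if_pos ⟨hpx, hpy⟩,
        if_pos ⟨hpx, hpy⟩, shiftWeight_single, map_one, Matching.e, M.shiftE_ι_single]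
      rw [show shiftWeight (0 : Fin m →₀ ℕ) = 0 from Finsupp.mapDomain_zero]
      rfl
    · refine Finset.sum_eq_zero fun i _ => ?_
      simp only [map_add, canonLR, canonUE, key]
      rw [dualMarkedMin_singleton_of_ne w z M hTS, dualMarkedMin_singleton_of_ne w z M hTS,
        TensorProduct.tmul_zero, TensorProduct.tmul_zero, add_zero]
  exact (congrArg σ (hDA.box_δ (fun bs => dualMarkedMin_of_two_le w z M) hY ⟨(g, p), hpx⟩
    ⟨(h, q), hpy⟩)).trans ((map_add σ _ _).trans (congrArg₂ (· + ·) e1 e2))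

theorem homotopyEquivalent_box :
    ((dualMarkedMin k w z M s).box (canonDD k M hrs).swap).swap.HomotopyEquivalent
      ((markedMin k w z M r).box (canonDD k M.extend hrs')) := by
  classical
  have hsr' : (s + 1) + (r + 1) = m + 2 + 1 := by omega
  let X := ((dualMarkedMin k w z M s).box (canonDD k M hrs).swap).swap
  let Y := (markedMin k w z M r).box (canonDD k M.extend hrs')
  have hX : X.IsTypeD := by
    refine ((dualMarkedMin_isTypeDA w z M).box_isTypeD (fun bs => dualMarkedMin_of_two_le w z M)
      (dualMarkedMin_isUnital w z M) ?_).swap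
    rw [PreDD.swap_toTypeD]
    exact (canonDD_isTypeD M hrs).swap
  let f : Y.Gen → X.Gen := fun p => ⟨(⟨(p.1.1.1.1, p.1.1.1.2.compl hrs'),
    (MinType.admits_iff_compl hrs').1 p.1.1.2⟩, psi p.1.1.1.2 p.1.1.2.mpreferred.1),
    psi_compl hrs hrs' p.1.1.2.mpreferred.1 ((MinType.admits_iff_compl hrs').1 p.1.1.2).preferred⟩
  have hf : Function.Bijective f := by
    constructor
    · rintro ⟨⟨⟨⟨T, x⟩, hx⟩, κ⟩, hκ : x = κ⟩ ⟨⟨⟨⟨S, y⟩, hy⟩, ν⟩, hν : y = ν⟩ h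
      subst hκ
      subst hν
      have h1 := congrArg (fun q : X.Gen => q.1.1.1) h
      obtain ⟨rfl, h3⟩ := Prod.ext_iff.1 h1
      obtain rfl := IState.compl_injective hrs' h3
      rfl
    · rintro ⟨⟨⟨⟨T, y⟩, hy⟩, κ⟩, hκ⟩
      obtain ⟨x, rfl⟩ : ∃ x : IState (m + 2) (r + 1), x.compl hrs' = y :=
        ⟨y.compl hsr', IState.compl_compl hsr' hrs' y⟩
      have hx := (MinType.admits_iff_compl hrs').2 hy
      obtain rfl : psi x hx.mpreferred.1 = κ :=
        IState.compl_injective hrs ((psi_compl hrs hrs' hx.mpreferred.1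
          (MinType.DualAdmits.preferred (T := T) hy)).symm.trans hκ)
      exact ⟨⟨(⟨(T, x), hx⟩, x), rfl⟩, rfl⟩
  refine PreTypeD.homotopyEquivalent_of_equiv (Equiv.ofBijective f hf).symm (fun g => ?_)
    (fun g h => ?_) hX
  · obtain ⟨p, rfl⟩ := (Equiv.ofBijective f hf).surjective g
    rw [Equiv.symm_apply_apply]
    obtain ⟨⟨⟨⟨T, x⟩, hx⟩, κ⟩, hκ : x = κ⟩ := p
    subst hκ
    rfl
  · obtain ⟨p, rfl⟩ := (Equiv.ofBijective f hf).surjective g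
    obtain ⟨q, rfl⟩ := (Equiv.ofBijective f hf).surjective h
    rw [Equiv.symm_apply_apply, Equiv.symm_apply_apply]
    obtain ⟨⟨⟨⟨T, x⟩, hx⟩, κ⟩, hκ : x = κ⟩ := p
    obtain ⟨⟨⟨⟨S, y⟩, hy⟩, ν⟩, hν : y = ν⟩ := q
    subst hκ
    subst hν
    exact (markedMin_box_δ w z M hrs' hx hy).trans
      (dualMarkedMin_box_δ w z M hrs hrs' hx hy _ _ _ _).symm

end Comparison

end

end LinkBordered

theorem mainTheorem9 (n : ℕ) (M₂ : LinkBordered.Matching (2 * n)) :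
    -- the dual module over `𝔽₂[w, z]` is a (strictly unital) type DA bimodule
    ((LinkBordered.dualMarkedMin (MvPolynomial (Fin 2) (ZMod 2))
        (MvPolynomial.X 0) (MvPolynomial.X 1) M₂ (n + 1)).IsTypeDA ∧
      (LinkBordered.dualMarkedMin (MvPolynomial (Fin 2) (ZMod 2))
        (MvPolynomial.X 0) (MvPolynomial.X 1) M₂ (n + 1)).IsUnital) ∧
    -- its tensor product with the canonical bimodule is that of `MarkedMin`
    (((LinkBordered.dualMarkedMin (MvPolynomial (Fin 2) (ZMod 2))
          (MvPolynomial.X 0) (MvPolynomial.X 1) M₂ (n + 1)).box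
        (LinkBordered.canonDD (MvPolynomial (Fin 2) (ZMod 2)) M₂
          (r := n) (s := n + 1) (by omega)).swap).swap).HomotopyEquivalent
      ((LinkBordered.markedMin (MvPolynomial (Fin 2) (ZMod 2))
          (MvPolynomial.X 0) (MvPolynomial.X 1) M₂ n).box
        (LinkBordered.canonDD (MvPolynomial (Fin 2) (ZMod 2)) M₂.extend
          (r := n + 1) (s := n + 2) (by omega))) ∧
    -- the same for the hat versions, that is, over `𝔽₂` with `w = z = 0`
    ((LinkBordered.dualMarkedMin (ZMod 2) 0 0 M₂ (n + 1)).IsTypeDA ∧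
      (LinkBordered.dualMarkedMin (ZMod 2) 0 0 M₂ (n + 1)).IsUnital) ∧
    (((LinkBordered.dualMarkedMin (ZMod 2) 0 0 M₂ (n + 1)).box
        (LinkBordered.canonDD (ZMod 2) M₂ (r := n) (s := n + 1) (by omega)).swap).swap).HomotopyEquivalent
      ((LinkBordered.markedMin (ZMod 2) 0 0 M₂ n).box
        (LinkBordered.canonDD (ZMod 2) M₂.extend (r := n + 1) (s := n + 2) (by omega))) := by
  exact ⟨⟨LinkBordered.dualMarkedMin_isTypeDA _ _ M₂, LinkBordered.dualMarkedMin_isUnital _ _ M₂⟩,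
    LinkBordered.homotopyEquivalent_box _ _ M₂ (by omega) (by omega),
    ⟨LinkBordered.dualMarkedMin_isTypeDA _ _ M₂, LinkBordered.dualMarkedMin_isUnital _ _ M₂⟩,
    LinkBordered.homotopyEquivalent_box _ _ M₂ (by omega) (by omega)⟩
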